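/- **Setting.** Let $S$ be a commutative ring in which $2$ and $3$ are invertible. *Webs.* A web in a disc with marked, oriented boundary points $\partial$ is a finite oriented planar graph with boundary $\partial$, all of whose interior vertices are trivalent and either sinks ("inwards") or sources ("outwards"); vertexless closed loops are allowed. The three edges at a vertex are cyclically ordered: anticlockwise at sinks, clockwise at sources. *Foams.* A foam (seamed cobordism) $F$ from a web $D_1$ to a web $D_2$ with the same boundary $\partial$ is an abstract (not embedded) compact $2$-complex, considered up to homeomorphism fixing the boundary, that is an oriented surface away from singular curves (seams); at each seam exactly three sheets meet, they induce the same orientation on the seam, and they carry a cyclic order. The boundary of $F$ is identified with $D_1\cup D_2\cup(\partial\times[0,1])$ such that the orientations of the sheets induce the orientations of the edges of $D_1$ and the opposite ones of the edges of $D_2$, and the cyclic orders at seams agree with those at the vertices of $D_1$ and $D_2$. Foams are composed by gluing, and planar tangles act on them by gluing. *Standard foams.* For a circle $\bigcirc$, let $\mathrm{cap}_g:\bigcirc\to\emptyset$ and $\mathrm{cup}_g:\emptyset\to\bigcirc$ be the genus $g$ surface with one boundary circle. The *choking tori* $\mathrm{chcap}:\bigcirc\to\emptyset$ and $\mathrm{chcup}:\emptyset\to\bigcirc$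 consist of an annulus at the circle ("bulk"), a one-holed torus ("handle") and a disc, meeting along one closed seam in the cyclic order bulk, handle, disc. For a bigon web $\mathsf B$ (a strand $|$ in which a segment is replaced by two parallel edges), let $b:\mathsf B\to|$ and $b':|\to\mathsf B$ be the half bubbles: one seam arc joins the two vertices, and it bounds the sheet of the strand and one disc for each of the two edges of the bigon. Let $k:\mathsf B\to|$ and $k':|\to\mathsf B$ be obtained from $b,b'$ by composing with a zip followed by an unzip of the two edges of the bigon; that is, the two discs are punctured and glued, together with a new disc, along a closed seam with cyclic order new disc, first sheet, second sheet, where the second sheet follows the first in the cyclic order (strand, first, second) at the vertices. For an oriented square web $\mathsf Q$ (four trivalent vertices, alternately sinks and sources, and four outer legs) with smoothings $\mathsf H$ (two horizontal strands) and $\mathsf V$ (two vertical strands), let $r_H:\mathsf Q\to\mathsf H$ and $r_H':\mathsf H\to\mathsf Q$ be the half rockets with two seam arcs, one for each horizontal side of the square: at each arc meet the sheet of a strand of $\mathsf H$, a disc bounded by that side of the square and the arc, and one disc, common to both arcs, that contains the two vertical sides. Let $r_V,r_V'$ be defined in the same way with horizontal and vertical exchanged. *Local relations.* (1) Sphere $=0$;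 torus $=3$; closed genus $2$ surface $=0$; the closed foam formed by one-holed surfaces of genus $2$, $1$, $0$ glued along a single seam $=0$. (2) Neck cutting: $\mathrm{id}_\bigcirc=\tfrac13\,\mathrm{cup}_0\mathrm{cap}_1-\tfrac19\,\mathrm{chcup}\,\mathrm{chcap}+\tfrac13\,\mathrm{cup}_1\mathrm{cap}_0$. (3) Airlock: the cylinder with two separating discs glued in along closed seams, with cyclic order middle annulus, outer annulus, disc at both seams, equals $-\mathrm{cup}_0\mathrm{cap}_0$. (4) Tube: $\mathrm{id}_{\mathsf B}=\tfrac12\,b'k+\tfrac12\,k'b$. (5) Three rocket: $\mathrm{id}_{\mathsf Q}+r_H'r_H+r_V'r_V=0$. (6) Seam-swap: reversing the cyclic order of the sheets at a closed seam multiplies a foam by $-1$. *The category.* $\mathrm{Cob}_3$ has as objects formally shifted webs $q^mD$, $m\in\mathbb Z$. Morphisms between webs with the same boundary are the $S$-module spanned by foams modulo the local relations, imposed locally (that is, modulo the ideal they generate under composition and planar operations). A foam $C$ from $q^{m_1}D_1$ to $q^{m_2}D_2$ has degree $2\chi(C)-|\partial|+\tfrac12|V|+m_2-m_1$, where $|\partial|$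 is the number of boundary points of each $D_i$ and $|V|$ is the total number of trivalent vertices of $D_1$ and $D_2$. $\mathrm{Mat}(\mathrm{Cob}_3)$ is the category of formal finite direct sums and matrices of morphisms. **Theorem.** In $\mathrm{Mat}(\mathrm{Cob}_3)$ there are isomorphisms $$\bigcirc\;\cong\;q^{-2}\emptyset\oplus q^0\emptyset\oplus q^2\emptyset,\qquad \mathsf B\;\cong\;q^{-1}|\;\oplus\;q\,|,\qquad \mathsf Q\;\cong\;\mathsf H\oplus\mathsf V .$$ More precisely, each of the following three pairs of matrices consists of mutually inverse isomorphisms, and all their entries are homogeneous of degree $0$: 1. circle: $\varphi=\big(\mathrm{cap}_0,\ \tfrac13\,\mathrm{chcap},\ \tfrac13\,\mathrm{cap}_1\big)^{T}$ and $\varphi^{-1}=\big(\tfrac13\,\mathrm{cup}_1,\ -\tfrac13\,\mathrm{chcup},\ \mathrm{cup}_0\big)$; 2. bigon: $\varphi=\big(b,\ \tfrac12 k\big)^{T}$ and $\varphi^{-1}=\big(\tfrac12 k',\ b'\big)$; 3. square: $\varphi=\big(r_H,\ r_V\big)^{T}$ and $\varphi^{-1}=\big(-r_H',\ -r_V'\big)$.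 -/

import Mathlib

open CategoryTheory

/-! # Webs, seamed cobordisms (foams) and the `su(3)` foam category -/

namespace SeamedFoam

universe u

/-! ## Webs -/

/-- Half-edges at trivalent vertices `V` (three at each, cyclically ordered by `i ↦ i + 1`),
marked points `M` of the interior of edges, and boundary points `X`. -/
abbrev Ends (V M X : Type) : Type := V × ZMod 3 ⊕ (M ⊕ X)

/-- A finite oriented trivalent graph (with a cell structure) all of whose trivalent vertices are
sinks (`Snk`, the inwards vertices) or sources (`Src`, the outwards vertices), whose boundary
consists of the points `I` (where a strand enters the disc) and `O` (where a strand leaves it).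
Edges may be subdivided by bivalent marked points `Mrk`; a closed loop is an edge from a marked
point to itself. Every edge has one tail and one head, so the set of edges is a bijection
from tails to heads. The three edges at a vertex are cyclically ordered by `i ↦ i + 1`; for a web
drawn in a disc this is the anticlockwise order at sinks and the clockwise order at sources. -/
structure PreWeb (I O : Type) : Type 1 where
  Snk : Type
  Src : Type
  Mrk : Type
  [finSnk : Finite Snk]
  [finSrc : Finite Src]
  [finMrk : Finite Mrk]
  edge : Ends Src Mrk I ≃ Ends Snk Mrk O

attribute [instance] PreWeb.finSnk PreWeb.finSrc PreWeb.finMrk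

/-- The tails of edges; also used as the set of edges. -/
abbrev PreWeb.Tail {I O : Type} (A : PreWeb I O) : Type := Ends A.Src A.Mrk I

/-- The heads of edges; also used as the set of edges. -/
abbrev PreWeb.Head {I O : Type} (A : PreWeb I O) : Type := Ends A.Snk A.Mrk O

/-- The boundary of a disc with marked points: points where strands enter (`In`) and leave
(`Out`), and the successor permutation `next` in anticlockwise order, a single cycle. -/
structure Rim : Type 1 where
  In : Type
  Out : Type
  [finIn : Finite In]
  [finOut : Finite Out]
  next : Equiv.Perm (In ⊕ Out)
  cyclic : ∀ x y, ∃ n : ℕ, next^[n] x = y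

attribute [instance] Rim.finIn Rim.finOut

section Planarity

variable {D : Rim} (A : PreWeb D.In D.Out)

/-- Half-edges of the graph obtained by contracting the outside of the disc to one vertex. -/
abbrev Dart : Type := A.Tail ⊕ A.Head

/-- The dart at a point of the rim. -/
def rimDart : D.In ⊕ D.Out → Dart A :=
  Sum.map (fun p => .inr (.inr p)) (fun o => .inr (.inr o))

/-- The anticlockwise successor of a dart around its vertex. The indices of the half-edges increase
anticlockwise at sinks and clockwise at sources; seen from the outside vertex, the points
of the rim are met in the opposite of their order around the disc. -/
def rotateDart : Dart A → Dart A
  | .inl (.inl (v, i)) => .inl (.inl (v, i - 1))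
  | .inr (.inl (v, i)) => .inr (.inl (v, i + 1))
  | .inl (.inr (.inl m)) => .inr (.inr (.inl m))
  | .inr (.inr (.inl m)) => .inl (.inr (.inl m))
  | .inl (.inr (.inr p)) => rimDart A (D.next.symm (.inl p))
  | .inr (.inr (.inr o)) => rimDart A (D.next.symm (.inr o))

/-- The other end of the edge of a dart. -/
def flipDart : Dart A → Dart A
  | .inl t => .inr (A.edge t)
  | .inr h => .inl (A.edge.symm h)

/-- The graph, with the given cyclic orders at vertices and on the rim, is drawn in the disc:
the Euler characteristic `V - E + F` of the rotation system is twice the number of components. -/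
def PreWeb.Planar : Prop :=
  Nat.card (Quot fun a b : Dart A => b = rotateDart A a) +
      Nat.card (Quot fun a b : Dart A => b = rotateDart A (flipDart A a)) =
    Nat.card A.Tail +
      2 * Nat.card (Quot fun a b : Dart A => b = rotateDart A a ∨ b = flipDart A a)

end Planarity

/-! ## Foams -/

section Foam

variable {I O : Type}

/-- The pieces of the boundaries of the facets of a foam from `A` to `B` with closed seams `R` that
are not part of a seam arc or of a vertical segment: the edges of `A` (indexed by their tails), the
edges of `B` (indexed by their heads), and the sides of the closed seams. -/
abbrev Piece (A B : PreWeb I O) (R : Type) : Type := (A.Tail ⊕ B.Head) ⊕ R × ZMod 3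

/-- Walking along the oriented boundary of a facet, from the end of an edge on to the beginning of
the next one, along a seam arc, through a marked point or along a vertical segment. The
boundary orientation of a facet agrees with the orientation of the edges of `A` and is opposite to
that of the edges of `B`. -/
def turn {A B : PreWeb I O} (arc : A.Snk ⊕ B.Src ≃ A.Src ⊕ B.Snk)
    (rot : A.Snk ⊕ B.Src → ZMod 3) : A.Head ⊕ B.Tail → A.Tail ⊕ B.Head
  | .inl (.inl (v, i)) =>
      Sum.map (fun w => .inl (w, i + rot (.inl v))) (fun w => .inl (w, i + rot (.inl v)))
        (arc (.inl v))
  | .inr (.inl (v, i)) =>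
      Sum.map (fun w => .inl (w, i + rot (.inr v))) (fun w => .inl (w, i + rot (.inr v)))
        (arc (.inr v))
  | .inl (.inr (.inl m)) => .inl (.inr (.inl m))
  | .inr (.inr (.inl m)) => .inr (.inr (.inl m))
  | .inl (.inr (.inr o)) => .inr (.inr (.inr o))
  | .inr (.inr (.inr p)) => .inl (.inr (.inr p))

/-- The next piece along the oriented boundary of a facet. -/
def pieceNext {A B : PreWeb I O} (arc : A.Snk ⊕ B.Src ≃ A.Src ⊕ B.Snk)
    (rot : A.Snk ⊕ B.Src → ZMod 3) {R : Type} (hol : R → ZMod 3) : Piece A B R → Piece A B R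
  | .inl x => .inl (turn arc rot (Sum.map A.edge B.edge.symm x))
  | .inr (k, i) => .inr (k, i + hol k)

/-- A seamed cobordism from `A` to `B`, up to homeomorphism relative to its boundary
`A ∪ B ∪ (∂ × [0,1])`.

* Seams are oriented by the sheets at them, so a seam arc begins at a sink of `A` or a source of
  `B` and ends at a source of `A` or a sink of `B`. The arc that begins at `v` ends at `arc v`, and
  the sheet attached to the half-edge `i` at its beginning is attached to the half-edge
  `i + rot v` at its end (so that the cyclic orders agree).
* `Ring` is the set of closed seams. Its sheets are numbered by `ZMod 3` in cyclic order;
  `hol` is the rotation of the sheets along the seam, zero for a seam of the form `Y × S¹`.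
* `Facet` is the set of components of the complement of the seams. The corresponding compact
  connected oriented surfaces are determined by their genus and their boundary circles; `attach`
  tells to which facet every boundary piece belongs. -/
structure Foam (A B : PreWeb I O) : Type 1 where
  arc : A.Snk ⊕ B.Src ≃ A.Src ⊕ B.Snk
  rot : A.Snk ⊕ B.Src → ZMod 3
  Ring : Type
  [finRing : Finite Ring]
  hol : Ring → ZMod 3
  Facet : Type
  [finFacet : Finite Facet]
  genus : Facet → ℕ
  attach : Piece A B Ring → Facet
  attach_next : ∀ s, attach (pieceNext arc rot hol s) = attach s

attribute [instance] Foam.finRing Foam.finFacet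

namespace Foam

variable {A B C : PreWeb I O}

/-- The facet at an edge of the source web. -/
abbrev bot (F : Foam A B) (t : A.Tail) : F.Facet := F.attach (.inl (.inl t))

/-- The facet at an edge of the target web. -/
abbrev top (F : Foam A B) (h : B.Head) : F.Facet := F.attach (.inl (.inr h))

/-- The facet at a side of a closed seam. -/
abbrev side (F : Foam A B) (k : F.Ring) (i : ZMod 3) : F.Facet := F.attach (.inr (k, i))

/-- The boundary circles of the facets. -/
def Circle (F : Foam A B) : Type := Quot fun s t => t = pieceNext F.arc F.rot F.hol s

/-- The facet to which a boundary circle belongs. -/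
def circleFacet (F : Foam A B) : F.Circle → F.Facet :=
  Quot.lift F.attach (by rintro s _ rfl; exact (F.attach_next s).symm)

/-- The Euler characteristic of a facet, a compact surface. -/
noncomputable def chi (F : Foam A B) (φ : F.Facet) : ℤ :=
  2 - 2 * (F.genus φ : ℤ) - (Nat.card {c : F.Circle // F.circleFacet c = φ} : ℤ)

/-- The Euler characteristic of a foam: along each seam arc three arcs are identified to one. -/
noncomputable def eulerChar (F : Foam A B) : ℤ :=
  (∑ᶠ φ : F.Facet, F.chi φ) - 2 * (Nat.card (A.Snk ⊕ B.Src) : ℤ)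

/-- The degree `2 χ - |∂| + |V| / 2` of a foam between webs without grading shift. The number `|V|`
of trivalent vertices of both webs is twice the number of seam arcs, so the division is exact. -/
noncomputable def deg (F : Foam A B) : ℤ :=
  2 * F.eulerChar - (Nat.card (I ⊕ O) : ℤ) +
    (Nat.card ((A.Snk ⊕ A.Src) ⊕ (B.Snk ⊕ B.Src)) : ℤ) / 2

end Foam

/-- The identity foam `A × [0,1]`. Its facets are the maximal chains of edges of `A` joined at marked
points, times `[0,1]`. -/
def idFoam [Finite I] (A : PreWeb I O) : Foam A A where
  arc := Equiv.sumComm _ _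
  rot := fun _ => 0
  Ring := Empty
  hol := Empty.elim
  Facet := Quot fun s t : A.Tail => ∃ m : A.Mrk, A.edge s = .inr (.inl m) ∧ t = .inr (.inl m)
  genus := fun _ => 0
  attach
    | .inl (.inl t) => Quot.mk _ t
    | .inl (.inr h) => Quot.mk _ (A.edge.symm h)
  attach_next := by
    rintro ((t | h) | ⟨⟨⟩, _⟩)
    · rcases h : A.edge t with (⟨v, i⟩ | m | o)
      · simp [pieceNext, turn, h]
        rw [← h]; simp
      · simp [pieceNext, turn, h]
        exact (Quot.sound ⟨m, h, rfl⟩).symm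
      · simp [pieceNext, turn, h]
        rw [← h]; simp
    · rcases h' : A.edge.symm h with (⟨v, i⟩ | m | o)
      · simp [pieceNext, turn, h']
      · simp [pieceNext, turn, h']
        exact (Quot.sound ⟨m, by simp, rfl⟩)
      · simp [pieceNext, turn, h']


/-! ### Vertical composition -/

section Gluing

variable {A B C : PreWeb I O} (F : Foam A B) (G : Foam B C)

/-- The seam arcs of both foams, indexed by their beginnings. -/
abbrev Arcs (_F : Foam A B) (_G : Foam B C) : Type := (A.Snk ⊕ B.Src) ⊕ (B.Snk ⊕ C.Src)

/-- What follows a seam arc: another seam arc that begins at a vertex of `B`, or an end at a vertex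
of `A` or `C`. -/
def arcEnd : Arcs F G → Arcs F G ⊕ (A.Src ⊕ C.Snk)
  | .inl s => Sum.elim (fun u => .inr (.inl u)) (fun w => .inl (.inr (.inl w))) (F.arc s)
  | .inr s => Sum.elim (fun u => .inl (.inl (.inr u))) (fun w => .inr (.inr w)) (G.arc s)

/-- The rotation of the sheets along a seam arc. -/
def arcRot : Arcs F G → ZMod 3 := Sum.elim F.rot G.rot

/-- `SeamPath F G x r e`: the seam that starts with the arc `x` ends at `e`, and the sheets are
rotated by `r` along it. -/
inductive SeamPath : Arcs F G → ZMod 3 → A.Src ⊕ C.Snk → Prop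
  | exit (x : Arcs F G) (e : A.Src ⊕ C.Snk) (h : arcEnd F G x = .inr e) :
      SeamPath x (arcRot F G x) e
  | step (x y : Arcs F G) (r : ZMod 3) (e : A.Src ⊕ C.Snk) (h : arcEnd F G x = .inl y)
      (hy : SeamPath y r e) : SeamPath x (arcRot F G x + r) e

/-- `SeamReturn F G b x r`: the seam that starts with the arc `x` comes back to the beginning of the
arc `b`, and the sheets are rotated by `r` until it does so for the first time. -/
inductive SeamReturn (b : Arcs F G) : Arcs F G → ZMod 3 → Prop
  | close (x : Arcs F G) (h : arcEnd F G x = .inl b) : SeamReturn b x (arcRot F G x)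
  | step (x y : Arcs F G) (r : ZMod 3) (h : arcEnd F G x = .inl y) (hb : y ≠ b)
      (hy : SeamReturn b y r) : SeamReturn b x (arcRot F G x + r)

/-- The closed seams formed by seam arcs of both foams. -/
abbrev ClosedSeam : Type :=
  {c : Quot fun x y : Arcs F G => arcEnd F G x = .inl y //
    ∀ x, Quot.mk _ x = c → ∀ e, arcEnd F G x ≠ .inr e}

/-- The facet at the side `i` of the beginning of a seam arc. -/
def Foam.arcFacet {A B : PreWeb I O} (F : Foam A B) : A.Snk ⊕ B.Src → ZMod 3 → F.Facet
  | .inl v, i => F.bot (A.edge.symm (.inl (v, i)))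
  | .inr v, i => F.top (B.edge (.inl (v, i)))

/-- The facets that are glued along an edge of `B`. -/
def FacetGlue (x y : F.Facet ⊕ G.Facet) : Prop :=
  ∃ t : B.Tail, x = .inl (F.top (B.edge t)) ∧ y = .inr (G.bot t)

/-- An identification of `H` with the seamed cobordism obtained by gluing `F` and `G` along `B`:
facets of `H` are classes of facets of `F` and `G` that are connected through edges of `B`, their
Euler characteristics add up (minus one for each edge of `B` and plus one for each marked
point of `B` along which they are glued), the seam arcs of `H` are the chains of seam arcs of `F` and
`G`, and its closed seams are those of `F` and `G` and the cycles of seam arcs. -/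
structure Gluing (H : Foam A C) : Type where
  facet : F.Facet ⊕ G.Facet → H.Facet
  facet_surjective : Function.Surjective facet
  facet_eq_iff : ∀ x y, facet x = facet y ↔ Relation.EqvGen (FacetGlue F G) x y
  bot_eq : ∀ t : A.Tail, H.bot t = facet (.inl (F.bot t))
  top_eq : ∀ h : C.Head, H.top h = facet (.inr (G.top h))
  chi_eq : ∀ φ : H.Facet, H.chi φ =
    (∑ᶠ x : {x : F.Facet ⊕ G.Facet // facet x = φ}, Sum.elim F.chi G.chi x.1) -
      (Nat.card {t : B.Tail // facet (.inr (G.bot t)) = φ} : ℤ) +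
      (Nat.card {m : B.Mrk // facet (.inr (G.bot (.inr (.inl m)))) = φ} : ℤ)
  arc_eq : ∀ s : A.Snk ⊕ C.Src, SeamPath F G (Sum.map .inl .inr s) (H.rot s) (H.arc s)
  ring : (F.Ring ⊕ G.Ring) ⊕ ClosedSeam F G ≃ H.Ring
  ring_left : ∀ k, H.hol (ring (.inl (.inl k))) = F.hol k ∧
    ∃ j, ∀ i, H.side (ring (.inl (.inl k))) (i + j) = facet (.inl (F.side k i))
  ring_right : ∀ k, H.hol (ring (.inl (.inr k))) = G.hol k ∧
    ∃ j, ∀ i, H.side (ring (.inl (.inr k))) (i + j) = facet (.inr (G.side k i))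
  ring_new : ∀ c, ∃ b, Quot.mk _ b = c.1 ∧ SeamReturn F G b b (H.hol (ring (.inr c))) ∧
    ∃ j, ∀ i, H.side (ring (.inr c)) (i + j) =
      facet (Sum.map (fun s => F.arcFacet s i) (fun s => G.arcFacet s i) b)

end Gluing

/-! ### Planar operations -/

/-- The half-edges of two webs together, their boundary points being regarded as marked points. -/
def Ends.merge {V M X V' M' X' Z : Type} (e : X ⊕ X' ≃ Z) :
    Ends V M X ⊕ Ends V' M' X' ≃ Ends (V ⊕ V') ((M ⊕ M') ⊕ Z) Empty where
  toFun
    | .inl (.inl (v, i)) => .inl (.inl v, i)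
    | .inl (.inr (.inl m)) => .inr (.inl (.inl (.inl m)))
    | .inl (.inr (.inr x)) => .inr (.inl (.inr (e (.inl x))))
    | .inr (.inl (v, i)) => .inl (.inr v, i)
    | .inr (.inr (.inl m)) => .inr (.inl (.inl (.inr m)))
    | .inr (.inr (.inr x)) => .inr (.inl (.inr (e (.inr x))))
  invFun
    | .inl (.inl v, i) => .inl (.inl (v, i))
    | .inl (.inr v, i) => .inr (.inl (v, i))
    | .inr (.inl (.inl (.inl m))) => .inl (.inr (.inl m))
    | .inr (.inl (.inl (.inr m))) => .inr (.inr (.inl m))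
    | .inr (.inl (.inr z)) => Sum.map (fun x => .inr (.inr x)) (fun x => .inr (.inr x)) (e.symm z)
    | .inr (.inr x) => x.elim
  left_inv := by rintro ((⟨v, i⟩ | m | x) | (⟨v, i⟩ | m | x)) <;> simp
  right_inv := by
    rintro (⟨v | v, i⟩ | ((m | m) | z) | ⟨⟨⟩⟩) <;> try rfl
    obtain ⟨x | x, rfl⟩ := e.surjective z <;> simp

/-- The half-edges of a web and a closed web together. -/
def Ends.append {V M X V' M' : Type} :
    Ends V M X ⊕ Ends V' M' Empty ≃ Ends (V ⊕ V') (M ⊕ M') X where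
  toFun
    | .inl (.inl (v, i)) => .inl (.inl v, i)
    | .inl (.inr (.inl m)) => .inr (.inl (.inl m))
    | .inl (.inr (.inr x)) => .inr (.inr x)
    | .inr (.inl (v, i)) => .inl (.inr v, i)
    | .inr (.inr (.inl m)) => .inr (.inl (.inr m))
    | .inr (.inr (.inr x)) => x.elim
  invFun
    | .inl (.inl v, i) => .inl (.inl (v, i))
    | .inl (.inr v, i) => .inr (.inl (v, i))
    | .inr (.inl (.inl m)) => .inl (.inr (.inl m))
    | .inr (.inl (.inr m)) => .inr (.inr (.inl m))
    | .inr (.inr x) => .inl (.inr (.inr x))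
  left_inv := by rintro ((⟨v, i⟩ | m | x) | (⟨v, i⟩ | m | ⟨⟨⟩⟩)) <;> rfl
  right_inv := by rintro (⟨v | v, i⟩ | (m | m) | x) <;> rfl

/-- The empty web. -/
abbrev emptyWeb : PreWeb Empty Empty where
  Snk := Empty
  Src := Empty
  Mrk := Empty
  edge := Equiv.refl _

/-- The closed web `A* ∪ B` on the boundary sphere of the can: `A` with its orientation reversed,
glued to `B` at the boundary points, which become marked points. -/
def PreWeb.bend [Finite I] [Finite O] (A B : PreWeb I O) : PreWeb Empty Empty where
  Snk := A.Src ⊕ B.Snk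
  Src := A.Snk ⊕ B.Src
  Mrk := (A.Mrk ⊕ B.Mrk) ⊕ (I ⊕ O)
  edge := (Ends.merge (Equiv.sumComm O I)).symm.trans
    ((Equiv.sumCongr A.edge.symm B.edge).trans (Ends.merge (Equiv.refl (I ⊕ O))))

/-- The disjoint union of a web and a closed web. -/
def PreWeb.adjoin (A : PreWeb I O) (W : PreWeb Empty Empty) : PreWeb I O where
  Snk := A.Snk ⊕ W.Snk
  Src := A.Src ⊕ W.Src
  Mrk := A.Mrk ⊕ W.Mrk
  edge := Ends.append.symm.trans ((Equiv.sumCongr A.edge W.edge).trans Ends.append)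

/-- The facet at a piece of the boundary, after pulling the source of `F` to the ceiling. -/
def Foam.bendAttach [Finite I] [Finite O] {A B : PreWeb I O} (F : Foam A B) :
    Piece emptyWeb (A.bend B) F.Ring → F.Facet
  | .inl (.inl (.inl (v, _))) => v.elim
  | .inl (.inl (.inr (.inl m))) => m.elim
  | .inl (.inl (.inr (.inr x))) => x.elim
  | .inl (.inr h) => F.attach (.inl ((Ends.merge (Equiv.refl (I ⊕ O))).symm h))
  | .inr k => F.attach (.inr k)

/-- A foam from `A` to `B`, with its source pulled to the ceiling of the can. -/
def Foam.bend [Finite I] [Finite O] {A B : PreWeb I O} (F : Foam A B) :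
    Foam emptyWeb (A.bend B) where
  arc := Equiv.sumCongr (Equiv.refl Empty) F.arc
  rot := Sum.elim Empty.elim F.rot
  Ring := F.Ring
  hol := F.hol
  Facet := F.Facet
  genus := F.genus
  attach := F.bendAttach
  attach_next := by
    rintro ((t | h) | k)
    · rcases t with (⟨⟨⟩, _⟩ | ⟨⟨⟩⟩ | ⟨⟨⟩⟩)
    · obtain ⟨x, rfl⟩ := (Ends.merge (Equiv.refl (I ⊕ O))).surjective h
      have he : (A.bend B).edge.symm (Ends.merge (Equiv.refl (I ⊕ O)) x) =
          Ends.merge (Equiv.sumComm O I) (Sum.map A.edge B.edge.symm x) := by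
        change Ends.merge (Equiv.sumComm O I) (Sum.map A.edge B.edge.symm
          ((Ends.merge (Equiv.refl (I ⊕ O))).symm (Ends.merge (Equiv.refl (I ⊕ O)) x))) = _
        rw [Equiv.symm_apply_apply]
      have hx : F.bendAttach (.inl (.inr (Ends.merge (Equiv.refl (I ⊕ O)) x))) =
          F.attach (.inl x) := by
        change F.attach (.inl ((Ends.merge (Equiv.refl (I ⊕ O))).symm
          (Ends.merge (Equiv.refl (I ⊕ O)) x))) = _
        rw [Equiv.symm_apply_apply]
      refine Eq.trans ?_ ((F.attach_next (.inl x)).trans hx.symm)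
      change F.bendAttach (.inl (turn _ _ (.inr ((A.bend B).edge.symm _)))) =
        F.attach (.inl (turn F.arc F.rot (Sum.map A.edge B.edge.symm x)))
      rw [he]
      rcases Sum.map A.edge B.edge.symm x with (⟨v, i⟩ | m | o) | (⟨v, i⟩ | m | o)
      · change F.bendAttach (.inl (.inr (.inl (F.arc (.inl v), i + F.rot (.inl v))))) =
          F.attach (.inl (Sum.map _ _ (F.arc (.inl v))))
        rcases F.arc (.inl v) with w | w <;> rfl
      · rfl
      · rfl
      · change F.bendAttach (.inl (.inr (.inl (F.arc (.inr v), i + F.rot (.inr v))))) =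
          F.attach (.inl (Sum.map _ _ (F.arc (.inr v))))
        rcases F.arc (.inr v) with w | w <;> rfl
      · rfl
      · rfl
    · exact F.attach_next (.inr k)

/-- The seam arcs of a foam from the empty web to a closed web. -/
def Foam.closedArc {W : PreWeb Empty Empty} (K : Foam emptyWeb W) : W.Src ≃ W.Snk :=
  (Equiv.emptySum Empty W.Src).symm.trans (K.arc.trans (Equiv.emptySum Empty W.Snk))

/-- The facet at a piece of the boundary of a disjoint union. -/
def Foam.adjoinAttach {A B : PreWeb I O} (F : Foam A B) {W : PreWeb Empty Empty}
    (K : Foam emptyWeb W) : Piece A (B.adjoin W) (F.Ring ⊕ K.Ring) → F.Facet ⊕ K.Facet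
  | .inl (.inl t) => .inl (F.bot t)
  | .inl (.inr h) => Sum.map F.top K.top (Ends.append.symm h)
  | .inr (.inl k, i) => .inl (F.side k i)
  | .inr (.inr k, i) => .inr (K.side k i)

/-- The disjoint union of a foam and a foam from the empty web to a closed web. -/
def Foam.adjoin {A B : PreWeb I O} (F : Foam A B) {W : PreWeb Empty Empty}
    (K : Foam emptyWeb W) : Foam A (B.adjoin W) where
  arc := (Equiv.sumAssoc A.Snk B.Src W.Src).symm.trans
    ((Equiv.sumCongr F.arc K.closedArc).trans (Equiv.sumAssoc A.Src B.Snk W.Snk))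
  rot := Sum.elim (fun v => F.rot (.inl v))
    (Sum.elim (fun v => F.rot (.inr v)) (fun v => K.rot (.inr v)))
  Ring := F.Ring ⊕ K.Ring
  hol := Sum.elim F.hol K.hol
  Facet := F.Facet ⊕ K.Facet
  genus := Sum.elim F.genus K.genus
  attach := F.adjoinAttach K
  attach_next := by
    rintro ((t | h) | ⟨k | k, i⟩)
    · refine Eq.trans ?_ (congrArg (Sum.inl (β := K.Facet)) (F.attach_next (.inl (.inl t))))
      simp only [pieceNext, Sum.map_inl]
      rcases A.edge t with ⟨v, i⟩ | m | o
      · change F.adjoinAttach K (.inl (Sum.map (fun w => .inl (w, i + F.rot (.inl v)))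
          (fun w => .inl (w, i + F.rot (.inl v)))
          (Equiv.sumAssoc A.Src B.Snk W.Snk (.inl (F.arc (.inl v)))))) =
          Sum.inl (F.attach (.inl (Sum.map _ _ (F.arc (.inl v)))))
        rcases F.arc (.inl v) with w | w <;> rfl
      · rfl
      · rfl
    · obtain ⟨x, rfl⟩ := Ends.append.surjective h
      have he : (B.adjoin W).edge.symm (Ends.append x) =
          Ends.append (Sum.map B.edge.symm W.edge.symm x) := by
        change Ends.append (Sum.map B.edge.symm W.edge.symm
          (Ends.append.symm (Ends.append x))) = _
        rw [Equiv.symm_apply_apply]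
      have hx : F.adjoinAttach K (.inl (.inr (Ends.append x))) = Sum.map F.top K.top x := by
        change Sum.map F.top K.top (Ends.append.symm (Ends.append x)) = _
        rw [Equiv.symm_apply_apply]
      rw [hx]
      change F.adjoinAttach K (.inl (turn _ _ (.inr ((B.adjoin W).edge.symm _)))) = _
      rw [he]
      rcases x with x | x
      · refine Eq.trans ?_ (congrArg (Sum.inl (β := K.Facet)) (F.attach_next (.inl (.inr x))))
        simp only [pieceNext, Sum.map_inl, Sum.map_inr]
        rcases B.edge.symm x with ⟨v, i⟩ | m | o
        · change F.adjoinAttach K (.inl (Sum.map (fun w => .inl (w, i + F.rot (.inr v)))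
            (fun w => .inl (w, i + F.rot (.inr v)))
            (Equiv.sumAssoc A.Src B.Snk W.Snk (.inl (F.arc (.inr v)))))) =
            Sum.inl (F.attach (.inl (Sum.map _ _ (F.arc (.inr v)))))
          rcases F.arc (.inr v) with w | w <;> rfl
        · rfl
        · rfl
      · refine Eq.trans ?_ (congrArg (Sum.inr (α := F.Facet)) (K.attach_next (.inl (.inr x))))
        simp only [pieceNext, Sum.map_inr]
        rcases W.edge.symm x with ⟨v, i⟩ | m | ⟨⟨⟩⟩
        · change F.adjoinAttach K (.inl (.inr (.inl (.inr (Equiv.emptySum Empty W.Snk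
            (K.arc (.inr v))), i + K.rot (.inr v))))) =
            Sum.inr (K.attach (.inl (Sum.map _ _ (K.arc (.inr v)))))
          rcases K.arc (.inr v) with ⟨⟨⟩⟩ | w
          rfl
        · rfl
    · exact congrArg Sum.inl (F.attach_next (.inr (k, i)))
    · exact congrArg Sum.inr (K.attach_next (.inr (k, i)))

end Foam

/-! ## The webs and foams of the local relations -/

/-- An oriented circle without vertices. -/
abbrev circleWeb : PreWeb Empty Empty where
  Snk := Empty
  Src := Empty
  Mrk := Unit
  edge := Equiv.refl _

/-- Three disjoint circles. -/
def threeCircles : PreWeb Empty Empty where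
  Snk := Empty
  Src := Empty
  Mrk := ZMod 3
  edge := Equiv.refl _

/-- A single strand through the disc. -/
abbrev strandWeb : PreWeb Unit Unit where
  Snk := Empty
  Src := Empty
  Mrk := Empty
  edge := Equiv.refl _

/-- A strand with a bigon. The strand that enters the disc ends at a sink (as its half-edge `0`), the
strand that leaves the disc starts at a source (as its half-edge `0`), and two edges
lead from the source to the sink, joining half-edges with the same index. -/
abbrev bigonWeb : PreWeb Unit Unit where
  Snk := Unit
  Src := Unit
  Mrk := Empty
  edge :=
    { toFun := fun
        | .inl (_, i) => if i = 0 then .inr (.inr ()) else .inl ((), i)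
        | .inr _ => .inl ((), 0)
      invFun := fun
        | .inl (_, i) => if i = 0 then .inr (.inr ()) else .inl ((), i)
        | .inr _ => .inl ((), 0)
      left_inv := by decide
      right_inv := by decide }

/-- A square in a disc with four boundary points, the north-west (`false`) and south-east (`true`)
entry points and the north-east (`false`) and south-west (`true`) exit points. The corners are
labelled in the same way: the half-edge `0` of each corner leads to the boundary, the half-edges `1`
form the vertical sides and the half-edges `2` form the horizontal sides. -/
abbrev squareWeb : PreWeb Bool Bool where
  Snk := Bool
  Src := Bool
  Mrk := Empty
  edge :=
    { toFun := fun
        | .inl (b, i) =>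
            if i = 0 then .inr (.inr b) else if i = 1 then .inl (!b, 1) else .inl (b, 2)
        | .inr (.inl m) => m.elim
        | .inr (.inr b) => .inl (b, 0)
      invFun := fun
        | .inl (b, i) =>
            if i = 0 then .inr (.inr b) else if i = 1 then .inl (!b, 1) else .inl (b, 2)
        | .inr (.inl m) => m.elim
        | .inr (.inr b) => .inl (b, 0)
      left_inv := by decide
      right_inv := by decide }

/-- The two horizontal strands, from north-west to north-east and from south-east to south-west. -/
abbrev horizontalWeb : PreWeb Bool Bool where
  Snk := Empty
  Src := Empty
  Mrk := Empty
  edge := Equiv.refl _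

/-- The two vertical strands, from north-west to south-west and from south-east to north-east. -/
abbrev verticalWeb : PreWeb Bool Bool where
  Snk := Empty
  Src := Empty
  Mrk := Empty
  edge := Equiv.sumCongr (Equiv.refl _) (Equiv.sumCongr (Equiv.refl _) Equiv.boolNot)

/-! ### Closed foams -/

/-- The closed oriented surface of genus `g`. -/
def closedSurface (g : ℕ) : Foam emptyWeb emptyWeb where
  arc := Equiv.refl (Empty ⊕ Empty)
  rot := fun _ => 0
  Ring := Empty
  hol := Empty.elim
  Facet := Unit
  genus := fun _ => g
  attach := fun _ => ()
  attach_next := fun _ => rfl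

/-- The closed foam made of three surfaces with one boundary circle and of genus `g 0`, `g 1`, `g 2`,
in this cyclic order around the seam. -/
def closedTheta (g : ZMod 3 → ℕ) : Foam emptyWeb emptyWeb where
  arc := Equiv.refl (Empty ⊕ Empty)
  rot := fun _ => 0
  Ring := Unit
  hol := fun _ => 0
  Facet := ZMod 3
  genus := g
  attach
    | .inr (_, i) => i
    | .inl _ => 0
  attach_next := by
    rintro (((⟨⟨⟩, _⟩ | ⟨⟨⟩⟩ | ⟨⟨⟩⟩) | (⟨⟨⟩, _⟩ | ⟨⟨⟩⟩ | ⟨⟨⟩⟩)) | ⟨_, i⟩)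
    simp [pieceNext]

/-! ### Foams bounded by circles -/

/-- The surface of genus `g` bounded by a circle, as a cobordism to the empty web: a disc for
`g = 0`, a punctured torus (handle) for `g = 1`. -/
def capFoam (g : ℕ) : Foam circleWeb emptyWeb where
  arc := Equiv.refl (Empty ⊕ Empty)
  rot := fun _ => 0
  Ring := Empty
  hol := Empty.elim
  Facet := Unit
  genus := fun _ => g
  attach := fun _ => ()
  attach_next := fun _ => rfl

/-- The surface of genus `g` bounded by a circle, as a cobordism from the empty web. -/
def cupFoam (g : ℕ) : Foam emptyWeb circleWeb where
  arc := Equiv.refl (Empty ⊕ Empty)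
  rot := fun _ => 0
  Ring := Empty
  hol := Empty.elim
  Facet := Unit
  genus := fun _ => g
  attach := fun _ => ()
  attach_next := fun _ => rfl

/-- The genera of the three facets bulk, handle, disc (in this cyclic order around the seam) of a
choking torus. -/
def chokeGenus (i : ZMod 3) : ℕ := if i = 1 then 1 else 0

/-- The choking torus, as a cobordism from the circle to the empty web. -/
def capChoke : Foam circleWeb emptyWeb where
  arc := Equiv.refl (Empty ⊕ Empty)
  rot := fun _ => 0
  Ring := Unit
  hol := fun _ => 0
  Facet := ZMod 3
  genus := chokeGenus
  attach
    | .inr (_, i) => i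
    | .inl _ => 0
  attach_next := by
    rintro (x | ⟨_, i⟩)
    · rfl
    · simp [pieceNext]

/-- The choking torus, as a cobordism from the empty web to the circle. -/
def cupChoke : Foam emptyWeb circleWeb where
  arc := Equiv.refl (Empty ⊕ Empty)
  rot := fun _ => 0
  Ring := Unit
  hol := fun _ => 0
  Facet := ZMod 3
  genus := chokeGenus
  attach
    | .inr (_, i) => i
    | .inl _ => 0
  attach_next := by
    rintro (x | ⟨_, i⟩)
    · rfl
    · simp [pieceNext]

/-- A tube with two separating discs. The middle annulus is `none`, the annulus and the disc at the
source (`b = false`) or target (`b = true`) circle are `some (b, false)` and `some (b, true)`. The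
cyclic order at both seams is middle annulus, outer annulus, disc. -/
def airlock : Foam circleWeb circleWeb where
  arc := Equiv.refl (Empty ⊕ Empty)
  rot := fun _ => 0
  Ring := Bool
  hol := fun _ => 0
  Facet := Option (Bool × Bool)
  genus := fun _ => 0
  attach
    | .inr (b, i) => if i = 0 then none else if i = 1 then some (b, false) else some (b, true)
    | .inl (.inl _) => some (false, false)
    | .inl (.inr _) => some (true, false)
  attach_next := by
    rintro (((⟨⟨⟩, _⟩ | _ | ⟨⟨⟩⟩) | (⟨⟨⟩, _⟩ | _ | ⟨⟨⟩⟩)) | ⟨b, i⟩)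
    · rfl
    · rfl
    · simp [pieceNext]

/-- A neighbourhood `Y × S¹` of a closed seam, as a cobordism from the empty web to three circles;
the circles are numbered by the permutation `c` in the cyclic order of the three sheets. -/
def seamFoam (c : Equiv.Perm (ZMod 3)) : Foam emptyWeb threeCircles where
  arc := Equiv.refl (Empty ⊕ Empty)
  rot := fun _ => 0
  Ring := Unit
  hol := fun _ => 0
  Facet := ZMod 3
  genus := fun _ => 0
  attach
    | .inr (_, i) => c i
    | .inl (.inr (.inr (.inl m))) => m
    | .inl _ => 0
  attach_next := by
    rintro (((⟨⟨⟩, _⟩ | ⟨⟨⟩⟩ | ⟨⟨⟩⟩) | (⟨⟨⟩, _⟩ | m | ⟨⟨⟩⟩)) | ⟨b, i⟩)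
    · rfl
    · simp [pieceNext]

/-- A neighbourhood of a closed seam along which the three sheets are rotated by `h ≠ 0`, so that they
form one annulus, which winds three times around the seam. Reversing the cyclic order replaces
`h` by `-h`. -/
def twistedSeam (h : ZMod 3) : Foam emptyWeb circleWeb where
  arc := Equiv.refl (Empty ⊕ Empty)
  rot := fun _ => 0
  Ring := Unit
  hol := fun _ => h
  Facet := Unit
  genus := fun _ => 0
  attach := fun _ => ()
  attach_next := fun _ => rfl

/-! ### Foams at a bigon -/

/-- The facets at the seam arc of the foams between a bigon and a strand: the facet `0` contains the
strand, the facets `1` and `2` contain the edges of the bigon. -/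
def bigonTail : bigonWeb.Tail → ZMod 3
  | .inl (_, i) => i
  | .inr _ => 0

/-- See `bigonTail`. -/
def bigonHead : bigonWeb.Head → ZMod 3
  | .inl (_, i) => i
  | .inr _ => 0

/-- The half bubble from a bigon to a strand: a seam arc joins both vertices, and each edge of
the bigon bounds a disc. -/
def lowerBubble : Foam bigonWeb strandWeb where
  arc := Equiv.refl (Unit ⊕ Empty)
  rot := fun _ => 0
  Ring := Empty
  hol := Empty.elim
  Facet := ZMod 3
  genus := fun _ => 0
  attach
    | .inl (.inl t) => bigonTail t
    | .inl (.inr _) => 0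
    | .inr (k, _) => k.elim
  attach_next := by
    rintro (((⟨⟨⟩, i⟩ | ⟨⟨⟩⟩ | _) | (⟨⟨⟩, _⟩ | ⟨⟨⟩⟩ | _)) | ⟨⟨⟩, _⟩) <;>
      first | rfl | (revert i; decide)

/-- The half bubble from a strand to a bigon. -/
def upperBubble : Foam strandWeb bigonWeb where
  arc := Equiv.refl (Empty ⊕ Unit)
  rot := fun _ => 0
  Ring := Empty
  hol := Empty.elim
  Facet := ZMod 3
  genus := fun _ => 0
  attach
    | .inl (.inl _) => 0
    | .inl (.inr h) => bigonHead h
    | .inr (k, _) => k.elim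
  attach_next := by
    rintro (((⟨⟨⟩, _⟩ | ⟨⟨⟩⟩ | _) | (⟨⟨⟩, i⟩ | ⟨⟨⟩⟩ | _)) | ⟨⟨⟩, _⟩) <;>
      first | rfl | (revert i; decide)

/-- The sheets at the closed seam of a kiss (a zip followed by an unzip) of the two sheets at the
edges of a bigon: the disc `none`, and then both sheets in the order
in which they follow each other at the vertices of the bigon. -/
def kissSide (i : ZMod 3) : Option (ZMod 3) := if i = 0 then none else some i

/-- The half bubble from a bigon to a strand whose two sheets at the edges of the bigon kiss. -/
def lowerKiss : Foam bigonWeb strandWeb where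
  arc := Equiv.refl (Unit ⊕ Empty)
  rot := fun _ => 0
  Ring := Unit
  hol := fun _ => 0
  Facet := Option (ZMod 3)
  genus := fun _ => 0
  attach
    | .inl (.inl t) => some (bigonTail t)
    | .inl (.inr _) => some 0
    | .inr (_, i) => kissSide i
  attach_next := by
    rintro (((⟨⟨⟩, i⟩ | ⟨⟨⟩⟩ | _) | (⟨⟨⟩, _⟩ | ⟨⟨⟩⟩ | _)) | ⟨⟨⟩, i⟩) <;>
      first | rfl | (revert i; decide)

/-- The half bubble from a strand to a bigon whose two sheets at the edges of the bigon kiss. -/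
def upperKiss : Foam strandWeb bigonWeb where
  arc := Equiv.refl (Empty ⊕ Unit)
  rot := fun _ => 0
  Ring := Unit
  hol := fun _ => 0
  Facet := Option (ZMod 3)
  genus := fun _ => 0
  attach
    | .inl (.inl _) => some 0
    | .inl (.inr h) => some (bigonHead h)
    | .inr (_, i) => kissSide i
  attach_next := by
    rintro (((⟨⟨⟩, _⟩ | ⟨⟨⟩⟩ | _) | (⟨⟨⟩, i⟩ | ⟨⟨⟩⟩ | _)) | ⟨⟨⟩, i⟩) <;>
      first | rfl | (revert i; decide)

/-! ### Foams at a square -/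

/-- The facets of the half rockets between a square and two strands: `some (b, false)` contains a
strand, `some (b, true)` is a disc bounded by a side of the square and a seam arc, and
`none` is the tunnel between the other two sides of the square. Here the tunnel is at the
vertical sides. -/
def rocketH (b : Bool) (i : ZMod 3) : Option (Bool × Bool) :=
  if i = 0 then some (b, false) else if i = 1 then none else some (b, true)

/-- As `rocketH`, with the tunnel at the horizontal sides. -/
def rocketV (b : Bool) (i : ZMod 3) : Option (Bool × Bool) :=
  if i = 0 then some (b, false) else if i = 1 then some (b, true) else none

/-- The half rocket from a square to two horizontal strands. Its two seam arcs are parallel to the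
horizontal sides of the square. -/
def lowerRocketH : Foam squareWeb horizontalWeb where
  arc := Equiv.refl (Bool ⊕ Empty)
  rot := fun _ => 0
  Ring := Empty
  hol := Empty.elim
  Facet := Option (Bool × Bool)
  genus := fun _ => 0
  attach
    | .inl (.inl (.inl (b, i))) => rocketH b i
    | .inl (.inl (.inr (.inl m))) => m.elim
    | .inl (.inl (.inr (.inr b))) => some (b, false)
    | .inl (.inr (.inl (v, _))) => v.elim
    | .inl (.inr (.inr (.inl m))) => m.elim
    | .inl (.inr (.inr (.inr b))) => some (b, false)
    | .inr (k, _) => k.elim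
  attach_next := by
    rintro (((⟨b, i⟩ | ⟨⟨⟩⟩ | b) | (⟨⟨⟩, _⟩ | ⟨⟨⟩⟩ | b)) | ⟨⟨⟩, _⟩) <;>
      cases b <;> first | rfl | (revert i; decide)

/-- The half rocket from two horizontal strands to a square. -/
def upperRocketH : Foam horizontalWeb squareWeb where
  arc := Equiv.refl (Empty ⊕ Bool)
  rot := fun _ => 0
  Ring := Empty
  hol := Empty.elim
  Facet := Option (Bool × Bool)
  genus := fun _ => 0
  attach
    | .inl (.inr (.inl (b, i))) => rocketH b i
    | .inl (.inr (.inr (.inl m))) => m.elim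
    | .inl (.inr (.inr (.inr b))) => some (b, false)
    | .inl (.inl (.inl (v, _))) => v.elim
    | .inl (.inl (.inr (.inl m))) => m.elim
    | .inl (.inl (.inr (.inr b))) => some (b, false)
    | .inr (k, _) => k.elim
  attach_next := by
    rintro (((⟨⟨⟩, _⟩ | ⟨⟨⟩⟩ | b) | (⟨b, i⟩ | ⟨⟨⟩⟩ | b)) | ⟨⟨⟩, _⟩) <;>
      cases b <;> first | rfl | (revert i; decide)

/-- The half rocket from a square to two vertical strands. Its two seam arcs are parallel to the
vertical sides of the square. The facets are labelled by the sinks. -/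
def lowerRocketV : Foam squareWeb verticalWeb where
  arc := Equiv.sumCongr Equiv.boolNot (Equiv.refl Empty)
  rot := fun _ => 0
  Ring := Empty
  hol := Empty.elim
  Facet := Option (Bool × Bool)
  genus := fun _ => 0
  attach
    | .inl (.inl (.inl (b, i))) => rocketV (!b) i
    | .inl (.inl (.inr (.inl m))) => m.elim
    | .inl (.inl (.inr (.inr b))) => some (b, false)
    | .inl (.inr (.inl (v, _))) => v.elim
    | .inl (.inr (.inr (.inl m))) => m.elim
    | .inl (.inr (.inr (.inr b))) => some (!b, false)
    | .inr (k, _) => k.elim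
  attach_next := by
    rintro (((⟨b, i⟩ | ⟨⟨⟩⟩ | b) | (⟨⟨⟩, _⟩ | ⟨⟨⟩⟩ | b)) | ⟨⟨⟩, _⟩) <;>
      cases b <;> first | rfl | (revert i; decide)

/-- The half rocket from two vertical strands to a square. -/
def upperRocketV : Foam verticalWeb squareWeb where
  arc := Equiv.sumCongr (Equiv.refl Empty) Equiv.boolNot
  rot := fun _ => 0
  Ring := Empty
  hol := Empty.elim
  Facet := Option (Bool × Bool)
  genus := fun _ => 0
  attach
    | .inl (.inr (.inl (b, i))) => rocketV b i
    | .inl (.inr (.inr (.inl m))) => m.elim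
    | .inl (.inr (.inr (.inr b))) => some (!b, false)
    | .inl (.inl (.inl (v, _))) => v.elim
    | .inl (.inl (.inr (.inl m))) => m.elim
    | .inl (.inl (.inr (.inr b))) => some (b, false)
    | .inr (k, _) => k.elim
  attach_next := by
    rintro (((⟨⟨⟩, _⟩ | ⟨⟨⟩⟩ | b) | (⟨b, i⟩ | ⟨⟨⟩⟩ | b)) | ⟨⟨⟩, _⟩) <;>
      cases b <;> first | rfl | (revert i; decide)

/-! ## Drawings of the webs -/

/-- The boundary of a disc without marked points. -/
abbrev emptyRim : Rim where
  In := Empty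
  Out := Empty
  next := Equiv.refl _
  cyclic := by rintro (⟨⟨⟩⟩ | ⟨⟨⟩⟩)

/-- The boundary of a disc that a single strand passes through. -/
abbrev strandRim : Rim where
  In := Unit
  Out := Unit
  next := Equiv.sumComm _ _
  cyclic := by
    rintro (⟨⟩ | ⟨⟩) (⟨⟩ | ⟨⟩)
    exacts [⟨0, rfl⟩, ⟨1, rfl⟩, ⟨1, rfl⟩, ⟨0, rfl⟩]

/-- The boundary of the disc of `squareWeb`: north-west, south-west, south-east, north-east. -/
abbrev squareRim : Rim where
  In := Bool
  Out := Bool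
  next :=
    { toFun := Sum.elim (fun b => .inr (!b)) (fun b => .inl b)
      invFun := Sum.elim (fun b => .inr b) (fun b => .inl (!b))
      left_inv := by decide
      right_inv := by decide }
  cyclic := by
    have h : ∀ x y : Bool ⊕ Bool, ∃ n : Fin 4,
        (Sum.elim (fun b => .inr (!b)) (fun b => .inl b) : Bool ⊕ Bool → Bool ⊕ Bool)^[n] x = y := by
      decide
    intro x y
    obtain ⟨n, hn⟩ := h x y
    exact ⟨n, hn⟩

section Count

theorem card_quot {α : Type} (r : α → α → Prop) {k : ℕ} (f : α → Fin k) (p : Fin k → α)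
    (hr : ∀ a b, r a b → f a = f b) (hf : ∀ j, f (p j) = j)
    (hc : ∀ a, Quot.mk r a = Quot.mk r (p (f a))) : Nat.card (Quot r) = k := by
  have e : Quot r ≃ Fin k :=
    { toFun := Quot.lift f hr
      invFun := fun j => Quot.mk r (p j)
      left_inv := by rintro ⟨a⟩; exact (hc a).symm
      right_inv := hf }
  simpa using Nat.card_congr e

theorem quot_iterate {α : Type} (r : α → α → Prop) (g : α → α) (hg : ∀ a, r a (g a)) (n : ℕ)
    (a : α) : Quot.mk r a = Quot.mk r (g^[n] a) := by
  induction n generalizing a with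
  | zero => rfl
  | succ n ih => exact (Quot.sound (hg a)).trans (ih (g a))

theorem card_orbits {α : Type} (g : α → α) {k : ℕ} (f : α → Fin k) (p : Fin k → α)
    (hr : ∀ a, f a = f (g a)) (hf : ∀ j, f (p j) = j)
    (hc : ∀ a, ∃ n : Fin 4, g^[n] a = p (f a)) : Nat.card (Quot fun a b => b = g a) = k := by
  refine card_quot _ f p (by rintro a _ rfl; exact hr a) hf fun a => ?_
  obtain ⟨n, hn⟩ := hc a
  rw [← hn]
  exact quot_iterate (fun a b => b = g a) g (fun _ => rfl) n a

theorem card_components {α : Type} (g h : α → α) {k : ℕ} (f : α → Fin k) (p : Fin k → α)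
    (hr : ∀ a, f a = f (g a)) (hr' : ∀ a, f a = f (h a)) (hf : ∀ j, f (p j) = j)
    (hc : ∀ a, ∃ x : Fin 4 × Bool × Fin 4,
      g^[x.1] (bif x.2.1 then h (g^[x.2.2] a) else a) = p (f a)) :
    Nat.card (Quot fun a b => b = g a ∨ b = h a) = k := by
  refine card_quot _ f p ?_ hf fun a => ?_
  · rintro a _ (rfl | rfl)
    exacts [hr a, hr' a]
  · have hg := quot_iterate (fun a b => b = g a ∨ b = h a) g (fun _ => .inl rfl)
    obtain ⟨⟨m, b, n⟩, hn⟩ := hc a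
    cases b
    · rw [← hn]
      exact hg m a
    · rw [← hn]
      exact ((hg n a).trans (Quot.sound (.inr rfl))).trans (hg m _)

end Count

theorem planar_of {D : Rim} {A : PreWeb D.In D.Out} {v f e c : ℕ}
    (hv : Nat.card (Quot fun a b : Dart A => b = rotateDart A a) = v)
    (hf : Nat.card (Quot fun a b : Dart A => b = rotateDart A (flipDart A a)) = f)
    (he : Nat.card A.Tail = e)
    (hc : Nat.card (Quot fun a b : Dart A => b = rotateDart A a ∨ b = flipDart A a) = c)
    (h : v + f = e + 2 * c) : A.Planar := by
  rw [PreWeb.Planar, hv, hf, he, hc, h]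

theorem emptyWeb_planar : PreWeb.Planar (D := emptyRim) emptyWeb := by
  have : IsEmpty (Dart (D := emptyRim) emptyWeb) :=
    ⟨by rintro ((⟨⟨⟩, _⟩ | ⟨⟨⟩⟩ | ⟨⟨⟩⟩) | (⟨⟨⟩, _⟩ | ⟨⟨⟩⟩ | ⟨⟨⟩⟩))⟩
  have : IsEmpty (PreWeb.Tail emptyWeb) := ⟨by rintro (⟨⟨⟩, _⟩ | ⟨⟨⟩⟩ | ⟨⟨⟩⟩)⟩
  refine planar_of (v := 0) (f := 0) (e := 0) (c := 0) ?_ ?_ ?_ ?_ rfl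
  · exact card_orbits _ isEmptyElim Fin.elim0 isEmptyElim (fun j => j.elim0) isEmptyElim
  · exact card_orbits (fun a => rotateDart _ (flipDart _ a)) isEmptyElim Fin.elim0 isEmptyElim
      (fun j => j.elim0) isEmptyElim
  · exact Nat.card_of_isEmpty
  · exact card_components _ _ isEmptyElim Fin.elim0 isEmptyElim isEmptyElim (fun j => j.elim0)
      isEmptyElim

theorem circleWeb_planar : PreWeb.Planar (D := emptyRim) circleWeb := by
  let f₀ : (Empty × ZMod 3 ⊕ (Unit ⊕ Empty)) ⊕ (Empty × ZMod 3 ⊕ (Unit ⊕ Empty)) → Fin 1 :=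
    fun _ => 0
  let f₁ : (Empty × ZMod 3 ⊕ (Unit ⊕ Empty)) ⊕ (Empty × ZMod 3 ⊕ (Unit ⊕ Empty)) → Fin 2 :=
    Sum.elim (fun _ => 0) (fun _ => 1)
  refine planar_of (v := 1) (f := 2) (e := 1) (c := 1) ?_ ?_ ?_ ?_ rfl
  · exact card_orbits _ f₀ ![.inl (.inr (.inl ()))] (by decide) (by decide) (by decide)
  · exact card_orbits (fun a => rotateDart _ (flipDart _ a)) f₁
      ![.inl (.inr (.inl ())), .inr (.inr (.inl ()))] (by decide) (by decide) (by decide)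
  · exact Nat.card_eq_fintype_card (α := Empty × ZMod 3 ⊕ (Unit ⊕ Empty))
  · exact card_components _ _ f₀ ![.inl (.inr (.inl ()))] (by decide) (by decide) (by decide)
      (by decide)

theorem strandWeb_planar : PreWeb.Planar (D := strandRim) strandWeb := by
  let f₀ : (Empty × ZMod 3 ⊕ (Empty ⊕ Unit)) ⊕ (Empty × ZMod 3 ⊕ (Empty ⊕ Unit)) → Fin 1 :=
    fun _ => 0
  let f₁ : (Empty × ZMod 3 ⊕ (Empty ⊕ Unit)) ⊕ (Empty × ZMod 3 ⊕ (Empty ⊕ Unit)) → Fin 2 :=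
    Sum.elim (fun _ => 0) (fun _ => 1)
  refine planar_of (v := 1) (f := 2) (e := 1) (c := 1) ?_ ?_ ?_ ?_ rfl
  · exact card_orbits _ f₀ ![.inl (.inr (.inr ()))] (by decide) (by decide) (by decide)
  · exact card_orbits (fun a => rotateDart _ (flipDart _ a)) f₁
      ![.inl (.inr (.inr ())), .inr (.inr (.inr ()))] (by decide) (by decide) (by decide)
  · exact Nat.card_eq_fintype_card (α := Empty × ZMod 3 ⊕ (Empty ⊕ Unit))
  · exact card_components _ _ f₀ ![.inl (.inr (.inr ()))] (by decide) (by decide) (by decide)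
      (by decide)

theorem bigonWeb_planar : PreWeb.Planar (D := strandRim) bigonWeb := by
  let f₀ : (Unit × ZMod 3 ⊕ (Empty ⊕ Unit)) ⊕ (Unit × ZMod 3 ⊕ (Empty ⊕ Unit)) → Fin 1 :=
    fun _ => 0
  let f₁ : (Unit × ZMod 3 ⊕ (Empty ⊕ Unit)) ⊕ (Unit × ZMod 3 ⊕ (Empty ⊕ Unit)) → Fin 3 :=
    Sum.elim (Sum.elim (fun _ => 1) (fun _ => 0)) (Sum.elim (fun _ => 2) (fun _ => 0))
  let f₂ : (Unit × ZMod 3 ⊕ (Empty ⊕ Unit)) ⊕ (Unit × ZMod 3 ⊕ (Empty ⊕ Unit)) → Fin 3 :=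
    Sum.elim (Sum.elim (fun a => ![0, 2, 1] a.2) (fun _ => 0))
      (Sum.elim (fun a => ![1, 0, 2] a.2) (fun _ => 1))
  refine planar_of (v := 3) (f := 3) (e := 4) (c := 1) ?_ ?_ ?_ ?_ rfl
  · exact card_orbits _ f₁ ![.inl (.inr (.inr ())), .inl (.inl ((), 0)), .inr (.inl ((), 0))]
      (by decide) (by decide) (by decide)
  · exact card_orbits (fun a => rotateDart _ (flipDart _ a)) f₂
      ![.inl (.inl ((), 0)), .inl (.inl ((), 2)), .inl (.inl ((), 1))]
      (by decide) (by decide) (by decide)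
  · exact Nat.card_eq_fintype_card (α := Unit × ZMod 3 ⊕ (Empty ⊕ Unit))
  · exact card_components _ _ f₀ ![.inl (.inr (.inr ()))] (by decide) (by decide) (by decide)
      (by decide)

theorem squareWeb_planar : PreWeb.Planar (D := squareRim) squareWeb := by
  let f₀ : (Bool × ZMod 3 ⊕ (Empty ⊕ Bool)) ⊕ (Bool × ZMod 3 ⊕ (Empty ⊕ Bool)) → Fin 1 :=
    fun _ => 0
  let f₁ : (Bool × ZMod 3 ⊕ (Empty ⊕ Bool)) ⊕ (Bool × ZMod 3 ⊕ (Empty ⊕ Bool)) → Fin 5 :=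
    Sum.elim (Sum.elim (fun a => bif a.1 then 1 else 2) (fun _ => 0))
      (Sum.elim (fun a => bif a.1 then 3 else 4) (fun _ => 0))
  let f₂ : (Bool × ZMod 3 ⊕ (Empty ⊕ Bool)) ⊕ (Bool × ZMod 3 ⊕ (Empty ⊕ Bool)) → Fin 5 :=
    Sum.elim (Sum.elim (fun a => bif a.1 then ![3, 0, 4] a.2 else ![1, 0, 2] a.2)
        (Sum.elim Empty.elim fun b => bif b then 1 else 3))
      (Sum.elim (fun a => bif a.1 then ![4, 1, 0] a.2 else ![2, 3, 0] a.2)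
        (Sum.elim Empty.elim fun b => bif b then 4 else 2))
  refine planar_of (v := 5) (f := 5) (e := 8) (c := 1) ?_ ?_ ?_ ?_ rfl
  · exact card_orbits _ f₁ ![.inl (.inr (.inr true)), .inl (.inl (true, 0)),
      .inl (.inl (false, 0)), .inr (.inl (true, 0)), .inr (.inl (false, 0))]
      (by decide) (by decide) (by decide)
  · exact card_orbits (fun a => rotateDart _ (flipDart _ a)) f₂
      ![.inl (.inl (true, 1)), .inl (.inl (false, 0)), .inr (.inl (false, 0)),
        .inl (.inl (true, 0)), .inr (.inl (true, 0))]
      (by decide) (by decide) (by decide)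
  · exact Nat.card_eq_fintype_card (α := Bool × ZMod 3 ⊕ (Empty ⊕ Bool))
  · exact card_components _ _ f₀ ![.inl (.inr (.inr true))] (by decide) (by decide) (by decide)
      (by decide)

theorem horizontalWeb_planar : PreWeb.Planar (D := squareRim) horizontalWeb := by
  let f₀ : (Empty × ZMod 3 ⊕ (Empty ⊕ Bool)) ⊕ (Empty × ZMod 3 ⊕ (Empty ⊕ Bool)) → Fin 1 :=
    fun _ => 0
  let f₁ : (Empty × ZMod 3 ⊕ (Empty ⊕ Bool)) ⊕ (Empty × ZMod 3 ⊕ (Empty ⊕ Bool)) → Fin 3 :=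
    Sum.elim (fun _ => 0) (Sum.elim (fun _ => 0) (Sum.elim (fun _ => 0) fun b => bif b then 1 else 2))
  refine planar_of (v := 1) (f := 3) (e := 2) (c := 1) ?_ ?_ ?_ ?_ rfl
  · exact card_orbits _ f₀ ![.inl (.inr (.inr true))] (by decide) (by decide) (by decide)
  · exact card_orbits (fun a => rotateDart _ (flipDart _ a)) f₁
      ![.inl (.inr (.inr true)), .inr (.inr (.inr true)), .inr (.inr (.inr false))]
      (by decide) (by decide) (by decide)
  · exact Nat.card_eq_fintype_card (α := Empty × ZMod 3 ⊕ (Empty ⊕ Bool))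
  · exact card_components _ _ f₀ ![.inl (.inr (.inr true))] (by decide) (by decide) (by decide)
      (by decide)

theorem verticalWeb_planar : PreWeb.Planar (D := squareRim) verticalWeb := by
  let f₀ : (Empty × ZMod 3 ⊕ (Empty ⊕ Bool)) ⊕ (Empty × ZMod 3 ⊕ (Empty ⊕ Bool)) → Fin 1 :=
    fun _ => 0
  let f₁ : (Empty × ZMod 3 ⊕ (Empty ⊕ Bool)) ⊕ (Empty × ZMod 3 ⊕ (Empty ⊕ Bool)) → Fin 3 :=
    Sum.elim (Sum.elim (fun _ => 0) (Sum.elim (fun _ => 0) fun b => bif b then 1 else 2)) (fun _ => 0)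
  refine planar_of (v := 1) (f := 3) (e := 2) (c := 1) ?_ ?_ ?_ ?_ rfl
  · exact card_orbits _ f₀ ![.inl (.inr (.inr true))] (by decide) (by decide) (by decide)
  · exact card_orbits (fun a => rotateDart _ (flipDart _ a)) f₁
      ![.inr (.inr (.inr true)), .inl (.inr (.inr true)), .inl (.inr (.inr false))]
      (by decide) (by decide) (by decide)
  · exact Nat.card_eq_fintype_card (α := Empty × ZMod 3 ⊕ (Empty ⊕ Bool))
  · exact card_components _ _ f₀ ![.inl (.inr (.inr true))] (by decide) (by decide) (by decide)
      (by decide)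

/-! ## The category of foams -/

section Category

variable (S : Type u) [CommRing S]

instance (I O : Type) : Quiver (PreWeb I O) := ⟨Foam⟩

/-- The free `S`-linear category on foams: formal linear combinations of composable sequences. -/
abbrev Formal (I O : Type) : Type 1 := Free S (Paths (PreWeb I O))

/-- A web as an object of the free category. -/
def PreWeb.formal {I O : Type} (A : PreWeb I O) : Formal S I O :=
  Free.of S ((Paths.of (PreWeb I O)).obj A)

/-- A foam as a morphism of the free category. -/
noncomputable def Foam.formal {I O : Type} {A B : PreWeb I O} (F : Foam A B) :
    A.formal S ⟶ B.formal S :=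
  (Free.embedding S (Paths (PreWeb I O))).map ((Paths.of (PreWeb I O)).map F)

variable [Invertible (2 : S)] [Invertible (3 : S)]

open Finsupp in
/-- The local relations: the linear combinations of foams, all with the same boundary, that are set to
zero. -/
inductive LocalRel : {I O : Type} → {A B : PreWeb I O} → (Foam A B →₀ S) → Prop
  | sphere : LocalRel (single (closedSurface 0) 1)
  | torus : LocalRel (single (closedSurface 1) 1 - single (idFoam emptyWeb) 3)
  | doubleTorus : LocalRel (single (closedSurface 2) 1)
  | tripleTorusDisc :
      LocalRel (single (closedTheta fun i => if i = 0 then 2 else if i = 1 then 1 else 0) 1)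
  | neckCutting (x y z : Foam circleWeb circleWeb) (_ : Gluing (capFoam 1) (cupFoam 0) x)
      (_ : Gluing capChoke cupChoke y) (_ : Gluing (capFoam 0) (cupFoam 1) z) :
      LocalRel (single (idFoam circleWeb) 1 -
        (single x (⅟3) - single y (⅟3 * ⅟3) + single z (⅟3)))
  | airlock (x : Foam circleWeb circleWeb) (_ : Gluing (capFoam 0) (cupFoam 0) x) :
      LocalRel (single airlock 1 + single x 1)
  | tube (x y : Foam bigonWeb bigonWeb) (_ : Gluing lowerKiss upperBubble x)
      (_ : Gluing lowerBubble upperKiss y) :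
      LocalRel (single (idFoam bigonWeb) 1 - (single x (⅟2) + single y (⅟2)))
  | rocket (x y : Foam squareWeb squareWeb) (_ : Gluing lowerRocketH upperRocketH x)
      (_ : Gluing lowerRocketV upperRocketV y) :
      LocalRel (single (idFoam squareWeb) 1 + single x 1 + single y 1)
  | seamSwap : LocalRel (single (seamFoam (Equiv.refl _)) 1 + single (seamFoam (Equiv.neg _)) 1)
  | twistedSeamSwap : LocalRel (single (twistedSeam 1) 1 + single (twistedSeam (-1)) 1)

/-- The relations between morphisms of the free category: a composable pair of foams equals the foam
obtained by gluing them, `A × [0,1]` is the identity, and the canopolis ideal generated by the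
local relations is zero. As a foam only depends on the identification of its boundary with the
sphere around the can, and as bending the source of the can is an invertible planar operation,
this ideal is generated under composition by the disjoint unions `A × [0,1] ⊔ F` of
identities and bent local relations. The local relations themselves, which can be recovered from
these, are listed too. -/
inductive Rel {I O : Type} [Finite I] [Finite O] : HomRel (Formal S I O)
  | refl {X Y : Formal S I O} (f : X ⟶ Y) : Rel f f
  | symm {X Y : Formal S I O} (f g : X ⟶ Y) : Rel f g → Rel g f
  | trans {X Y : Formal S I O} (f g h : X ⟶ Y) : Rel f g → Rel g h → Rel f h
  | comp_left {X Y Z : Formal S I O} (f : X ⟶ Y) (g g' : Y ⟶ Z) :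
      Rel g g' → Rel (f ≫ g) (f ≫ g')
  | comp_right {X Y Z : Formal S I O} (f f' : X ⟶ Y) (g : Y ⟶ Z) :
      Rel f f' → Rel (f ≫ g) (f' ≫ g)
  | add {X Y : Formal S I O} (f f' g g' : X ⟶ Y) :
      Rel f f' → Rel g g' → Rel (f + g) (f' + g')
  | smul {X Y : Formal S I O} (a : S) (f f' : X ⟶ Y) : Rel f f' → Rel (a • f) (a • f')
  | one (A : PreWeb I O) : Rel ((idFoam A).formal S) (𝟙 (A.formal S))
  | glue {A B C : PreWeb I O} (F : Foam A B) (G : Foam B C) (H : Foam A C) (_ : Gluing F G H) :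
      Rel (F.formal S ≫ G.formal S) (H.formal S)
  | rel {A B : PreWeb I O} (x : Foam A B →₀ S) (_ : LocalRel S x) :
      Rel (x.sum fun F a => a • F.formal S) 0
  | planar {I' O' : Type} [Finite I'] [Finite O'] {A' B' : PreWeb I' O'} (x : Foam A' B' →₀ S)
      (_ : LocalRel S x) (A : PreWeb I O) :
      Rel (x.sum fun F a => a • ((idFoam A).adjoin F.bend).formal S) 0

instance {I O : Type} [Finite I] [Finite O] : Congruence (Rel S (I := I) (O := O)) where
  comp_left f _ _ h := .comp_left f _ _ h
  comp_right g h := .comp_right _ _ g h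
  equivalence := ⟨.refl, .symm _ _, .trans _ _ _⟩

/-- The `S`-linear category of all webs with given boundary and foams modulo the relations. -/
abbrev FoamCat (I O : Type) [Finite I] [Finite O] : Type 1 := Quotient (Rel S (I := I) (O := O))

noncomputable instance (I O : Type) [Finite I] [Finite O] : Preadditive (FoamCat S I O) :=
  Quotient.preadditive _ fun _ _ _ _ _ _ h h' => .add _ _ _ _ h h'

instance (I O : Type) [Finite I] [Finite O] : (Quotient.functor (Rel S (I := I) (O := O))).Additive :=
  Quotient.functor_additive _ fun _ _ _ _ _ _ h h' => .add _ _ _ _ h h'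

noncomputable instance (I O : Type) [Finite I] [Finite O] : Linear S (FoamCat S I O) :=
  Quotient.linear S _ fun a _ _ _ _ h => .smul a _ _ h

/-- A web drawn in a disc with boundary `D`, with a formal grading shift `q ^ shift`. -/
structure GradedWeb (D : Rim) : Type 1 where
  web : PreWeb D.In D.Out
  planar : web.Planar
  shift : ℤ

/-- The category of graded webs drawn in a disc with boundary `D`; morphisms are linear
combinations of foams of all degrees modulo the relations. -/
abbrev Cob3 (D : Rim) : Type 1 :=
  InducedCategory (FoamCat S D.In D.Out)
    fun X : GradedWeb D => (Quotient.functor (Rel S)).obj (X.web.formal S)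

/-- The morphism of graded webs given by a foam. -/
noncomputable def Foam.mor {D : Rim} (X Y : GradedWeb D) (F : Foam X.web Y.web) :
    (show Cob3 S D from X) ⟶ (show Cob3 S D from Y) :=
  InducedCategory.homMk ((Quotient.functor (Rel S)).map (F.formal S))

/-- A morphism of graded webs is homogeneous of degree `d` if it is a linear combination of foams of
degree `d`; grading shifts `q ^ m` of the source and `q ^ n` of the target add `n - m` to the degree
of a foam. -/
def IsHomogeneous {D : Rim} (d : ℤ) {X Y : GradedWeb D}
    (f : (show Cob3 S D from X) ⟶ (show Cob3 S D from Y)) : Prop :=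
  f ∈ Submodule.span S {g | ∃ F : Foam X.web Y.web, F.deg + Y.shift - X.shift = d ∧ g = F.mor S X Y}

/-- A morphism of direct sums of graded webs all of whose matrix entries are of degree zero. -/
def IsGraded {D : Rim} {M N : Mat_ (Cob3 S D)} (f : M ⟶ N) : Prop :=
  ∀ i j, IsHomogeneous S 0 (X := M.X i) (Y := N.X j) (f i j)

end Category

/-- `q ^ m` times the empty web. -/
def qEmpty (m : ℤ) : GradedWeb emptyRim := ⟨emptyWeb, emptyWeb_planar, m⟩

/-- `q ^ m` times the circle. -/
def qCircle (m : ℤ) : GradedWeb emptyRim := ⟨circleWeb, circleWeb_planar, m⟩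

/-- `q ^ m` times the strand. -/
def qStrand (m : ℤ) : GradedWeb strandRim := ⟨strandWeb, strandWeb_planar, m⟩

/-- `q ^ m` times the bigon. -/
def qBigon (m : ℤ) : GradedWeb strandRim := ⟨bigonWeb, bigonWeb_planar, m⟩

/-- `q ^ m` times the square. -/
def qSquare (m : ℤ) : GradedWeb squareRim := ⟨squareWeb, squareWeb_planar, m⟩

/-- `q ^ m` times the two horizontal strands. -/
def qHorizontal (m : ℤ) : GradedWeb squareRim := ⟨horizontalWeb, horizontalWeb_planar, m⟩

/-- `q ^ m` times the two vertical strands. -/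
def qVertical (m : ℤ) : GradedWeb squareRim := ⟨verticalWeb, verticalWeb_planar, m⟩

end SeamedFoam

open SeamedFoam

/-! For each of the three pairs, one of the two composites is a local relation. Neck cutting, the
tube relation and the three rocket relation express the identity of the circle, of the bigon and of
the square as the sum of the composites that pass through the smaller webs (`id_circle`, `id_bigon`,
`id_square`). The other composite is a matrix whose entries are foams between webs without vertices,
and the work lies in evaluating these entries.

To apply a relation inside a foam `H`, it is written as the disjoint union of an identity and a
piece `K`, followed by a foam `F` with punctured facets (`Filling`, `Filling.gluing`,
`Filling.cls_comp`). Composing the planar form of a local relation with the punctured foam then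
yields rules for foams with flat ends: a sphere or a closed surface of genus 2 kills the foam, a
torus contributes 3, an airlock contributes -1, reversing a closed seam contributes -1, and a neck
can be cut (`cls_addFacet_zero`, `cls_addFacet_one`, `cls_addFacet_two`, `cls_addAirlock`,
`cls_addRing`, `cls_eq_of_neck`). As 2 is invertible, a foam vanishes if reversing an odd number of
its seams gives an isomorphic foam (`cls_eq_zero_of_eq_neg`).

Circle: cups and caps give closed surfaces of genus 0, 1, 2. A choking torus and a cup or cap give
three surfaces of genus g, 1, 0 along one seam, which vanish because two of them can be exchanged
(`cls_thetaFoam`). Two choking tori give two tori joined by an airlock, with value -9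
(`cls_chokeFoam`).

Bigon: a bubble vanishes by exchanging its two discs (`cls_bubbleFoam`). If its sheets kiss twice,
exchanging them reverses three seams, so the foam vanishes again (`cls_doubleKissFoam`). If they
kiss once, one sheet is an annulus between the two seams. Cutting it gives a foam with two
exchangeable discs (value 0), a foam with a twisted airlock to a torus (value 3) and a foam with two
choking tori (value -9). With the coefficients of neck cutting this adds up to 2 (`cls_kissFoam`).

Square: a rocket followed by the half rocket of the same kind is an airlock between two sheets, with
both seams reversed in the horizontal case, and so has value -1 (`cls_rocketFoamH`,
`cls_rocketFoamV`). In the mixed case the seam arcs close up to one seam with two discs on a saddle,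
which can be exchanged (`cls_rocketFoamHV`, `cls_rocketFoamVH`).

That an explicit foam is a composite of two others is a statement about finite data: classes of
facets, Euler characteristics and cycles of seam arcs. `FacetGluing.of_linked`, `FacetGluing.gluing`
and `FacetGluing.gluingFlat` reduce it to finite checks; the degrees follow from the same count of
boundary circles. -/

namespace SeamedFoam

universe u

/-! ### Classes of foams -/

section Classes

variable {I O : Type} [Finite I] [Finite O] {A B C : PreWeb I O}
variable (S : Type u) [CommRing S] [Invertible (2 : S)] [Invertible (3 : S)]

/-- The morphism of the foam category represented by a foam. -/
noncomputable def Foam.cls (F : Foam A B) :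
    (Quotient.functor (Rel S)).obj (A.formal S) ⟶ (Quotient.functor (Rel S)).obj (B.formal S) :=
  (Quotient.functor (Rel S)).map (F.formal S)

theorem cls_idFoam (A : PreWeb I O) : (idFoam A).cls S = 𝟙 _ :=
  (CategoryTheory.Quotient.sound _ (Rel.one A)).trans ((Quotient.functor (Rel S)).map_id _)

theorem Gluing.cls_comp {F : Foam A B} {G : Foam B C} {H : Foam A C} (g : Gluing F G H) :
    F.cls S ≫ G.cls S = H.cls S :=
  ((Quotient.functor (Rel S)).map_comp _ _).symm.trans
    (CategoryTheory.Quotient.sound _ (Rel.glue F G H g))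

theorem functor_map_sum (x : Foam A B →₀ S) :
    (Quotient.functor (Rel S)).map (x.sum fun F a => a • F.formal S) =
      Finsupp.linearCombination S (fun F : Foam A B => F.cls S) x := by
  rw [Finsupp.linearCombination_apply, Finsupp.sum, Finsupp.sum, Functor.map_sum]
  rfl

theorem LocalRel.linearCombination_eq_zero {x : Foam A B →₀ S} (h : LocalRel S x) :
    Finsupp.linearCombination S (fun F : Foam A B => F.cls S) x = 0 := by
  rw [← functor_map_sum]
  exact (CategoryTheory.Quotient.sound _ (Rel.rel x h)).trans ((Quotient.functor (Rel S)).map_zero _ _)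

/-- The planar form of a relation: its two ends are bent into one closed web, next to the identity
of an arbitrary web. This is what allows a relation to be used inside a larger foam. -/
theorem LocalRel.linearCombination_adjoin_eq_zero {I' O' : Type} [Finite I'] [Finite O']
    {A' B' : PreWeb I' O'} {x : Foam A' B' →₀ S} (h : LocalRel S x) (A : PreWeb I O) :
    Finsupp.linearCombination S (fun F : Foam A' B' => ((idFoam A).adjoin F.bend).cls S) x = 0 := by
  have h1 := (CategoryTheory.Quotient.sound _ (Rel.planar x h A)).trans
    ((Quotient.functor (Rel S)).map_zero _ _)
  rw [Finsupp.sum, Functor.map_sum] at h1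
  rw [Finsupp.linearCombination_apply, Finsupp.sum]
  exact h1

end Classes

/-! ### Counting orbits -/

section Orbits

variable {α β γ : Type} {Φ Ψ : Type}

/-- The orbits of a map. -/
abbrev Orbit (n : α → α) : Type := Quot fun s t => t = n s

/-- The number of orbits of `n` on which the labelling `f` takes the value `φ`. -/
noncomputable def orbitCount (n : α → α) (f : α → Φ) (φ : Φ) : ℕ :=
  Nat.card {c : Orbit n // ∃ s, Quot.mk _ s = c ∧ f s = φ}

/-- The attaching map is constant along `pieceNext`, so a boundary circle belongs to the facet of
any of its pieces. `orbitCount` asks for some representative with the right label instead of a label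
on the quotient; it thus makes sense for every labelling and is easily transported. -/
theorem Foam.chi_eq_orbitCount {I O : Type} {A B : PreWeb I O} (F : Foam A B) (φ : F.Facet) :
    F.chi φ = 2 - 2 * (F.genus φ : ℤ) -
      orbitCount (pieceNext F.arc F.rot F.hol) F.attach φ := by
  unfold Foam.chi orbitCount
  congr 2
  refine Nat.card_congr (Equiv.subtypeEquivRight ?_)
  rintro ⟨s⟩
  constructor
  · intro h
    exact ⟨s, rfl, h⟩
  · rintro ⟨t, h, rfl⟩
    exact (congrArg F.circleFacet h).symm

theorem orbitCount_congr (e : α ≃ β) {n : α → α} {m : β → β} {f : α → Φ} {g : β → Φ}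
    (hn : ∀ s, e (n s) = m (e s)) (hf : ∀ s, g (e s) = f s) (φ : Φ) :
    orbitCount n f φ = orbitCount m g φ := by
  have hn' : ∀ a b, b = n a ↔ e b = m (e a) := fun a b => by rw [← hn, e.apply_eq_iff_eq]
  refine Nat.card_congr ((Quot.congr (rb := fun s t => t = m s) e hn').subtypeEquiv ?_)
  rintro ⟨s⟩
  constructor
  · rintro ⟨t, h, rfl⟩
    exact ⟨e t, congrArg (Quot.congr (rb := fun s t => t = m s) e hn') h, hf t⟩
  · rintro ⟨t, h, rfl⟩
    refine ⟨e.symm t, (Quot.congr (rb := fun s t => t = m s) e hn').injective ?_, by rw [← hf, e.apply_symm_apply]⟩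
    refine Eq.trans ?_ h
    exact congrArg (Quot.mk _) (e.apply_symm_apply t)

/-- The orbits of a map on a disjoint union. -/
def orbitSum (n : α → α) (m : β → β) : Orbit (Sum.map n m) ≃ Orbit n ⊕ Orbit m where
  toFun := Quot.lift (Sum.map (Quot.mk _) (Quot.mk _)) (by
    rintro (a | b) _ rfl
    · exact congrArg Sum.inl (Quot.sound rfl)
    · exact congrArg Sum.inr (Quot.sound rfl))
  invFun := Sum.elim (Quot.lift (fun a => Quot.mk _ (.inl a)) fun _ _ h => Quot.sound (by rw [h]; rfl))
    (Quot.lift (fun a => Quot.mk _ (.inr a)) fun _ _ h => Quot.sound (by rw [h]; rfl))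
  left_inv := by rintro ⟨a | b⟩ <;> rfl
  right_inv := by rintro (⟨⟨a⟩⟩ | ⟨⟨b⟩⟩) <;> rfl

theorem orbitCount_sum [Finite α] [Finite β] (n : α → α) (m : β → β) (f : α ⊕ β → Φ)
    (φ : Φ) :
    orbitCount (Sum.map n m) f φ =
      orbitCount n (f ∘ Sum.inl) φ + orbitCount m (f ∘ Sum.inr) φ := by
  unfold orbitCount
  rw [← Nat.card_sum]
  refine Nat.card_congr (Equiv.trans ?_ (Equiv.subtypeSum
    (p := fun c : Orbit n ⊕ Orbit m => ∃ s, orbitSum n m (Quot.mk _ s) = c ∧ f s = φ))|>.trans ?_)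
  · refine (orbitSum n m).subtypeEquiv fun c => ?_
    simp only [(orbitSum n m).apply_eq_iff_eq]
  · refine Equiv.sumCongr (Equiv.subtypeEquivRight fun c => ?_) (Equiv.subtypeEquivRight fun c => ?_)
    · constructor
      · rintro ⟨s | s, h, hs⟩
        · exact ⟨s, Sum.inl_injective h, hs⟩
        · cases h
      · rintro ⟨s, rfl, hs⟩
        exact ⟨.inl s, rfl, hs⟩
    · constructor
      · rintro ⟨s | s, h, hs⟩
        · cases h
        · exact ⟨s, Sum.inr_injective h, hs⟩
      · rintro ⟨s, rfl, hs⟩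
        exact ⟨.inr s, rfl, hs⟩

theorem orbitCount_id (f : α → Φ) (φ : Φ) :
    orbitCount id f φ = Nat.card {a // f a = φ} := by
  have hq : ∀ a b : α, Quot.mk (fun s t => t = id s) a = Quot.mk _ b → a = b := fun a b h =>
    congrArg (Quot.lift id fun _ _ h => h.symm) h
  refine (Nat.card_congr (Equiv.ofBijective
    (fun a : {a // f a = φ} => (⟨Quot.mk _ a.1, a.1, rfl, a.2⟩ :
      {c : Orbit (id : α → α) // ∃ s, Quot.mk _ s = c ∧ f s = φ})) ⟨?_, ?_⟩)).symm
  · intro a b h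
    exact Subtype.ext (hq _ _ (congrArg Subtype.val h))
  · rintro ⟨_, s, rfl, hs⟩
    exact ⟨⟨s, hs⟩, rfl⟩

/-- By invariance of `f` an orbit has exactly one label, and the orbits can be sorted by it before
relabelling. This turns the circles of a merged facet into a sum over the facets that merge. -/
theorem orbitCount_comp [Finite α] [Fintype Ψ] [DecidableEq Φ] (n : α → α) (f : α → Ψ)
    (hf : ∀ s, f (n s) = f s) (a : Ψ → Φ) (φ : Φ) :
    orbitCount n (a ∘ f) φ = ∑ x, if a x = φ then orbitCount n f x else 0 := by
  classical
  have hq : ∀ s t, Quot.mk (fun s t => t = n s) s = Quot.mk _ t → f s = f t := fun s t h =>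
    congrArg (Quot.lift f (by rintro a _ rfl; exact (hf a).symm)) h
  rw [← Finset.sum_filter, ← Finset.sum_coe_sort, ]
  unfold orbitCount
  rw [← Nat.card_sigma]
  let F : (Σ x : {x // x ∈ Finset.univ.filter fun x => a x = φ},
      {c : Orbit n // ∃ s, Quot.mk _ s = c ∧ f s = x.1}) →
      {c : Orbit n // ∃ s, Quot.mk _ s = c ∧ (a ∘ f) s = φ} := fun c => ⟨c.2.1, by
    obtain ⟨⟨x, hx⟩, c, s, hs, hs'⟩ := c
    exact ⟨s, hs, (congrArg a hs').trans (Finset.mem_filter.1 hx).2⟩⟩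
  refine (Nat.card_congr (Equiv.ofBijective F ⟨?_, ?_⟩)).symm
  · rintro ⟨⟨x, hx⟩, ⟨c, s, hs, hs'⟩⟩ ⟨⟨y, hy⟩, ⟨d, t, ht, ht'⟩⟩ h
    obtain rfl : c = d := congrArg Subtype.val h
    obtain rfl : x = y := hs'.symm.trans ((hq _ _ (hs.trans ht.symm)).trans ht')
    rfl
  · rintro ⟨_, s, rfl, hs⟩
    exact ⟨⟨⟨f s, Finset.mem_filter.2 ⟨Finset.mem_univ _, hs⟩⟩, _, s, rfl, rfl⟩, rfl⟩

/-- The invariant `ix` separates the representatives `p`, and every point runs into its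
representative, so `ι` indexes the orbits. Bounding the number of steps keeps the condition
decidable; three steps suffice for the circles met here. -/
theorem orbitCount_eq_card {ι : Type} [Fintype ι] [DecidableEq Φ] (n : α → α) (f : α → Φ)
    (ix : α → ι) (p : ι → α) (hf : ∀ s, f (n s) = f s) (hix : ∀ s, ix (n s) = ix s)
    (hp : ∀ j, ix (p j) = j) (hc : ∀ s, ∃ k : Fin 4, n^[k] s = p (ix s)) (φ : Φ) :
    orbitCount n f φ = ∑ j, if f (p j) = φ then 1 else 0 := by
  have hq : ∀ s t, Quot.mk (fun s t => t = n s) s = Quot.mk _ t → f s = f t := fun s t h =>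
    congrArg (Quot.lift f (by rintro a _ rfl; exact (hf a).symm)) h
  have hqi : ∀ s t, Quot.mk (fun s t => t = n s) s = Quot.mk _ t → ix s = ix t := fun s t h =>
    congrArg (Quot.lift ix (by rintro a _ rfl; exact (hix a).symm)) h
  rw [← Finset.sum_filter, Finset.sum_const, smul_eq_mul, mul_one, ← Fintype.card_subtype,
    ← Nat.card_eq_fintype_card]
  refine (Nat.card_congr (Equiv.ofBijective (fun j : {j // f (p j) = φ} =>
    (⟨Quot.mk _ (p j.1), p j.1, rfl, j.2⟩ :
      {c : Orbit n // ∃ s, Quot.mk _ s = c ∧ f s = φ})) ⟨?_, ?_⟩)).symm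
  · intro j k h
    have := hqi _ _ (congrArg Subtype.val h)
    rw [hp, hp] at this
    exact Subtype.ext this
  · rintro ⟨_, s, rfl, hs⟩
    obtain ⟨k, hk⟩ := hc s
    have h1 := quot_iterate (fun s t => t = n s) n (fun _ => rfl) k s
    rw [hk] at h1
    exact ⟨⟨ix s, (hq _ _ h1).symm.trans hs⟩, Subtype.ext h1.symm⟩

theorem orbitCount_comp_injective (n : α → α) (f : α → Ψ) {a : Ψ → Φ} (ha : Function.Injective a)
    (ψ : Ψ) : orbitCount n (a ∘ f) (a ψ) = orbitCount n f ψ := by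
  simp only [orbitCount, Function.comp_apply, ha.eq_iff]

theorem orbitCount_eq_zero (n : α → α) (f : α → Φ) {φ : Φ} (h : ∀ s, f s ≠ φ) :
    orbitCount n f φ = 0 := by
  have : IsEmpty {c : Orbit n // ∃ s, Quot.mk _ s = c ∧ f s = φ} :=
    ⟨fun ⟨_, s, _, hs⟩ => h s hs⟩
  exact Nat.card_of_isEmpty

theorem finsum_subtype [Fintype α] (q : α → Prop) [DecidablePred q] (g : α → ℤ) :
    ∑ᶠ x : {x // q x}, g x.1 = ∑ x, if q x then g x else 0 := by
  rw [finsum_eq_sum_of_fintype, ← Finset.sum_filter]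
  exact (Finset.sum_subtype _ (by simp) _).symm

theorem card_subtype_eq_sum [Fintype α] (q : α → Prop) [DecidablePred q] :
    (Nat.card {x // q x} : ℤ) = ∑ x, if q x then 1 else 0 := by
  rw [Nat.card_eq_fintype_card, Fintype.card_subtype, Finset.sum_boole]

end Orbits

/-! ### Filling punctures -/

section Fill

variable {I O : Type}

/-- A web all of whose edges join boundary points. -/
class PreWeb.Flat (A : PreWeb I O) : Prop where
  snk : IsEmpty A.Snk
  src : IsEmpty A.Src
  mrk : IsEmpty A.Mrk

attribute [instance] PreWeb.Flat.snk PreWeb.Flat.src PreWeb.Flat.mrk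

/-- A closed web that consists of circles with one marked point each. -/
class PreWeb.Loops (W : PreWeb Empty Empty) : Prop where
  snk : IsEmpty W.Snk
  src : IsEmpty W.Src
  edge_mrk : ∀ m, W.edge (.inr (.inl m)) = .inr (.inl m)

attribute [instance] PreWeb.Loops.snk PreWeb.Loops.src

variable {A B : PreWeb I O} {W : PreWeb Empty Empty}

/-- `pieceNext` on the pieces that do not lie on closed seams. -/
def outerNext (arc : A.Snk ⊕ B.Src ≃ A.Src ⊕ B.Snk) (rot : A.Snk ⊕ B.Src → ZMod 3) :
    A.Tail ⊕ B.Head → A.Tail ⊕ B.Head :=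
  fun x => turn arc rot (Sum.map A.edge B.edge.symm x)

/-- `pieceNext` on the sides of closed seams. -/
def sideNext {R : Type} (hol : R → ZMod 3) : R × ZMod 3 → R × ZMod 3 := fun k => (k.1, k.2 + hol
    k.1)

theorem pieceNext_eq_map (arc : A.Snk ⊕ B.Src ≃ A.Src ⊕ B.Snk) (rot : A.Snk ⊕ B.Src → ZMod 3)
    {R : Type} (hol : R → ZMod 3) :
    pieceNext arc rot hol = Sum.map (outerNext arc rot) (sideNext hol) := by
  funext x
  rcases x with x | ⟨k, i⟩ <;> rfl

theorem Foam.attach_outerNext (F : Foam A B) (s : A.Tail ⊕ B.Head) :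
    F.attach (.inl (outerNext F.arc F.rot s)) = F.attach (.inl s) := F.attach_next (.inl s)

theorem Foam.attach_sideNext (F : Foam A B) (s : F.Ring × ZMod 3) :
    F.attach (.inr (sideNext F.hol s)) = F.attach (.inr s) := F.attach_next (.inr s)

instance {Z V M : Type} [Finite V] [Finite M] [Finite Z] : Finite (Ends V M Z) :=
  inferInstanceAs (Finite (V × ZMod 3 ⊕ (M ⊕ Z)))

theorem Foam.chi_eq_sub_sub [Finite I] [Finite O] (F : Foam A B) (φ : F.Facet) :
    F.chi φ = 2 - 2 * (F.genus φ : ℤ) - orbitCount (outerNext F.arc F.rot) (F.attach ∘ Sum.inl) φ -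
      orbitCount (sideNext F.hol) (F.attach ∘ Sum.inr) φ := by
  rw [F.chi_eq_orbitCount, pieceNext_eq_map, orbitCount_sum]
  push_cast
  ring

theorem Foam.chi_eq_of_orbitCount [Finite I] [Finite O] (F : Foam A B) (φ : F.Facet) {m n : ℕ}
    (hm : orbitCount (outerNext F.arc F.rot) (F.attach ∘ Sum.inl) φ = m)
    (hn : orbitCount (sideNext F.hol) (F.attach ∘ Sum.inr) φ = n) :
    F.chi φ = 2 - 2 * (F.genus φ : ℤ) - m - n := by
  rw [F.chi_eq_sub_sub, hm, hn]

/-- Without vertices there are no seam arcs, and a walk around a facet only passes along vertical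
segments. -/
theorem outerNext_eq_of_flat [A.Flat] [B.Flat] (arc arc' : A.Snk ⊕ B.Src ≃ A.Src ⊕ B.Snk)
    (rot rot' : A.Snk ⊕ B.Src → ZMod 3) : outerNext arc rot = outerNext arc' rot' := by
  funext x
  unfold outerNext
  rcases Sum.map A.edge B.edge.symm x with (⟨v, i⟩ | m | o) | (⟨v, i⟩ | m | o)
  · exact isEmptyElim v
  · rfl
  · rfl
  · exact isEmptyElim v
  · rfl
  · rfl

/-- The edges of a union of circles. -/
def loopEquiv (V : Type) (M : Type) [IsEmpty V] : M ≃ Ends V M Empty where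
  toFun m := .inr (.inl m)
  invFun
    | .inl (v, _) => isEmptyElim v
    | .inr (.inl m) => m
    | .inr (.inr x) => x.elim
  left_inv _ := rfl
  right_inv := by
    rintro (⟨v, _⟩ | m | ⟨⟨⟩⟩)
    · exact isEmptyElim v
    · rfl

theorem adjoin_edge (A : PreWeb I O) (W : PreWeb Empty Empty) (x : A.Tail ⊕ W.Tail) :
    (A.adjoin W).edge (Ends.append x) = Ends.append (Sum.map A.edge W.edge x) := by
  change Ends.append (Sum.map A.edge W.edge (Ends.append.symm (Ends.append x))) = _
  rw [Equiv.symm_apply_apply]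

theorem adjoin_edge_symm (A : PreWeb I O) (W : PreWeb Empty Empty) (x : A.Head ⊕ W.Head) :
    (A.adjoin W).edge.symm (Ends.append x) = Ends.append (Sum.map A.edge.symm W.edge.symm x) := by
  change Ends.append (Sum.map A.edge.symm W.edge.symm (Ends.append.symm (Ends.append x))) = _
  rw [Equiv.symm_apply_apply]

theorem adjoin_edge_mrk (A : PreWeb I O) [W.Loops] (m : W.Mrk) :
    (A.adjoin W).edge (Ends.append (.inr (.inr (.inl m)))) = Ends.append (.inr (.inr (.inl m))) :=
  (adjoin_edge A W _).trans (congrArg (fun x => Ends.append (.inr x)) (PreWeb.Loops.edge_mrk m))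

theorem adjoin_edge_symm_mrk (A : PreWeb I O) [W.Loops] (m : W.Mrk) :
    (A.adjoin W).edge.symm (Ends.append (.inr (.inr (.inl m)))) =
      Ends.append (.inr (.inr (.inl m))) :=
  (Equiv.symm_apply_eq _).2 (adjoin_edge_mrk A m).symm

instance [A.Flat] [W.Loops] : IsEmpty (A.adjoin W).Snk := inferInstanceAs (IsEmpty (A.Snk ⊕ W.Snk))
instance [A.Flat] [W.Loops] : IsEmpty (A.adjoin W).Src := inferInstanceAs (IsEmpty (A.Src ⊕ W.Src))

/-- The facet at a piece of the boundary of a punctured foam. -/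
def Foam.punctureAttach [W.Loops] (F : Foam A B) (p : W.Mrk → F.Facet) :
    Piece (A.adjoin W) B F.Ring → F.Facet
  | .inl (.inl t) => Sum.elim F.bot (fun t => p ((loopEquiv _ _).symm t)) (Ends.append.symm t)
  | .inl (.inr h) => F.top h
  | .inr k => F.attach (.inr k)

/-- The foam with the facets `p` punctured. -/
def Foam.puncture [A.Flat] [B.Flat] [W.Loops] (F : Foam A B) (p : W.Mrk → F.Facet) :
    Foam (A.adjoin W) B where
  arc := Equiv.equivOfIsEmpty _ _
  rot := isEmptyElim
  Ring := F.Ring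
  hol := F.hol
  Facet := F.Facet
  genus := F.genus
  attach := F.punctureAttach p
  attach_next := by
    rintro ((t | h) | k)
    · obtain ⟨x, rfl⟩ := Ends.append.surjective t
      have hx : ∀ x, F.punctureAttach p (.inl (.inl (Ends.append x))) =
          Sum.elim F.bot (fun t => p ((loopEquiv _ _).symm t)) x := fun x => by
        simp only [Foam.punctureAttach, Equiv.symm_apply_apply]
      rw [hx]
      change F.punctureAttach p (.inl (turn _ _ (.inl ((A.adjoin W).edge _)))) = _
      rw [adjoin_edge]
      rcases x with x | x
      · have := F.attach_next (.inl (.inl x))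
        simp only [pieceNext, Sum.map_inl] at this
        refine Eq.trans ?_ this
        simp only [Sum.map_inl]
        rcases A.edge x with ⟨v, i⟩ | m | o
        · exact isEmptyElim v
        · exact isEmptyElim m
        · rfl
      · obtain ⟨m, rfl⟩ := (loopEquiv _ _).surjective x
        simp only [Sum.map_inr]
        change F.punctureAttach p (.inl (turn _ _ (.inl (Ends.append (.inr
          (W.edge (.inr (.inl m)))))))) = _
        rw [PreWeb.Loops.edge_mrk]
        rfl
    · have := F.attach_next (.inl (.inr h))
      refine Eq.trans ?_ this
      simp only [pieceNext, Sum.map_inr]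
      rcases B.edge.symm h with ⟨v, i⟩ | m | o
      · exact isEmptyElim v
      · exact isEmptyElim m
      · rfl
    · exact F.attach_next (.inr k)

/-- An identification of `H` with the foam obtained by gluing `K` into punctures of facets `p` of `F`. -/
structure Filling [W.Loops] (F : Foam A B) (K : Foam emptyWeb W) (p : W.Mrk → F.Facet)
    (H : Foam A B) where
  a : F.Facet → H.Facet
  b : K.Facet → H.Facet
  glue : ∀ m, b (K.top (.inr (.inl m))) = a (p m)
  surj : Function.Surjective (Sum.elim a b)
  ker : ∀ u v, Sum.elim a b u = Sum.elim a b v →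
    Relation.EqvGen (fun u v => ∃ m, u = .inl (p m) ∧ v = .inr (K.top (.inr (.inl m)))) u v
  genus : ∀ φ, (H.genus φ : ℤ) - 1 = (∑ᶠ x : {x // a x = φ}, ((F.genus x.1 : ℤ) - 1)) +
    (∑ᶠ y : {y // b y = φ}, ((K.genus y.1 : ℤ) - 1)) + (Nat.card {m // a (p m) = φ} : ℤ)
  bot : ∀ t, H.bot t = a (F.bot t)
  top : ∀ h, H.top h = a (F.top h)
  ring : F.Ring ⊕ K.Ring ≃ H.Ring
  ring_left : ∀ k, H.hol (ring (.inl k)) = F.hol k ∧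
    ∃ j, ∀ i, H.side (ring (.inl k)) (i + j) = a (F.side k i)
  ring_right : ∀ k, H.hol (ring (.inr k)) = K.hol k ∧
    ∃ j, ∀ i, H.side (ring (.inr k)) (i + j) = b (K.side k i)

/-- Each puncture is a boundary circle by itself, a fixed point of `outerNext`; the other circles
and the genus stay as they are. -/
theorem Foam.chi_puncture [Finite I] [Finite O] [A.Flat] [B.Flat] [W.Loops] (F : Foam A B)
    (p : W.Mrk → F.Facet) (φ : F.Facet) :
    (F.puncture p).chi φ = F.chi φ - Nat.card {m // p m = φ} := by
  refine ((F.puncture p).chi_eq_sub_sub φ).trans ?_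
  rw [F.chi_eq_sub_sub φ]
  -- The outer pieces of the punctured foam are the old ones and one loop for each marked point of
  -- `W`.
  let e : (A.Tail ⊕ B.Head) ⊕ W.Mrk ≃ (A.adjoin W).Tail ⊕ B.Head :=
    (Equiv.sumAssoc _ _ _).trans ((Equiv.sumCongr (Equiv.refl _) (Equiv.sumComm _ _)).trans
      ((Equiv.sumAssoc _ _ _).symm.trans (Equiv.sumCongr
        ((Equiv.sumCongr (Equiv.refl _) (loopEquiv _ _)).trans Ends.append) (Equiv.refl _))))
  have h := orbitCount_congr e (n := Sum.map (outerNext F.arc F.rot) id)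
    (m := outerNext (F.puncture p).arc (F.puncture p).rot)
    (f := Sum.elim (F.attach ∘ Sum.inl) p)
    (g := (F.puncture p).attach ∘ Sum.inl) ?_ ?_ φ
  · rw [orbitCount_sum, Sum.elim_comp_inl, Sum.elim_comp_inr, orbitCount_id] at h
    refine Eq.trans (congrArg (fun n : ℕ => 2 - 2 * (F.genus φ : ℤ) - (n : ℤ) -
      (orbitCount (sideNext F.hol) (F.attach ∘ Sum.inr) φ : ℤ)) h.symm) ?_
    push_cast
    ring
  · rintro ((t | h) | m)
    · change e (.inl (turn _ _ (.inl (A.edge t)))) =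
        turn _ _ (.inl ((A.adjoin W).edge (Ends.append (.inl t))))
      rw [adjoin_edge, Sum.map_inl]
      rcases A.edge t with ⟨v, i⟩ | m | o
      · exact isEmptyElim v
      · exact isEmptyElim m
      · rfl
    · change e (.inl (turn _ _ (.inr (B.edge.symm h)))) = turn _ _ (.inr (B.edge.symm h))
      rcases B.edge.symm h with ⟨v, i⟩ | m | o
      · exact isEmptyElim v
      · exact isEmptyElim m
      · rfl
    · change _ = turn _ _ (.inl ((A.adjoin W).edge (Ends.append (.inr (.inr (.inl m))))))
      rw [adjoin_edge_mrk]
      rfl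
  · rintro ((t | h) | m)
    · change Sum.elim F.bot _ (Ends.append.symm (Ends.append (.inl t))) = _
      rw [Equiv.symm_apply_apply]
      rfl
    · rfl
    · rfl

/-- The facets of the identity of a flat web are its edges. -/
def idFacet [Finite I] (A : PreWeb I O) [A.Flat] : (idFoam A).Facet ≃ A.Tail where
  toFun := Quot.lift id (by rintro _ _ ⟨m, -⟩; exact isEmptyElim m)
  invFun := Quot.mk _
  left_inv := by rintro ⟨t⟩; rfl
  right_inv _ := rfl

/-- The loops at the boundary of `K` are fixed points of `outerNext`, and all other outer circles
bound the strips over the edges of `A`. -/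
theorem orbitCount_idFoam_adjoin [Finite I] [Finite O] [A.Flat] [W.Loops] (K : Foam emptyWeb W)
    (ψ : ((idFoam A).adjoin K).Facet) :
    orbitCount (outerNext ((idFoam A).adjoin K).arc ((idFoam A).adjoin K).rot)
        (((idFoam A).adjoin K).attach ∘ Sum.inl) ψ =
      orbitCount (outerNext (idFoam A).arc (idFoam A).rot)
          (Sum.inl ∘ (idFoam A).attach ∘ Sum.inl) ψ +
        Nat.card {m // Sum.inr (K.top (.inr (.inl m))) = ψ} := by
  let e : (A.Tail ⊕ A.Head) ⊕ W.Mrk ≃ A.Tail ⊕ (A.adjoin W).Head :=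
    (Equiv.sumAssoc _ _ _).trans (Equiv.sumCongr (Equiv.refl _)
        ((Equiv.sumCongr (Equiv.refl _) (loopEquiv _ _)).trans Ends.append))
  have h1 := orbitCount_congr e
    (n := Sum.map (outerNext (idFoam A).arc (idFoam A).rot) id)
    (m := outerNext ((idFoam A).adjoin K).arc ((idFoam A).adjoin K).rot)
    (f := Sum.elim (Sum.inl ∘ (idFoam A).attach ∘ Sum.inl) (fun m => .inr (K.top (.inr (.inl m)))))
    (g := ((idFoam A).adjoin K).attach ∘ Sum.inl) ?_ ?_ ψ
  · exact h1.symm.trans ((orbitCount_sum _ _ _ _).trans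
      (congrArg₂ (· + ·) rfl (orbitCount_id _ _)))
  · rintro ((t | h) | m)
    · change e (.inl (turn _ _ (.inl (A.edge t)))) = turn _ _ (.inl (A.edge t))
      rcases A.edge t with ⟨v, i⟩ | m | o
      · exact isEmptyElim v
      · exact isEmptyElim m
      · rfl
    · change e (.inl (turn _ _ (.inr (A.edge.symm h)))) =
        turn _ _ (.inr ((A.adjoin W).edge.symm (Ends.append (.inl h))))
      rw [adjoin_edge_symm, Sum.map_inl]
      rcases A.edge.symm h with ⟨v, i⟩ | m | o
      · exact isEmptyElim v
      · exact isEmptyElim m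
      · rfl
    · change _ = turn _ _ (.inr ((A.adjoin W).edge.symm (Ends.append (.inr (.inr (.inl m))))))
      rw [adjoin_edge_symm_mrk]
      rfl
  · rintro ((t | h) | m)
    · rfl
    · change Sum.map (idFoam A).top K.top (Ends.append.symm (Ends.append (.inl h))) = _
      rw [Equiv.symm_apply_apply]
      rfl
    · rfl

theorem chi_idFoam_adjoin_inr [Finite I] [Finite O] [A.Flat] [W.Loops] (K : Foam emptyWeb W)
    (y : K.Facet) : ((idFoam A).adjoin K).chi (.inr y) =
      2 - 2 * (K.genus y : ℤ) - Nat.card {m // K.top (.inr (.inl m)) = y} -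
        orbitCount (sideNext K.hol) (K.attach ∘ Sum.inr) y := by
  have h0 : orbitCount (sideNext ((idFoam A).adjoin K).hol)
      (((idFoam A).adjoin K).attach ∘ Sum.inr) (.inr y) =
      orbitCount (sideNext K.hol) (K.attach ∘ Sum.inr) y := by
    rw [← orbitCount_comp_injective _ _ (Sum.inr_injective (α := (idFoam A).Facet))]
    refine (orbitCount_congr (Equiv.prodCongr (Equiv.emptySum Empty K.Ring).symm (Equiv.refl _))
      (fun s => rfl) (fun s => rfl) _).symm
  have h1 := (orbitCount_idFoam_adjoin (A := A) K (.inr y)).trans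
    (congrArg₂ (· + ·) (orbitCount_eq_zero _ _ (fun s h => by cases h)) rfl)
  refine (((idFoam A).adjoin K).chi_eq_of_orbitCount (.inr y) h1 h0).trans ?_
  simp only [zero_add, Sum.inr.injEq]
  rfl

/-- The strip over an edge of `A` is a disc: a single circle runs through its bottom and its top
edge, and no closed seam touches it. -/
theorem chi_idFoam_adjoin_inl [Finite I] [Finite O] [A.Flat] [W.Loops] (K : Foam emptyWeb W)
    (q : (idFoam A).Facet) : ((idFoam A).adjoin K).chi (.inl q) = 1 := by
  classical
  have := Fintype.ofFinite A.Tail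
  have h0 : Nat.card {m // (Sum.inr (K.top (.inr (.inl m))) : (idFoam A).Facet ⊕ K.Facet) =
      .inl q} = 0 := by
    have : IsEmpty {m // (Sum.inr (K.top (.inr (.inl m))) : (idFoam A).Facet ⊕ K.Facet) = .inl q} :=
      ⟨fun ⟨m, h⟩ => by cases h⟩
    exact Nat.card_of_isEmpty
  have h2 : (∑ j : A.Tail, if (Quot.mk _ j : (idFoam A).Facet) = q then 1 else 0) = 1 := by
    have : ∀ j : A.Tail, (Quot.mk _ j : (idFoam A).Facet) = q ↔ j = idFacet A q := fun j =>
      (idFacet A).symm_apply_eq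
    simp only [this, Finset.sum_ite_eq', Finset.mem_univ, if_true]
  have h1 : orbitCount (outerNext (idFoam A).arc (idFoam A).rot)
      ((idFoam A).attach ∘ Sum.inl) q = 1 := by
    refine (orbitCount_eq_card (outerNext (idFoam A).arc (idFoam A).rot)
      ((idFoam A).attach ∘ Sum.inl) (Sum.elim id A.edge.symm) Sum.inl
      (fun s => (idFoam A).attach_outerNext s) ?_ (fun _ => rfl) ?_ q).trans h2
    · rintro (t | h)
      · change Sum.elim id A.edge.symm (turn _ _ (.inl (A.edge t))) = t
        obtain ⟨h, rfl⟩ := A.edge.symm.surjective t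
        rw [Equiv.apply_symm_apply]
        rcases h with ⟨v, i⟩ | m | o
        · exact isEmptyElim v
        · exact isEmptyElim m
        · rfl
      · change Sum.elim id A.edge.symm (turn _ _ (.inr (A.edge.symm h))) = A.edge.symm h
        rcases A.edge.symm h with ⟨v, i⟩ | m | o
        · exact isEmptyElim v
        · exact isEmptyElim m
        · rfl
    · rintro (t | h)
      · exact ⟨0, rfl⟩
      · refine ⟨1, ?_⟩
        change turn _ _ (.inr (A.edge.symm h)) = .inl (A.edge.symm h)
        rcases A.edge.symm h with ⟨v, i⟩ | m | o
        · exact isEmptyElim v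
        · exact isEmptyElim m
        · rfl
  have h3 : orbitCount (sideNext ((idFoam A).adjoin K).hol)
      (((idFoam A).adjoin K).attach ∘ Sum.inr) (.inl q) = orbitCount (sideNext K.hol)
      (Sum.inr ∘ K.attach ∘ Sum.inr) (.inl q : (idFoam A).Facet ⊕ K.Facet) :=
    (orbitCount_congr (Equiv.prodCongr (Equiv.emptySum Empty K.Ring).symm (Equiv.refl _))
      (fun s => rfl) (fun s => rfl) _).symm
  refine (((idFoam A).adjoin K).chi_eq_of_orbitCount (.inl q)
    ((orbitCount_idFoam_adjoin (A := A) K (.inl q)).trans (congrArg₂ (· + ·)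
      ((orbitCount_comp_injective _ _ Sum.inl_injective q).trans h1) h0))
    (h3.trans (orbitCount_eq_zero _ _ (fun s h => by cases h)))).trans ?_
  change 2 - 2 * ((0 : ℕ) : ℤ) - _ - _ = _
  norm_num

end Fill

/-! ### Fillings are compositions with a punctured foam -/

section Fill

variable {I O : Type} {A B : PreWeb I O} {W : PreWeb Empty Empty}

namespace Filling

variable [W.Loops] [Finite I] [Finite O] {F : Foam A B} {K : Foam emptyWeb W}
  {p : W.Mrk → F.Facet} {H : Foam A B} (D : Filling F K p H)

/-- The map from facets to facets of the filled foam. -/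
def facet [A.Flat] : (((idFoam A).Facet ⊕ K.Facet) ⊕ F.Facet) → H.Facet :=
  Sum.elim (Sum.elim (fun q => D.a (F.bot (idFacet A q))) D.b) D.a

-- The closed seams of `H` are those of `F` and of `K`. The numbering of the sheets may differ by a
-- rotation at each seam, which the shifts `j` and `j'` absorb.
omit [Finite I] [Finite O] in
theorem sideNext_count [A.Flat] [B.Flat] [Fintype F.Facet] [Fintype K.Facet] [DecidableEq H.Facet]
    (φ : H.Facet) :
    orbitCount (sideNext H.hol) (H.attach ∘ Sum.inr) φ =
      (∑ x, if D.a x = φ then orbitCount (sideNext F.hol) (F.attach ∘ Sum.inr) x else 0) +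
      ∑ y, if D.b y = φ then orbitCount (sideNext K.hol) (K.attach ∘ Sum.inr) y else 0 := by
  choose j hj using fun k => (D.ring_left k).2
  choose j' hj' using fun k => (D.ring_right k).2
  let e : F.Ring × ZMod 3 ⊕ K.Ring × ZMod 3 ≃ H.Ring × ZMod 3 :=
    (Equiv.sumProdDistrib _ _ _).symm.trans
      ((Equiv.prodShear D.ring fun k => Equiv.addRight (Sum.elim j j' k)))
  rw [← orbitCount_comp _ _ (fun s => F.attach_sideNext s),
    ← orbitCount_comp _ _ (fun s => K.attach_sideNext s)]
  refine (orbitCount_congr e (n := Sum.map (sideNext F.hol) (sideNext K.hol))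
    (f := Sum.elim (D.a ∘ F.attach ∘ Sum.inr) (D.b ∘ K.attach ∘ Sum.inr)) ?_ ?_ φ).symm.trans
    (orbitCount_sum _ _ _ _)
  · rintro (⟨k, i⟩ | ⟨k, i⟩)
    · exact Prod.ext rfl ((add_right_comm _ _ _).trans
        (congrArg (i + j k + ·) (D.ring_left k).1.symm))
    · exact Prod.ext rfl ((add_right_comm _ _ _).trans
        (congrArg (i + j' k + ·) (D.ring_right k).1.symm))
  · rintro (⟨k, i⟩ | ⟨k, i⟩)
    · exact hj k i
    · exact hj' k i

/-- The boundary of `K` disappears in the gluing, so the outer circles of `H` are those of `F`,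
sorted into merged facets by `a`. -/
theorem outerNext_count [A.Flat] [B.Flat] [Fintype F.Facet] [DecidableEq H.Facet] (φ : H.Facet) :
    orbitCount (outerNext H.arc H.rot) (H.attach ∘ Sum.inl) φ =
      ∑ x, if D.a x = φ then orbitCount (outerNext F.arc F.rot) (F.attach ∘ Sum.inl) x else 0 := by
  rw [← orbitCount_comp _ _ (fun s => F.attach_outerNext s), outerNext_eq_of_flat F.arc H.arc F.rot
      H.rot]
  congr 1
  funext s
  rcases s with t | h
  · exact D.bot t
  · exact D.top h

/-- The strips over the edges of `A` contribute 1 each and are glued along one edge each, which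
cancels. At a loop of `W` the edge and its marked point cancel as well. What is left of a puncture
is that it counts as a boundary circle twice, once in `F` and once in `K`, and this loss of 2 is
what the puncture term in the genus formula of `Filling` compensates. The circles of `H` itself are
counted by `outerNext_count` and `sideNext_count`. -/
theorem chi_eq [A.Flat] [B.Flat] (φ : H.Facet) : H.chi φ =
    (∑ᶠ x : {x : ((idFoam A).adjoin K).Facet ⊕ (F.puncture p).Facet // D.facet x = φ},
      Sum.elim ((idFoam A).adjoin K).chi (F.puncture p).chi x.1) -
      (Nat.card {t : (A.adjoin W).Tail // D.facet (.inr ((F.puncture p).bot t)) = φ} : ℤ) +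
      (Nat.card {m : (A.adjoin W).Mrk //
        D.facet (.inr ((F.puncture p).bot (.inr (.inl m)))) = φ} : ℤ) := by
  classical
  have := Fintype.ofFinite A.Tail
  have := Fintype.ofFinite F.Facet
  have := Fintype.ofFinite K.Facet
  have := Fintype.ofFinite W.Mrk
  have := Fintype.ofEquiv _ (idFacet A).symm
  have hg := D.genus φ
  rw [finsum_subtype (fun x => D.a x = φ) (fun x => ((F.genus x : ℤ) - 1)),
    finsum_subtype (fun x => D.b x = φ) (fun x => ((K.genus x : ℤ) - 1))] at hg
  have h1 : (∑ᶠ x : {x : ((idFoam A).adjoin K).Facet ⊕ (F.puncture p).Facet // D.facet x = φ},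
      Sum.elim ((idFoam A).adjoin K).chi (F.puncture p).chi x.1) =
      ((∑ t : A.Tail, if D.a (F.bot t) = φ then 1 else 0) +
      ∑ y : K.Facet, if D.b y = φ then 2 - 2 * (K.genus y : ℤ) -
        Nat.card {m // K.top (.inr (.inl m)) = y} -
          orbitCount (sideNext K.hol) (K.attach ∘ Sum.inr) y else 0) +
      ∑ x : F.Facet, if D.a x = φ then F.chi x - Nat.card {m // p m = x} else 0 := by
    refine (finsum_subtype (α := ((idFoam A).Facet ⊕ K.Facet) ⊕ F.Facet)
      (fun x => D.facet x = φ) _).trans ?_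
    rw [Fintype.sum_sum_type, Fintype.sum_sum_type]
    congr 1
    · congr 1
      · rw [← (idFacet A).symm.sum_comp]
        refine Finset.sum_congr rfl fun t _ => if_congr Iff.rfl ?_ rfl
        exact chi_idFoam_adjoin_inl K _
      · refine Finset.sum_congr rfl fun t _ => if_congr Iff.rfl ?_ rfl
        exact chi_idFoam_adjoin_inr K _
    · refine Finset.sum_congr rfl fun t _ => if_congr Iff.rfl ?_ rfl
      exact F.chi_puncture p t
  have h2 : (Nat.card {t : (A.adjoin W).Tail // D.facet (.inr ((F.puncture p).bot t)) = φ} : ℤ) =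
      (∑ t : A.Tail, if D.a (F.bot t) = φ then 1 else 0) +
        (Nat.card {m // D.a (p m) = φ} : ℤ) := by
    let e : {t : A.Tail // D.a (F.bot t) = φ} ⊕ {m // D.a (p m) = φ} ≃
        {t : (A.adjoin W).Tail // D.facet (.inr ((F.puncture p).bot t)) = φ} :=
      Equiv.subtypeSum.symm.trans (Equiv.subtypeEquiv
        (p := fun x : A.Tail ⊕ W.Mrk => Sum.elim (fun t => D.a (F.bot t) = φ)
          (fun m => D.a (p m) = φ) x)
        ((Equiv.sumCongr (Equiv.refl _) (loopEquiv _ _)).trans Ends.append) ?_)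
    · rw [← Nat.card_congr e, Nat.card_sum]
      push_cast
      rw [card_subtype_eq_sum]
    · rintro (t | m)
      · change _ ↔ D.a (Sum.elim F.bot _ (Ends.append.symm (Ends.append (.inl t)))) = φ
        rw [Equiv.symm_apply_apply]
        rfl
      · rfl
  have h3 : Nat.card {m : (A.adjoin W).Mrk //
        D.facet (.inr ((F.puncture p).bot (.inr (.inl m)))) = φ} =
        Nat.card {m // D.a (p m) = φ} := by
    refine (Nat.card_congr (Equiv.subtypeEquiv (Equiv.emptySum A.Mrk W.Mrk).symm ?_)).symm
    exact fun m => Iff.rfl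
  have h4 : ∀ {α β : Type} [Fintype α] [Fintype β] (q : α → β) (c : β → H.Facet),
      (Nat.card {m // c (q m) = φ} : ℤ) =
        ∑ x, if c x = φ then (Nat.card {m // q m = x} : ℤ) else 0 := by
    intro α β _ _ q c
    have := orbitCount_comp (id : α → α) q (fun _ => rfl) c φ
    rw [orbitCount_id] at this
    simp only [orbitCount_id] at this
    exact_mod_cast this
  -- The punctures at `φ`, counted by the facets of `F` and then by the facets of `K`.
  have h5 := h4 p D.a
  have h6 := h4 (fun m => K.top (.inr (.inl m))) D.b
  simp only [D.glue] at h6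
  rw [h1, h2, h3, H.chi_eq_sub_sub, D.sideNext_count, D.outerNext_count]
  simp only [F.chi_eq_sub_sub]
  push_cast
  have key : ∀ {α : Type} [Fintype α] (q : α → Prop) [DecidablePred q] (f g : α → ℤ),
      (∑ x, if q x then f x - g x else 0) =
        (∑ x, if q x then f x else 0) - ∑ x, if q x then g x else 0 := by
    intro α _ q _ f g
    rw [← Finset.sum_sub_distrib]
    exact Finset.sum_congr rfl fun x _ => by split_ifs <;> simp
  have key2 : ∀ {α : Type} [Fintype α] (q : α → Prop) [DecidablePred q] (f : α → ℤ),
      (∑ x, if q x then 2 * f x else 0) = 2 * ∑ x, if q x then f x else 0 := by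
    intro α _ q _ f
    rw [Finset.mul_sum]
    exact Finset.sum_congr rfl fun x _ => by split_ifs <;> ring
  have key3 : ∀ {α : Type} [Fintype α] (q : α → Prop) [DecidablePred q],
      (∑ x, if q x then (2 : ℤ) else 0) = 2 * ∑ x, if q x then (1 : ℤ) else 0 := by
    intro α _ q _
    exact key2 q fun _ => 1
  simp only [key, key2, key3, ← h5, ← h6] at hg ⊢
  linarith

-- Every strip over an edge of `A` is glued to exactly one facet of `F`. Contracting the strips
-- turns the relation generated by the gluing into the one generated by the punctures, which
-- `Filling` controls.
omit [Finite O] in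
theorem facet_eq_iff [A.Flat] [B.Flat] (x y) : D.facet x = D.facet y ↔
    Relation.EqvGen (FacetGlue ((idFoam A).adjoin K) (F.puncture p)) x y := by
  have hstep : ∀ m, FacetGlue ((idFoam A).adjoin K) (F.puncture p)
      (.inl (.inr (K.top (.inr (.inl m))))) (.inr (p m)) := by
    intro m
    refine ⟨Ends.append (.inr (.inr (.inl m))), ?_, rfl⟩
    rw [adjoin_edge_mrk]
    rfl
  have hid : ∀ q, FacetGlue ((idFoam A).adjoin K) (F.puncture p)
      (.inl (.inl q)) (.inr (F.bot (idFacet A q))) := by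
    intro q
    obtain ⟨t, rfl⟩ := (idFacet A).symm.surjective q
    refine ⟨Ends.append (.inl t), ?_, ?_⟩
    · rw [adjoin_edge]
      change _ = Sum.inl (Sum.map (idFoam A).top K.top
        (Ends.append.symm (Ends.append (.inl (A.edge t)))))
      rw [Equiv.symm_apply_apply]
      change _ = Sum.inl (Sum.inl (Quot.mk _ (A.edge.symm (A.edge t))))
      rw [Equiv.symm_apply_apply]
      rfl
    · change _ = Sum.inr (Sum.elim F.bot _ (Ends.append.symm (Ends.append (.inl t))))
      rw [Equiv.symm_apply_apply]
      rfl
  -- `c` contracts the strips onto the facets of `F`, and `c'` includes what remains.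
  let c : ((idFoam A).adjoin K).Facet ⊕ (F.puncture p).Facet → F.Facet ⊕ K.Facet :=
    Sum.elim (Sum.elim (fun q => .inl (F.bot (idFacet A q))) .inr) .inl
  let c' : F.Facet ⊕ K.Facet → ((idFoam A).adjoin K).Facet ⊕ (F.puncture p).Facet :=
    Sum.elim .inr (fun y => .inl (.inr y))
  have hc : ∀ x, Relation.EqvGen (FacetGlue ((idFoam A).adjoin K) (F.puncture p)) x (c' (c x)) := by
    rintro ((q | y) | x)
    · exact .rel _ _ (hid q)
    · exact .refl _
    · exact .refl _
  have hf : ∀ x, D.facet x = Sum.elim D.a D.b (c x) := by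
    rintro ((q | y) | x) <;> rfl
  constructor
  · intro h
    rw [hf, hf] at h
    refine .trans _ _ _ (hc x) (.trans _ _ _ ?_ (.symm _ _ (hc y)))
    have h' := D.ker _ _ h
    clear h
    generalize c x = u at h'
    generalize c y = v at h'
    induction h' with
    | rel u v h =>
      obtain ⟨m, rfl, rfl⟩ := h
      exact .symm _ _ (.rel _ _ (hstep m))
    | refl u => exact .refl _
    | symm u v _ ih => exact .symm _ _ ih
    | trans u v w _ _ ih ih' => exact .trans _ _ _ ih ih'
  · intro h
    induction h with
    | rel u v h =>
      obtain ⟨t, rfl, rfl⟩ := h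
      obtain ⟨x, rfl⟩ := Ends.append.surjective t
      rw [adjoin_edge]
      rcases x with t | t
      · change D.facet (.inl (Sum.map (idFoam A).top K.top
          (Ends.append.symm (Ends.append (.inl (A.edge t)))))) =
          D.a (Sum.elim F.bot _ (Ends.append.symm (Ends.append (.inl t))))
        rw [Equiv.symm_apply_apply, Equiv.symm_apply_apply]
        change D.a (F.bot (A.edge.symm (A.edge t))) = _
        rw [Equiv.symm_apply_apply]
        rfl
      · obtain ⟨m, rfl⟩ := (loopEquiv _ _).surjective t
        change D.facet (.inl (Sum.map (idFoam A).top K.top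
          (Ends.append.symm (Ends.append (.inr (W.edge (.inr (.inl m)))))))) = D.a (p m)
        rw [PreWeb.Loops.edge_mrk]
        exact D.glue m
    | refl u => rfl
    | symm u v _ ih => exact ih.symm
    | trans u v w _ _ ih ih' => exact ih.trans ih'

omit [Finite I] [Finite O] in
theorem isEmpty_closedSeam {C : PreWeb I O} [A.Flat] [C.Flat] [IsEmpty B.Snk] [IsEmpty B.Src]
    (F : Foam A B) (G : Foam B C) : IsEmpty (ClosedSeam F G) := by
  refine ⟨fun ⟨c, _⟩ => ?_⟩
  obtain ⟨(v | v) | (v | v)⟩ := c <;> exact isEmptyElim v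

/-- Gluing `K` and a punctured foam. -/
noncomputable def gluing [A.Flat] [B.Flat] : Gluing ((idFoam A).adjoin K) (F.puncture p) H where
  facet := D.facet
  facet_surjective φ := by
    obtain ⟨x | y, h⟩ := D.surj φ
    exacts [⟨.inr x, h⟩, ⟨.inl (.inr y), h⟩]
  facet_eq_iff := D.facet_eq_iff
  bot_eq t := D.bot t
  top_eq h := D.top h
  chi_eq := D.chi_eq
  arc_eq s := isEmptyElim s
  ring := haveI := isEmpty_closedSeam ((idFoam A).adjoin K) (F.puncture p)
    (Equiv.sumEmpty _ _).trans ((Equiv.sumComm _ _).trans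
      ((Equiv.sumCongr (Equiv.refl _) (Equiv.emptySum Empty K.Ring)).trans D.ring))
  ring_left := by
    rintro (⟨⟨⟩⟩ | k)
    exact D.ring_right k
  ring_right k := D.ring_left k
  ring_new c := (isEmpty_closedSeam ((idFoam A).adjoin K) (F.puncture p)).elim c

end Filling
end Fill

/-! ### Building foams from facets and closed seams -/

section Builders

variable {I O : Type} {A B C : PreWeb I O}

/-- The disjoint union with a closed surface. -/
def Foam.addFacet (F : Foam A B) (g : ℕ) : Foam A B where
  arc := F.arc
  rot := F.rot
  Ring := F.Ring
  hol := F.hol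
  Facet := Option F.Facet
  genus := fun x => x.elim g F.genus
  attach := fun s => some (F.attach s)
  attach_next := fun s => congrArg some (F.attach_next s)

/-- The pieces of the boundary after adding a closed seam at the facets `p`. -/
def Foam.addRingAttach (F : Foam A B) (p : ZMod 3 → F.Facet) : Piece A B (Option F.Ring) → F.Facet
  | .inl x => F.attach (.inl x)
  | .inr (none, i) => p i
  | .inr (some k, i) => F.side k i

/-- Three facets are punctured and glued along a new closed seam. -/
def Foam.addRing (F : Foam A B) (p : ZMod 3 → F.Facet) : Foam A B where
  arc := F.arc
  rot := F.rot
  Ring := Option F.Ring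
  hol := fun k => k.elim 0 F.hol
  Facet := F.Facet
  genus := F.genus
  attach := F.addRingAttach p
  attach_next := by
    rintro (x | ⟨_ | k, i⟩)
    · exact F.attach_next (.inl x)
    · simp [pieceNext, Foam.addRingAttach]
    · exact F.attach_next (.inr (k, i))

/-- The foam with `n` handles added to a facet. -/
def Foam.addGenus (F : Foam A B) [DecidableEq F.Facet] (x : F.Facet) (n : ℕ) : Foam A B :=
  { F with genus := fun y => F.genus y + if y = x then n else 0 }

instance (F : Foam A B) (g : ℕ) [h : Fintype F.Ring] : Fintype (F.addFacet g).Ring := h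
instance (F : Foam A B) (g : ℕ) [h : DecidableEq F.Ring] : DecidableEq (F.addFacet g).Ring := h
instance (F : Foam A B) [h : DecidableEq F.Facet] (x : F.Facet) (n : ℕ) :
    DecidableEq (F.addGenus x n).Facet := h

/-- The foam without closed seams that consists of discs. -/
def sheets [A.Flat] [B.Flat] (Φ : Type) [Finite Φ] (f : A.Tail ⊕ B.Head → Φ)
    (hf : ∀ x, f (outerNext (Equiv.equivOfIsEmpty _ _) isEmptyElim x) = f x) : Foam A B where
  arc := Equiv.equivOfIsEmpty _ _
  rot := isEmptyElim
  Ring := Empty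
  hol := Empty.elim
  Facet := Φ
  genus := fun _ => 0
  attach
    | .inl x => f x
    | .inr (k, _) => k.elim
  attach_next := by
    rintro (x | ⟨⟨⟩, _⟩)
    exact hf x

/-! ### Verifying gluings -/

/-- The Euler characteristic of a facet of a foam all of whose closed seams are of the form `Y × S¹`,
in terms of representatives `p` of the boundary circles that are not sides of closed seams. -/
def Foam.euler (F : Foam A B) [DecidableEq F.Facet] [Fintype F.Ring] {ι : Type} [Fintype ι]
    (p : ι → A.Tail ⊕ B.Head) (φ : F.Facet) : ℤ :=
  2 - 2 * (F.genus φ : ℤ) - (∑ j, if F.attach (.inl (p j)) = φ then 1 else 0) -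
    ∑ k : F.Ring × ZMod 3, if F.attach (.inr k) = φ then 1 else 0

/-- `p` is a set of representatives for the boundary circles of facets that are not sides of closed
seams. -/
def Foam.OuterCircles (F : Foam A B) {ι : Type} (p : ι → A.Tail ⊕ B.Head)
    (ix : A.Tail ⊕ B.Head → ι) : Prop :=
  (∀ k, F.hol k = 0) ∧ (∀ s, ix (outerNext F.arc F.rot s) = ix s) ∧ (∀ j, ix (p j) = j) ∧
    ∀ s, ∃ k : Fin 4, (outerNext F.arc F.rot)^[k] s = p (ix s)

/-- When the sheets do not rotate along the closed seams, each of the three sides of a seam is a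
circle by itself; the other circles are indexed by `ι`. The right hand side contains only finite
sums and can be computed. -/
theorem Foam.OuterCircles.chi_eq [Finite I] [Finite O] {F : Foam A B} [DecidableEq F.Facet]
    [Fintype F.Ring] {ι : Type} [Fintype ι]
    {p : ι → A.Tail ⊕ B.Head} {ix : A.Tail ⊕ B.Head → ι} (h : F.OuterCircles p ix) (φ : F.Facet) :
    F.chi φ = F.euler p φ := by
  obtain ⟨h0, h1, h2, h3⟩ := h
  have hs : sideNext F.hol = id := by
    funext k
    exact Prod.ext rfl (by simp [sideNext, h0])
  rw [F.chi_eq_sub_sub, orbitCount_eq_card _ _ ix p (fun s => F.attach_outerNext s) h1 h2 h3,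
    hs, orbitCount_id, card_subtype_eq_sum, Foam.euler]
  push_cast
  rfl

/-- Two facets are connected through at most `n` edges along which foams are glued. -/
def Linked (F : Foam A B) (G : Foam B C) : ℕ → F.Facet ⊕ G.Facet → F.Facet ⊕ G.Facet → Prop
  | 0, x, y => x = y
  | n + 1, x, y => x = y ∨ ∃ t : B.Tail,
      (x = .inl (F.top (B.edge t)) ∧ Linked F G n (.inr (G.bot t)) y) ∨
      (x = .inr (G.bot t) ∧ Linked F G n (.inl (F.top (B.edge t))) y)

instance Linked.decidable (F : Foam A B) (G : Foam B C) [DecidableEq F.Facet] [DecidableEq G.Facet]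
    [Fintype B.Tail] (n : ℕ) (x y : F.Facet ⊕ G.Facet) : Decidable (Linked F G n x y) :=
  match n with
  | 0 => inferInstanceAs (Decidable (x = y))
  | n + 1 =>
    haveI := fun x y => Linked.decidable F G n x y
    inferInstanceAs (Decidable (x = y ∨ ∃ t : B.Tail,
      (x = .inl (F.top (B.edge t)) ∧ Linked F G n (.inr (G.bot t)) y) ∨
      (x = .inr (G.bot t) ∧ Linked F G n (.inl (F.top (B.edge t))) y)))

theorem Linked.eqvGen {F : Foam A B} {G : Foam B C} {n : ℕ} {x y : F.Facet ⊕ G.Facet}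
    (h : Linked F G n x y) : Relation.EqvGen (FacetGlue F G) x y := by
  induction n generalizing x with
  | zero => cases h; exact .refl _
  | succ n ih =>
    rcases h with rfl | ⟨t, ⟨rfl, h⟩ | ⟨rfl, h⟩⟩
    · exact .refl _
    · exact .trans _ _ _ (.rel _ _ ⟨t, rfl, rfl⟩) (ih h)
    · exact .trans _ _ _ (.symm _ _ (.rel _ _ ⟨t, rfl, rfl⟩)) (ih h)

/-- A map from the facets of two foams to those of a third is an identification of the facets after
gluing. -/
structure FacetGluing (F : Foam A B) (G : Foam B C) (H : Foam A C)
    (facet : F.Facet ⊕ G.Facet → H.Facet) : Prop where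
  surjective : Function.Surjective facet
  eq_iff : ∀ x y, facet x = facet y ↔ Relation.EqvGen (FacetGlue F G) x y
  bot_eq : ∀ t : A.Tail, H.bot t = facet (.inl (F.bot t))
  top_eq : ∀ h : C.Head, H.top h = facet (.inr (G.top h))
  chi_eq : ∀ φ : H.Facet, H.chi φ =
    (∑ᶠ x : {x : F.Facet ⊕ G.Facet // facet x = φ}, Sum.elim F.chi G.chi x.1) -
      (Nat.card {t : B.Tail // facet (.inr (G.bot t)) = φ} : ℤ) +
      (Nat.card {m : B.Mrk // facet (.inr (G.bot (.inr (.inl m)))) = φ} : ℤ)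

/-- The generated equivalence is replaced by decidable conditions: `facet` agrees on both sides of
each edge of `B`, and every facet is joined by a chain of at most three edges to the chosen facet
`sec` of its class. Euler characteristics are compared through representatives of the boundary
circles. -/
theorem FacetGluing.of_linked [Finite I] [Finite O] {F : Foam A B} {G : Foam B C} {H : Foam A C}
    {facet : F.Facet ⊕ G.Facet → H.Facet}
    [Fintype F.Facet] [Fintype G.Facet] [DecidableEq F.Facet] [DecidableEq G.Facet]
    [DecidableEq H.Facet] [Fintype F.Ring] [Fintype G.Ring] [Fintype H.Ring]
    [Fintype B.Tail] [Fintype B.Mrk]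
    {ιF ιG ιH : Type} [Fintype ιF] [Fintype ιG] [Fintype ιH]
    {pF : ιF → A.Tail ⊕ B.Head} {ixF : A.Tail ⊕ B.Head → ιF} (hF : F.OuterCircles pF ixF)
    {pG : ιG → B.Tail ⊕ C.Head} {ixG : B.Tail ⊕ C.Head → ιG} (hG : G.OuterCircles pG ixG)
    {pH : ιH → A.Tail ⊕ C.Head} {ixH : A.Tail ⊕ C.Head → ιH} (hH : H.OuterCircles pH ixH)
    (sec : H.Facet → F.Facet ⊕ G.Facet) (hsec : ∀ φ, facet (sec φ) = φ)
    (hglue : ∀ t, facet (.inl (F.top (B.edge t))) = facet (.inr (G.bot t)))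
    (hlink : ∀ x, Linked F G 3 x (sec (facet x)))
    (hbot : ∀ t : A.Tail, H.bot t = facet (.inl (F.bot t)))
    (htop : ∀ h : C.Head, H.top h = facet (.inr (G.top h)))
    (hchi : ∀ φ, H.euler pH φ =
      (∑ x, if facet x = φ then Sum.elim (F.euler pF) (G.euler pG) x else 0) -
      (∑ t : B.Tail, if facet (.inr (G.bot t)) = φ then 1 else 0) +
      ∑ m : B.Mrk, if facet (.inr (G.bot (.inr (.inl m)))) = φ then 1 else 0) :
    FacetGluing F G H facet where
  surjective φ := ⟨_, hsec φ⟩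
  eq_iff x y := by
    constructor
    · intro h
      have hy := (hlink y).eqvGen
      rw [← h] at hy
      exact .trans _ _ _ (hlink x).eqvGen (.symm _ _ hy)
    · intro h
      induction h with
      | rel u v h =>
        obtain ⟨t, rfl, rfl⟩ := h
        exact hglue t
      | refl u => rfl
      | symm u v _ ih => exact ih.symm
      | trans u v w _ _ ih ih' => exact ih.trans ih'
  bot_eq := hbot
  top_eq := htop
  chi_eq φ := by
    rw [hH.chi_eq, hchi, finsum_subtype (fun x => facet x = φ), card_subtype_eq_sum,
      card_subtype_eq_sum, funext hF.chi_eq, funext hG.chi_eq]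

/-- The closed seams formed by seam arcs that do not end. -/
def closedSeamEquiv {F : Foam A B} {G : Foam B C} {ι : Type} (nx : Arcs F G → Arcs F G)
    (hnx : ∀ x, arcEnd F G x = .inl (nx x)) (ix : Arcs F G → ι) (p : ι → Arcs F G)
    (hix : ∀ x, ix (nx x) = ix x) (hp : ∀ j, ix (p j) = j)
    (hc : ∀ x, ∃ k : Fin 4, nx^[k] x = p (ix x)) : ClosedSeam F G ≃ ι where
  toFun c := Quot.lift ix (by
    intro x y h
    rw [hnx, Sum.inl.injEq] at h
    rw [← h, hix]) c.1
  invFun j := ⟨Quot.mk _ (p j), fun x _ e h => by rw [hnx] at h; cases h⟩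
  left_inv := by
    rintro ⟨⟨x⟩, hx⟩
    refine Subtype.ext ?_
    obtain ⟨k, hk⟩ := hc x
    change Quot.mk _ (p (ix x)) = _
    rw [← hk]
    exact (quot_iterate _ nx hnx k x).symm
  right_inv := hp

/-- The seam arc that follows a seam arc, if there is one. -/
def nextArc (F : Foam A B) (G : Foam B C) (x : Arcs F G) : Arcs F G :=
  Sum.elim id (fun _ => x) (arcEnd F G x)

/-- `SeamReturn` stops at the first return, while `n + 1` steps may pass `b` earlier. As no arc
rotates the sheets, the total rotation is zero wherever the walk stops. -/
theorem seamReturn_of_iterate {F : Foam A B} {G : Foam B C}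
    (hnx : ∀ x, arcEnd F G x = .inl (nextArc F G x)) (hrot : ∀ x, arcRot F G x = 0) {b : Arcs F G}
    (n : ℕ) (x : Arcs F G) (h : (nextArc F G)^[n + 1] x = b) : SeamReturn F G b x 0 := by
  induction n generalizing x with
  | zero => exact hrot x ▸ SeamReturn.close x ((hnx x).trans (congrArg _ h))
  | succ n ih =>
    by_cases hb : nextArc F G x = b
    · exact hrot x ▸ SeamReturn.close x ((hnx x).trans (congrArg _ hb))
    · have := SeamReturn.step x _ 0 (hnx x) hb (ih _ h)
      rwa [hrot, add_zero] at this

/-- A gluing of foams along which the sheets are not rotated, with flat webs at the ends. -/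
noncomputable def FacetGluing.gluing [A.Flat] [C.Flat] {F : Foam A B} {G : Foam B C} {H : Foam A C}
    {facet : F.Facet ⊕ G.Facet → H.Facet} (h : FacetGluing F G H facet)
    {ι : Type} (ix : Arcs F G → ι) (p : ι → Arcs F G) (ring : (F.Ring ⊕ G.Ring) ⊕ ι → H.Ring)
    (hnx : ∀ x, arcEnd F G x = .inl (nextArc F G x))
    (hrot : ∀ x, arcRot F G x = 0) (hix : ∀ x, ix (nextArc F G x) = ix x) (hp : ∀ j, ix (p j) = j)
    (hc : ∀ x, ∃ k : Fin 4, (nextArc F G)^[k] x = p (ix x))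
    (hret : ∀ j, ∃ k : Fin 4, (nextArc F G)^[k + 1] (p j) = p j)
    (hring : Function.Bijective ring)
    (ring_left : ∀ k, H.hol (ring (.inl (.inl k))) = F.hol k ∧
      ∃ j, ∀ i, H.side (ring (.inl (.inl k))) (i + j) = facet (.inl (F.side k i)))
    (ring_right : ∀ k, H.hol (ring (.inl (.inr k))) = G.hol k ∧
      ∃ j, ∀ i, H.side (ring (.inl (.inr k))) (i + j) = facet (.inr (G.side k i)))
    (ring_new : ∀ c, H.hol (ring (.inr c)) = 0 ∧ ∃ j, ∀ i, H.side (ring (.inr c)) (i + j) =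
        facet (Sum.map (fun s => F.arcFacet s i) (fun s => G.arcFacet s i) (p c))) :
    Gluing F G H where
  facet := facet
  facet_surjective := h.surjective
  facet_eq_iff := h.eq_iff
  bot_eq := h.bot_eq
  top_eq := h.top_eq
  chi_eq := h.chi_eq
  arc_eq s := isEmptyElim s
  ring := (Equiv.sumCongr (Equiv.refl _) (closedSeamEquiv _ hnx ix p hix hp hc)).trans
    (Equiv.ofBijective ring hring)
  ring_left := ring_left
  ring_right := ring_right
  ring_new c := by
    obtain ⟨j, rfl⟩ := (closedSeamEquiv _ hnx ix p hix hp hc).symm.surjective c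
    refine ⟨p j, rfl, ?_⟩
    rw [Equiv.trans_apply, Equiv.sumCongr_apply, Sum.map_inr, Equiv.apply_symm_apply,
      Equiv.ofBijective_apply, (ring_new j).1]
    obtain ⟨k, hk⟩ := hret j
    exact ⟨seamReturn_of_iterate hnx hrot k _ hk, (ring_new j).2⟩

/-- A gluing along a web without vertices. -/
noncomputable def FacetGluing.gluingFlat [B.Flat] {F : Foam A B} {G : Foam B C} {H : Foam A C}
    {facet : F.Facet ⊕ G.Facet → H.Facet} (h : FacetGluing F G H facet)
    (arc_eq : ∀ s, arcEnd F G (Sum.map .inl .inr s) = .inr (H.arc s))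
    (rot_eq : ∀ s, arcRot F G (Sum.map .inl .inr s) = H.rot s)
    (ring : F.Ring ⊕ G.Ring → H.Ring) (hring : Function.Bijective ring)
    (ring_left : ∀ k, H.hol (ring (.inl k)) = F.hol k ∧
      ∃ j, ∀ i, H.side (ring (.inl k)) (i + j) = facet (.inl (F.side k i)))
    (ring_right : ∀ k, H.hol (ring (.inr k)) = G.hol k ∧
      ∃ j, ∀ i, H.side (ring (.inr k)) (i + j) = facet (.inr (G.side k i))) :
    Gluing F G H :=
  have : IsEmpty (ClosedSeam F G) := by
    refine ⟨fun ⟨c, hc⟩ => ?_⟩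
    obtain ⟨x⟩ := c
    obtain ⟨s, rfl⟩ : ∃ s, x = Sum.map .inl .inr s := by
      rcases x with (v | v) | (v | v)
      exacts [⟨.inl v, rfl⟩, isEmptyElim v, isEmptyElim v, ⟨.inr v, rfl⟩]
    exact hc _ rfl _ (arc_eq s)
  { facet := facet
    facet_surjective := h.surjective
    facet_eq_iff := h.eq_iff
    bot_eq := h.bot_eq
    top_eq := h.top_eq
    chi_eq := h.chi_eq
    arc_eq := fun s => rot_eq s ▸ SeamPath.exit _ _ (arc_eq s)
    ring := (Equiv.sumEmpty _ _).trans (Equiv.ofBijective ring hring)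
    ring_left := ring_left
    ring_right := ring_right
    ring_new := fun c => isEmptyElim c }

/-- The function on `ZMod 3` with the given values. -/
def tri {α : Type} (x y z : α) : ZMod 3 → α := fun i => if i = 0 then x else if i = 1 then y else z

/-- An annulus between closed seams at the facets `x` and `y`, which are punctured, and two discs that
close up these seams. -/
def Foam.addAirlock (F : Foam A B) (x y : F.Facet) : Foam A B :=
  ((((F.addFacet 0).addFacet 0).addFacet 0).addRing
    (tri (some (some none)) (some (some (some x))) (some none))).addRing
    (tri (some (some none)) (some (some (some y))) none)

end Builders

/-! ### Composites of the standard foams -/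

instance : emptyWeb.Flat :=
  ⟨inferInstanceAs (IsEmpty Empty), inferInstanceAs (IsEmpty Empty), inferInstanceAs (IsEmpty
      Empty)⟩
instance : strandWeb.Flat :=
  ⟨inferInstanceAs (IsEmpty Empty), inferInstanceAs (IsEmpty Empty), inferInstanceAs (IsEmpty
      Empty)⟩
instance : horizontalWeb.Flat :=
  ⟨inferInstanceAs (IsEmpty Empty), inferInstanceAs (IsEmpty Empty), inferInstanceAs (IsEmpty
      Empty)⟩
instance : verticalWeb.Flat :=
  ⟨inferInstanceAs (IsEmpty Empty), inferInstanceAs (IsEmpty Empty), inferInstanceAs (IsEmpty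
      Empty)⟩

section Instances

instance (g : ℕ) : Fintype (capFoam g).Facet := inferInstanceAs (Fintype Unit)
instance (g : ℕ) : DecidableEq (capFoam g).Facet := inferInstanceAs (DecidableEq Unit)
instance (g : ℕ) : Fintype (capFoam g).Ring := inferInstanceAs (Fintype Empty)
instance (g : ℕ) : Fintype (cupFoam g).Facet := inferInstanceAs (Fintype Unit)
instance (g : ℕ) : DecidableEq (cupFoam g).Facet := inferInstanceAs (DecidableEq Unit)
instance (g : ℕ) : Fintype (cupFoam g).Ring := inferInstanceAs (Fintype Empty)
instance : Fintype capChoke.Facet := inferInstanceAs (Fintype (ZMod 3))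
instance : DecidableEq capChoke.Facet := inferInstanceAs (DecidableEq (ZMod 3))
instance : Fintype capChoke.Ring := inferInstanceAs (Fintype Unit)
instance : Fintype cupChoke.Facet := inferInstanceAs (Fintype (ZMod 3))
instance : DecidableEq cupChoke.Facet := inferInstanceAs (DecidableEq (ZMod 3))
instance : Fintype cupChoke.Ring := inferInstanceAs (Fintype Unit)
instance : Fintype lowerBubble.Facet := inferInstanceAs (Fintype (ZMod 3))
instance : DecidableEq lowerBubble.Facet := inferInstanceAs (DecidableEq (ZMod 3))
instance : Fintype lowerBubble.Ring := inferInstanceAs (Fintype Empty)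
instance : Fintype upperBubble.Facet := inferInstanceAs (Fintype (ZMod 3))
instance : DecidableEq upperBubble.Facet := inferInstanceAs (DecidableEq (ZMod 3))
instance : Fintype upperBubble.Ring := inferInstanceAs (Fintype Empty)
instance : Fintype lowerKiss.Facet := inferInstanceAs (Fintype (Option (ZMod 3)))
instance : DecidableEq lowerKiss.Facet := inferInstanceAs (DecidableEq (Option (ZMod 3)))
instance : Fintype lowerKiss.Ring := inferInstanceAs (Fintype Unit)
instance : Fintype upperKiss.Facet := inferInstanceAs (Fintype (Option (ZMod 3)))
instance : DecidableEq upperKiss.Facet := inferInstanceAs (DecidableEq (Option (ZMod 3)))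
instance : Fintype upperKiss.Ring := inferInstanceAs (Fintype Unit)
instance : Fintype lowerRocketH.Facet := inferInstanceAs (Fintype (Option (Bool × Bool)))
instance : DecidableEq lowerRocketH.Facet := inferInstanceAs (DecidableEq (Option (Bool × Bool)))
instance : Fintype lowerRocketH.Ring := inferInstanceAs (Fintype Empty)
instance : Fintype upperRocketH.Facet := inferInstanceAs (Fintype (Option (Bool × Bool)))
instance : DecidableEq upperRocketH.Facet := inferInstanceAs (DecidableEq (Option (Bool × Bool)))
instance : Fintype upperRocketH.Ring := inferInstanceAs (Fintype Empty)
instance : Fintype lowerRocketV.Facet := inferInstanceAs (Fintype (Option (Bool × Bool)))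
instance : DecidableEq lowerRocketV.Facet := inferInstanceAs (DecidableEq (Option (Bool × Bool)))
instance : Fintype lowerRocketV.Ring := inferInstanceAs (Fintype Empty)
instance : Fintype upperRocketV.Facet := inferInstanceAs (Fintype (Option (Bool × Bool)))
instance : DecidableEq upperRocketV.Facet := inferInstanceAs (DecidableEq (Option (Bool × Bool)))
instance : Fintype upperRocketV.Ring := inferInstanceAs (Fintype Empty)

end Instances

/-- A genus in `Fin 2` turns the claim into a finite check; only discs and handles are needed. -/
theorem capFoam_outerCircles (g : Fin 2) : (capFoam g).OuterCircles
    (fun _ : Unit => .inl (.inr (.inl ()))) (fun _ => ()) := by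
  refine ⟨?_, ?_, ?_, ?_⟩ <;>
  · revert g
    decide +kernel

theorem cupFoam_outerCircles (g : Fin 2) : (cupFoam g).OuterCircles
    (fun _ : Unit => .inr (.inr (.inl ()))) (fun _ => ()) := by
  refine ⟨?_, ?_, ?_, ?_⟩ <;>
  · revert g
    decide +kernel

theorem capChoke_outerCircles : capChoke.OuterCircles
    (fun _ : Unit => .inl (.inr (.inl ()))) (fun _ => ()) := by
  refine ⟨?_, ?_, ?_, ?_⟩ <;> decide +kernel

theorem cupChoke_outerCircles : cupChoke.OuterCircles
    (fun _ : Unit => .inr (.inr (.inl ()))) (fun _ => ()) := by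
  refine ⟨?_, ?_, ?_, ?_⟩ <;> decide +kernel

/-- Each of the three discs meets the source of the bigon in one half-edge, which represents its
boundary circle. -/
theorem lowerBubble_outerCircles : lowerBubble.OuterCircles
    (fun i : ZMod 3 => .inl (.inl ((), i))) (Sum.elim bigonTail fun _ => 0) := by
  refine ⟨?_, ?_, ?_, ?_⟩ <;> decide +kernel

theorem upperBubble_outerCircles : upperBubble.OuterCircles
    (fun i : ZMod 3 => .inr (.inl ((), i))) (Sum.elim (fun _ => 0) bigonHead) := by
  refine ⟨?_, ?_, ?_, ?_⟩ <;> decide +kernel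

theorem lowerKiss_outerCircles : lowerKiss.OuterCircles
    (fun i : ZMod 3 => .inl (.inl ((), i))) (Sum.elim bigonTail fun _ => 0) := by
  refine ⟨?_, ?_, ?_, ?_⟩ <;> decide +kernel

theorem upperKiss_outerCircles : upperKiss.OuterCircles
    (fun i : ZMod 3 => .inr (.inl ((), i))) (Sum.elim (fun _ => 0) bigonHead) := by
  refine ⟨?_, ?_, ?_, ?_⟩ <;> decide +kernel

/-- A half-edge of the square at each facet of a half rocket. -/
def rocketEndH : Option (Bool × Bool) → Bool × ZMod 3
  | none => (false, 1)
  | some (b, c) => (b, if c then 2 else 0)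

/-- A half-edge of the square at each facet of a half rocket. -/
def rocketEndV : Option (Bool × Bool) → Bool × ZMod 3
  | none => (false, 2)
  | some (b, c) => (b, if c then 1 else 0)

theorem lowerRocketH_outerCircles : lowerRocketH.OuterCircles
    (fun x : lowerRocketH.Facet => .inl (.inl (rocketEndH x))) (fun s => lowerRocketH.attach (.inl
        s)) := by
  refine ⟨?_, ?_, ?_, ?_⟩ <;> decide +kernel

theorem upperRocketH_outerCircles : upperRocketH.OuterCircles
    (fun x : upperRocketH.Facet => .inr (.inl (rocketEndH x))) (fun s => upperRocketH.attach (.inl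
        s)) := by
  refine ⟨?_, ?_, ?_, ?_⟩ <;> decide +kernel

theorem lowerRocketV_outerCircles : lowerRocketV.OuterCircles
    (fun x : lowerRocketV.Facet => .inl (.inl (Prod.map not id (rocketEndV x)))) (fun s =>
        lowerRocketV.attach (.inl s)) := by
  refine ⟨?_, ?_, ?_, ?_⟩ <;> decide +kernel

theorem upperRocketV_outerCircles : upperRocketV.OuterCircles
    (fun x : upperRocketV.Facet => .inr (.inl (rocketEndV x))) (fun s => upperRocketV.attach (.inl
        s)) := by
  refine ⟨?_, ?_, ?_, ?_⟩ <;> decide +kernel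

/-! ### Closed foams -/

/-- The empty foam. -/
def voidFoam : Foam emptyWeb emptyWeb := sheets Empty
  (fun s => Empty.elim (by rcases s with (⟨⟨⟩, _⟩ | ⟨⟨⟩⟩ | ⟨⟨⟩⟩) | (⟨⟨⟩, _⟩ | ⟨⟨⟩⟩ | ⟨⟨⟩⟩)))
  (by rintro ((⟨⟨⟩, _⟩ | ⟨⟨⟩⟩ | ⟨⟨⟩⟩) | (⟨⟨⟩, _⟩ | ⟨⟨⟩⟩ | ⟨⟨⟩⟩)))

/-- A closed surface of genus `g`. -/
def surfaceFoam (g : ℕ) : Foam emptyWeb emptyWeb := voidFoam.addFacet g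

/-- Surfaces of genus `g`, `1` and `0` with one boundary circle, glued in this cyclic order. -/
def thetaFoam (g : ℕ) : Foam emptyWeb emptyWeb :=
  (((voidFoam.addFacet 0).addFacet 1).addFacet g).addRing
    (tri none (some none) (some (some none)))

/-- Two handles joined by an airlock. -/
def chokeFoam : Foam emptyWeb emptyWeb :=
  ((voidFoam.addFacet 1).addFacet 1).addAirlock none (some none)

instance : Fintype voidFoam.Facet := inferInstanceAs (Fintype Empty)
instance : DecidableEq voidFoam.Facet := inferInstanceAs (DecidableEq Empty)
instance (g : ℕ) : Fintype (surfaceFoam g).Facet := inferInstanceAs (Fintype (Option Empty))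
instance (g : ℕ) : DecidableEq (surfaceFoam g).Facet := inferInstanceAs (DecidableEq (Option Empty))
instance (g : ℕ) : Fintype (surfaceFoam g).Ring := inferInstanceAs (Fintype Empty)
instance (g : ℕ) : DecidableEq (surfaceFoam g).Ring := inferInstanceAs (DecidableEq Empty)
instance (g : ℕ) : Fintype (thetaFoam g).Facet :=
  inferInstanceAs (Fintype (Option (Option (Option Empty))))
instance (g : ℕ) : DecidableEq (thetaFoam g).Facet :=
  inferInstanceAs (DecidableEq (Option (Option (Option Empty))))
instance (g : ℕ) : Fintype (thetaFoam g).Ring := inferInstanceAs (Fintype (Option Empty))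
instance (g : ℕ) : DecidableEq (thetaFoam g).Ring := inferInstanceAs (DecidableEq (Option Empty))
instance : Fintype chokeFoam.Facet :=
  inferInstanceAs (Fintype (Option (Option (Option (Option (Option Empty))))))
instance : DecidableEq chokeFoam.Facet :=
  inferInstanceAs (DecidableEq (Option (Option (Option (Option (Option Empty))))))
instance : Fintype chokeFoam.Ring := inferInstanceAs (Fintype (Option (Option Empty)))
instance : DecidableEq chokeFoam.Ring := inferInstanceAs (DecidableEq (Option (Option Empty)))

theorem outerCircles_of_empty (F : Foam emptyWeb emptyWeb) (h : ∀ k, F.hol k = 0) :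
    F.OuterCircles (fun j : Empty => j.elim)
      (fun s => by rcases s with (⟨⟨⟩, _⟩ | ⟨⟨⟩⟩ | ⟨⟨⟩⟩) | (⟨⟨⟩, _⟩ | ⟨⟨⟩⟩ | ⟨⟨⟩⟩)) :=
  ⟨h, by rintro ((⟨⟨⟩, _⟩ | ⟨⟨⟩⟩ | ⟨⟨⟩⟩) | (⟨⟨⟩, _⟩ | ⟨⟨⟩⟩ | ⟨⟨⟩⟩)), fun j => j.elim,
    by rintro ((⟨⟨⟩, _⟩ | ⟨⟨⟩⟩ | ⟨⟨⟩⟩) | (⟨⟨⟩, _⟩ | ⟨⟨⟩⟩ | ⟨⟨⟩⟩))⟩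

theorem cupCap_facetGluing (g h : Fin 2) : FacetGluing (cupFoam g) (capFoam h) (surfaceFoam (g + h))
    (Sum.elim (fun _ => none) fun _ => none) := by
  refine .of_linked (cupFoam_outerCircles g) (capFoam_outerCircles h)
    (outerCircles_of_empty _ (fun k => k.elim))
    (fun _ => .inl ()) ?_ ?_ ?_ ?_ ?_ ?_
  all_goals
    revert g h
    decide +kernel

theorem cupCap_gluing (g h : Fin 2) : Nonempty (Gluing (cupFoam g) (capFoam h) (surfaceFoam (g +
    h))) := by
  refine ⟨(cupCap_facetGluing g h).gluing (fun x => (isEmptyElim x : Empty)) Empty.elim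
    (fun x => (by rcases x with (⟨⟨⟩⟩ | ⟨⟨⟩⟩) | ⟨⟨⟩⟩)) ?_ ?_ ?_ ?_ ?_ ?_ ?_ ?_ ?_ ?_⟩
  all_goals
    revert g h
    decide +kernel

/-- The bulk annulus of the choking torus is absorbed by the surface of genus `g`. -/
theorem cupChokeCap_facetGluing (g : Fin 2) : FacetGluing (cupFoam g) capChoke (thetaFoam g)
    (Sum.elim (fun _ => none) (tri none (some none) (some (some none)))) := by
  refine .of_linked (cupFoam_outerCircles g) capChoke_outerCircles
    (outerCircles_of_empty _ (by revert g; decide +kernel))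
    (fun x : Option (Option (Option Empty)) => x.elim (.inl ()) fun x => x.elim (.inr (1 : ZMod 3))
        fun _ => .inr (2 : ZMod 3)) ?_ ?_ ?_ ?_ ?_ ?_
  all_goals
    revert g
    decide +kernel

theorem cupChokeCap_gluing (g : Fin 2) : Nonempty (Gluing (cupFoam g) capChoke (thetaFoam g)) := by
  refine ⟨(cupChokeCap_facetGluing g).gluing (fun x => (isEmptyElim x : Empty)) Empty.elim
    (Sum.elim (fun _ => none) Empty.elim) ?_ ?_ ?_ ?_ ?_ ?_ ?_ ?_ ?_ ?_⟩
  all_goals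
    revert g
    decide +kernel

theorem chokeCupCap_facetGluing (g : Fin 2) : FacetGluing cupChoke (capFoam g) (thetaFoam g)
    (Sum.elim (tri none (some none) (some (some none))) (fun _ => none)) := by
  refine .of_linked cupChoke_outerCircles (capFoam_outerCircles g)
    (outerCircles_of_empty _ (by revert g; decide +kernel))
    (fun x : Option (Option (Option Empty)) => x.elim (.inr ()) fun x => x.elim (.inl (1 : ZMod 3))
        fun _ => .inl (2 : ZMod 3)) ?_ ?_ ?_ ?_ ?_ ?_
  all_goals
    revert g
    decide +kernel

theorem chokeCupCap_gluing (g : Fin 2) : Nonempty (Gluing cupChoke (capFoam g) (thetaFoam g)) := by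
  refine ⟨(chokeCupCap_facetGluing g).gluing (fun x => (isEmptyElim x : Empty)) Empty.elim
    (Sum.elim (fun _ => none) Empty.elim) ?_ ?_ ?_ ?_ ?_ ?_ ?_ ?_ ?_ ?_⟩
  all_goals
    revert g
    decide +kernel

/-- The two bulk annuli join to the middle annulus of an airlock. The handles take the places of its
outer annuli, and the order bulk, handle, disc is the order of the airlock at both seams. -/
theorem chokeChoke_facetGluing : FacetGluing cupChoke capChoke chokeFoam
    (Sum.elim (tri (some (some none)) (some (some (some none))) (some none)) (tri (some (some
        none)) (some (some (some (some none)))) none)) := by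
  refine .of_linked cupChoke_outerCircles capChoke_outerCircles
    (outerCircles_of_empty _ (by decide +kernel))
    (fun x : Option (Option (Option (Option (Option Empty)))) => x.elim (.inr (2 : ZMod 3)) fun x
        => x.elim (.inl (2 : ZMod 3)) fun x => x.elim (.inl (0 : ZMod 3)) fun x => x.elim (.inl (1
        : ZMod 3)) fun _ => .inr (1 : ZMod 3)) ?_ ?_ ?_ ?_ ?_ ?_
  all_goals decide +kernel

theorem chokeChoke_gluing : Nonempty (Gluing cupChoke capChoke chokeFoam) := by
  refine ⟨(chokeChoke_facetGluing).gluing (fun x => (isEmptyElim x : Empty)) Empty.elim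
    (Sum.elim (Sum.elim (fun _ => (some none : Option (Option Empty))) fun _ => none) Empty.elim)
        ?_ ?_ ?_ ?_ ?_ ?_ ?_ ?_ ?_ ?_⟩
  all_goals decide +kernel

/-! ### Foams between circles -/

/-- Two surfaces of genus `g` and `h` with one boundary circle. -/
def discPair (g h : ℕ) : Foam circleWeb circleWeb where
  arc := Equiv.refl (Empty ⊕ Empty)
  rot := fun _ => 0
  Ring := Empty
  hol := Empty.elim
  Facet := Bool
  genus := fun b => bif b then h else g
  attach
    | .inr (k, _) => k.elim
    | .inl (.inl _) => false
    | .inl (.inr _) => true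
  attach_next := by
    rintro (((⟨⟨⟩, _⟩ | _ | ⟨⟨⟩⟩) | (⟨⟨⟩, _⟩ | _ | ⟨⟨⟩⟩)) | ⟨⟨⟩, _⟩) <;> rfl

/-- Two choking tori. -/
def chokePair : Foam circleWeb circleWeb where
  arc := Equiv.refl (Empty ⊕ Empty)
  rot := fun _ => 0
  Ring := Bool
  hol := fun _ => 0
  Facet := Bool × ZMod 3
  genus := fun x => chokeGenus x.2
  attach
    | .inr x => x
    | .inl (.inl _) => (false, 0)
    | .inl (.inr _) => (true, 0)
  attach_next := by
    rintro (((⟨⟨⟩, _⟩ | _ | ⟨⟨⟩⟩) | (⟨⟨⟩, _⟩ | _ | ⟨⟨⟩⟩)) | ⟨b, i⟩)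
    · rfl
    · rfl
    · simp [pieceNext]

instance (g h : ℕ) : Fintype (discPair g h).Facet := inferInstanceAs (Fintype Bool)
instance (g h : ℕ) : DecidableEq (discPair g h).Facet := inferInstanceAs (DecidableEq Bool)
instance (g h : ℕ) : Fintype (discPair g h).Ring := inferInstanceAs (Fintype Empty)
instance (g h : ℕ) : DecidableEq (discPair g h).Ring := inferInstanceAs (DecidableEq Empty)
instance : Fintype chokePair.Facet := inferInstanceAs (Fintype (Bool × ZMod 3))
instance : DecidableEq chokePair.Facet := inferInstanceAs (DecidableEq (Bool × ZMod 3))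
instance : Fintype chokePair.Ring := inferInstanceAs (Fintype Bool)
instance : DecidableEq chokePair.Ring := inferInstanceAs (DecidableEq Bool)

theorem discPair_outerCircles (g h : Fin 2) : (discPair g h).OuterCircles
    (fun b : Bool => bif b then .inr (.inr (.inl ())) else .inl (.inr (.inl ()))) (Sum.elim (fun _
        => false) fun _ => true) := by
  refine ⟨?_, ?_, ?_, ?_⟩ <;>
  · revert g h
    decide +kernel

theorem chokePair_outerCircles : chokePair.OuterCircles
    (fun b : Bool => bif b then .inr (.inr (.inl ())) else .inl (.inr (.inl ()))) (Sum.elim (fun _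
        => false) fun _ => true) := by
  refine ⟨?_, ?_, ?_, ?_⟩ <;> decide +kernel

theorem capCup_facetGluing (g h : Fin 2) : FacetGluing (capFoam g) (cupFoam h) (discPair g h)
    (Sum.elim (fun _ => false) fun _ => true) := by
  refine .of_linked (capFoam_outerCircles g) (cupFoam_outerCircles h)
    (discPair_outerCircles g h)
    (fun b : Bool => bif b then .inr () else .inl ()) ?_ ?_ ?_ ?_ ?_ ?_
  all_goals
    revert g h
    decide +kernel

theorem capCup_gluing (g h : Fin 2) : Nonempty (Gluing (capFoam g) (cupFoam h) (discPair g h)) := by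
  refine ⟨(capCup_facetGluing g h).gluingFlat ?_ ?_
    (Sum.elim id id) ?_ ?_ ?_⟩
  all_goals
    revert g h
    decide +kernel

theorem chokeCapCup_facetGluing : FacetGluing capChoke cupChoke chokePair
    (Sum.elim (fun i => (false, i)) fun i => (true, i)) := by
  refine .of_linked capChoke_outerCircles cupChoke_outerCircles
    chokePair_outerCircles
    (fun x : Bool × ZMod 3 => bif x.1 then .inr x.2 else .inl x.2) ?_ ?_ ?_ ?_ ?_ ?_
  all_goals decide +kernel

theorem chokeCapCup_gluing : Nonempty (Gluing capChoke cupChoke chokePair) := by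
  refine ⟨(chokeCapCup_facetGluing).gluingFlat ?_ ?_
    (Sum.elim (fun _ => false) fun _ => true) ?_ ?_ ?_⟩
  all_goals decide +kernel

/-! ### Foams at a bigon -/

/-- The identity of a strand. -/
def strandSheet : Foam strandWeb strandWeb := sheets Unit (fun _ => ()) fun _ => rfl

/-- A bubble on a strand. -/
def bubbleFoam : Foam strandWeb strandWeb :=
  ((strandSheet.addFacet 0).addFacet 0).addRing (tri (some (some ())) (some none) none)

/-- A bubble on a strand both of whose sheets kiss. -/
def kissFoam : Foam strandWeb strandWeb :=
  ((((strandSheet.addFacet 0).addFacet 0).addFacet 0).addRing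
    (tri (some (some (some ()))) (some (some none)) (some none))).addRing
      (tri none (some (some none)) (some none))

/-- A bubble on a strand both of whose sheets kiss twice. -/
def doubleKissFoam : Foam strandWeb strandWeb :=
  ((((((strandSheet.addFacet 0).addFacet 0).addFacet 0).addFacet 0).addRing
    (tri (some (some (some (some ())))) (some (some (some none))) (some (some none)))).addRing
      (tri (some none) (some (some (some none))) (some (some none)))).addRing
        (tri none (some (some (some none))) (some (some none)))

instance : Fintype strandSheet.Ring := inferInstanceAs (Fintype Empty)
instance : DecidableEq strandSheet.Ring := inferInstanceAs (DecidableEq Empty)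
instance : Fintype bubbleFoam.Facet := inferInstanceAs (Fintype (Option (Option Unit)))
instance : DecidableEq bubbleFoam.Facet := inferInstanceAs (DecidableEq (Option (Option Unit)))
instance : Fintype bubbleFoam.Ring := inferInstanceAs (Fintype (Option Empty))
instance : DecidableEq bubbleFoam.Ring := inferInstanceAs (DecidableEq (Option Empty))
instance : Fintype kissFoam.Facet := inferInstanceAs (Fintype (Option (Option (Option Unit))))
instance : DecidableEq kissFoam.Facet :=
  inferInstanceAs (DecidableEq (Option (Option (Option Unit))))
instance : Fintype kissFoam.Ring := inferInstanceAs (Fintype (Option (Option Empty)))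
instance : DecidableEq kissFoam.Ring := inferInstanceAs (DecidableEq (Option (Option Empty)))
instance : Fintype doubleKissFoam.Facet :=
  inferInstanceAs (Fintype (Option (Option (Option (Option Unit)))))
instance : DecidableEq doubleKissFoam.Facet :=
  inferInstanceAs (DecidableEq (Option (Option (Option (Option Unit)))))
instance : Fintype doubleKissFoam.Ring := inferInstanceAs (Fintype (Option (Option (Option Empty))))
instance : DecidableEq doubleKissFoam.Ring :=
  inferInstanceAs (DecidableEq (Option (Option (Option Empty))))

theorem bubbleFoam_outerCircles : bubbleFoam.OuterCircles
    (fun _ : Unit => .inl (.inr (.inr ()))) (fun _ => ()) := by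
  refine ⟨?_, ?_, ?_, ?_⟩ <;> decide +kernel

theorem kissFoam_outerCircles : kissFoam.OuterCircles
    (fun _ : Unit => .inl (.inr (.inr ()))) (fun _ => ()) := by
  refine ⟨?_, ?_, ?_, ?_⟩ <;> decide +kernel

theorem doubleKissFoam_outerCircles : doubleKissFoam.OuterCircles
    (fun _ : Unit => .inl (.inr (.inr ()))) (fun _ => ()) := by
  refine ⟨?_, ?_, ?_, ?_⟩ <;> decide +kernel

/-- The two seam arcs close up to one seam, at which the sheet of the strand meets two discs. -/
theorem bubble_facetGluing : FacetGluing upperBubble lowerBubble bubbleFoam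
    (Sum.elim (tri (some (some ())) (some none) none) (tri (some (some ())) (some none) none)) := by
  refine .of_linked upperBubble_outerCircles lowerBubble_outerCircles
    bubbleFoam_outerCircles
    (fun x : Option (Option Unit) => .inl (x.elim (2 : ZMod 3) fun x => x.elim (1 : ZMod 3) fun _
        => (0 : ZMod 3))) ?_ ?_ ?_ ?_ ?_ ?_
  all_goals decide +kernel

theorem bubble_gluing : Nonempty (Gluing upperBubble lowerBubble bubbleFoam) := by
  refine ⟨(bubble_facetGluing).gluing (fun _ => ()) (fun _ => .inl (.inr ()))
    (Sum.elim (fun x => none) fun _ => none) ?_ ?_ ?_ ?_ ?_ ?_ ?_ ?_ ?_ ?_⟩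
  all_goals decide +kernel

/-- The kiss turns both discs of the bubble into annuli between two closed seams, and the second
seam bounds the new disc. It makes no difference which half of the bubble carries the kiss. -/
theorem upperKissBubble_facetGluing : FacetGluing upperKiss lowerBubble kissFoam
    (Sum.elim (fun x => Option.elim x none (tri (some (some (some ()))) (some (some none)) (some
        none))) (tri (some (some (some ()))) (some (some none)) (some none))) := by
  refine .of_linked upperKiss_outerCircles lowerBubble_outerCircles
    kissFoam_outerCircles
    (fun x : Option (Option (Option Unit)) => x.elim (.inl none) fun x => .inl (some (x.elim (2 :
        ZMod 3) fun x => x.elim (1 : ZMod 3) fun _ => (0 : ZMod 3)))) ?_ ?_ ?_ ?_ ?_ ?_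
  all_goals decide +kernel

theorem upperKissBubble_gluing : Nonempty (Gluing upperKiss lowerBubble kissFoam) := by
  refine ⟨(upperKissBubble_facetGluing).gluing (fun _ => ()) (fun _ => .inl (.inr ()))
    (Sum.elim (fun _ => none) fun _ => some none) ?_ ?_ ?_ ?_ ?_ ?_ ?_ ?_ ?_ ?_⟩
  all_goals decide +kernel

theorem bubbleLowerKiss_facetGluing : FacetGluing upperBubble lowerKiss kissFoam
    (Sum.elim (tri (some (some (some ()))) (some (some none)) (some none)) (fun x => Option.elim x
        none (tri (some (some (some ()))) (some (some none)) (some none)))) := by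
  refine .of_linked upperBubble_outerCircles lowerKiss_outerCircles
    kissFoam_outerCircles
    (fun x : Option (Option (Option Unit)) => x.elim (.inr none) fun x => .inr (some (x.elim (2 :
        ZMod 3) fun x => x.elim (1 : ZMod 3) fun _ => (0 : ZMod 3)))) ?_ ?_ ?_ ?_ ?_ ?_
  all_goals decide +kernel

theorem bubbleLowerKiss_gluing : Nonempty (Gluing upperBubble lowerKiss kissFoam) := by
  refine ⟨(bubbleLowerKiss_facetGluing).gluing (fun _ => ()) (fun _ => .inl (.inr ()))
    (Sum.elim (fun _ => none) fun _ => some none) ?_ ?_ ?_ ?_ ?_ ?_ ?_ ?_ ?_ ?_⟩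
  all_goals decide +kernel

theorem doubleKiss_facetGluing : FacetGluing upperKiss lowerKiss doubleKissFoam
    (Sum.elim (fun x => Option.elim x (some none) (tri (some (some (some (some ())))) (some (some
        (some none))) (some (some none)))) (fun x => Option.elim x none (tri (some (some (some
        (some ())))) (some (some (some none))) (some (some none))))) := by
  refine .of_linked upperKiss_outerCircles lowerKiss_outerCircles
    doubleKissFoam_outerCircles
    (fun x : Option (Option (Option (Option Unit))) => x.elim (.inr none) fun x => x.elim (.inl
        none) fun x => .inl (some (x.elim (2 : ZMod 3) fun x => x.elim (1 : ZMod 3) fun _ => (0 :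
        ZMod 3)))) ?_ ?_ ?_ ?_ ?_ ?_
  all_goals decide +kernel

theorem doubleKiss_gluing : Nonempty (Gluing upperKiss lowerKiss doubleKissFoam) := by
  refine ⟨(doubleKiss_facetGluing).gluing (fun _ => ()) (fun _ => .inl (.inr ()))
    (Sum.elim (Sum.elim (fun _ => some none) (fun _ => none)) fun _ => some (some none)) ?_ ?_ ?_
        ?_ ?_ ?_ ?_ ?_ ?_ ?_⟩
  all_goals decide +kernel

/-- The facets of two half bubbles with a common strand. -/
def doubleBubbleOuter : bigonWeb.Tail ⊕ bigonWeb.Head → Fin 6 :=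
  Sum.elim (fun t => tri 0 1 2 (bigonTail t)) (fun h => tri 0 3 4 (bigonHead h))

theorem doubleBubbleOuter_next (x : bigonWeb.Tail ⊕ bigonWeb.Head) :
    doubleBubbleOuter (outerNext (Equiv.refl (Unit ⊕ Unit)) (fun _ => 0) x) =
      doubleBubbleOuter x := by
  revert x
  decide +kernel

/-- Two half bubbles with a common strand and a closed seam with sheets `s`. -/
def doubleBubble (s : ZMod 3 → Fin 6) : Foam bigonWeb bigonWeb where
  arc := Equiv.refl (Unit ⊕ Unit)
  rot := fun _ => 0
  Ring := Unit
  hol := fun _ => 0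
  Facet := Fin 6
  genus := fun _ => 0
  attach := Sum.elim doubleBubbleOuter fun k => s k.2
  attach_next := by
    rintro (x | ⟨⟨⟩, i⟩)
    · exact doubleBubbleOuter_next x
    · simp [pieceNext]

/-- The facets of the half rockets between two squares, between a rocket at the source (`b = false`)
or the target (`b = true`) and the strands. -/
def doubleRocketFacet (b : Bool) : Option (Bool × Bool) → Bool ⊕ Bool × Option Bool
  | none => .inr (b, none)
  | some (c, true) => .inr (b, some c)
  | some (c, false) => .inl c

/-- Two half rockets with two common horizontal strands. -/
def doubleRocketH : Foam squareWeb squareWeb where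
  arc := Equiv.refl (Bool ⊕ Bool)
  rot := fun _ => 0
  Ring := Empty
  hol := Empty.elim
  Facet := Bool ⊕ Bool × Option Bool
  genus := fun _ => 0
  attach
    | .inl (.inl t) => doubleRocketFacet false (lowerRocketH.bot t)
    | .inl (.inr h) => doubleRocketFacet true (upperRocketH.top h)
    | .inr (k, _) => k.elim
  attach_next := by
    rintro (((⟨b, i⟩ | ⟨⟨⟩⟩ | b) | (⟨b, i⟩ | ⟨⟨⟩⟩ | b)) | ⟨⟨⟩, _⟩) <;>
      cases b <;> first | rfl | (revert i; decide +kernel)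

/-- Two half rockets with two common vertical strands. -/
def doubleRocketV : Foam squareWeb squareWeb where
  arc := Equiv.sumCongr Equiv.boolNot Equiv.boolNot
  rot := fun _ => 0
  Ring := Empty
  hol := Empty.elim
  Facet := Bool ⊕ Bool × Option Bool
  genus := fun _ => 0
  attach
    | .inl (.inl t) => doubleRocketFacet false (lowerRocketV.bot t)
    | .inl (.inr h) => doubleRocketFacet true (upperRocketV.top h)
    | .inr (k, _) => k.elim
  attach_next := by
    rintro (((⟨b, i⟩ | ⟨⟨⟩⟩ | b) | (⟨b, i⟩ | ⟨⟨⟩⟩ | b)) | ⟨⟨⟩, _⟩) <;>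
      cases b <;> first | rfl | (revert i; decide +kernel)

instance (s : ZMod 3 → Fin 6) : Fintype (doubleBubble s).Facet := inferInstanceAs (Fintype (Fin 6))
instance (s : ZMod 3 → Fin 6) : DecidableEq (doubleBubble s).Facet :=
  inferInstanceAs (DecidableEq (Fin 6))
instance (s : ZMod 3 → Fin 6) : Fintype (doubleBubble s).Ring := inferInstanceAs (Fintype Unit)
instance (s : ZMod 3 → Fin 6) : DecidableEq (doubleBubble s).Ring :=
  inferInstanceAs (DecidableEq Unit)
instance : Fintype doubleRocketH.Facet := inferInstanceAs (Fintype (Bool ⊕ Bool × Option Bool))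
instance : DecidableEq doubleRocketH.Facet :=
  inferInstanceAs (DecidableEq (Bool ⊕ Bool × Option Bool))
instance : Fintype doubleRocketH.Ring := inferInstanceAs (Fintype Empty)
instance : DecidableEq doubleRocketH.Ring := inferInstanceAs (DecidableEq Empty)
instance : Fintype doubleRocketV.Facet := inferInstanceAs (Fintype (Bool ⊕ Bool × Option Bool))
instance : DecidableEq doubleRocketV.Facet :=
  inferInstanceAs (DecidableEq (Bool ⊕ Bool × Option Bool))
instance : Fintype doubleRocketV.Ring := inferInstanceAs (Fintype Empty)
instance : DecidableEq doubleRocketV.Ring := inferInstanceAs (DecidableEq Empty)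

theorem lowerKissUpperBubble_outerCircles : (doubleBubble (tri 5 1 2)).OuterCircles
    (fun j : Fin 5 => ![.inl (.inl ((), 0)), .inl (.inl ((), 1)), .inl (.inl ((), 2)), .inr (.inl
        ((), 1)), .inr (.inl ((), 2))] j) (Sum.elim (fun t => tri 0 1 2 (bigonTail t)) fun h => tri
        0 3 4 (bigonHead h)) := by
  refine ⟨?_, ?_, ?_, ?_⟩ <;> decide +kernel

theorem lowerBubbleUpperKiss_outerCircles : (doubleBubble (tri 5 3 4)).OuterCircles
    (fun j : Fin 5 => ![.inl (.inl ((), 0)), .inl (.inl ((), 1)), .inl (.inl ((), 2)), .inr (.inl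
        ((), 1)), .inr (.inl ((), 2))] j) (Sum.elim (fun t => tri 0 1 2 (bigonTail t)) fun h => tri
        0 3 4 (bigonHead h)) := by
  refine ⟨?_, ?_, ?_, ?_⟩ <;> decide +kernel

theorem lowerKissUpperBubble_facetGluing : FacetGluing lowerKiss upperBubble (doubleBubble (tri 5 1
    2))
    (Sum.elim (fun x => Option.elim x (5 : Fin 6) (tri (α := Fin 6) 0 1 2)) (tri (α := Fin 6) 0 3
        4)) := by
  refine .of_linked lowerKiss_outerCircles upperBubble_outerCircles
    lowerKissUpperBubble_outerCircles
    (fun x : Fin 6 => ![.inl (some (0 : ZMod 3)), .inl (some (1 : ZMod 3)), .inl (some (2 : ZMod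
        3)), .inr (1 : ZMod 3), .inr (2 : ZMod 3), .inl none] x) ?_ ?_ ?_ ?_ ?_ ?_
  all_goals decide +kernel

theorem lowerKissUpperBubble_gluing : Nonempty (Gluing lowerKiss upperBubble (doubleBubble (tri 5 1
    2))) := by
  refine ⟨(lowerKissUpperBubble_facetGluing).gluingFlat ?_ ?_
    (Sum.elim (fun _ => ()) Empty.elim) ?_ ?_ ?_⟩
  all_goals decide +kernel

theorem lowerBubbleUpperKiss_facetGluing : FacetGluing lowerBubble upperKiss (doubleBubble (tri 5 3
    4))
    (Sum.elim (tri (α := Fin 6) 0 1 2) (fun x => Option.elim x (5 : Fin 6) (tri (α := Fin 6) 0 3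
        4))) := by
  refine .of_linked lowerBubble_outerCircles upperKiss_outerCircles
    lowerBubbleUpperKiss_outerCircles
    (fun x : Fin 6 => ![.inl (0 : ZMod 3), .inl (1 : ZMod 3), .inl (2 : ZMod 3), .inr (some (1 :
        ZMod 3)), .inr (some (2 : ZMod 3)), .inr none] x) ?_ ?_ ?_ ?_ ?_ ?_
  all_goals decide +kernel

theorem lowerBubbleUpperKiss_gluing : Nonempty (Gluing lowerBubble upperKiss (doubleBubble (tri 5 3
    4))) := by
  refine ⟨(lowerBubbleUpperKiss_facetGluing).gluingFlat ?_ ?_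
    (Sum.elim Empty.elim fun _ => ()) ?_ ?_ ?_⟩
  all_goals decide +kernel

theorem doubleRocketH_outerCircles : doubleRocketH.OuterCircles
    (fun x : doubleRocketH.Facet => Sum.elim (fun b => .inl (.inl (rocketEndH (some (b, false)))))
      (fun y => bif y.1 then .inr (.inl (rocketEndH (y.2.map (·, true)))) else .inl (.inl
          (rocketEndH (y.2.map (·, true))))) x) (fun s => doubleRocketH.attach (.inl s)) := by
  refine ⟨?_, ?_, ?_, ?_⟩ <;> decide +kernel

theorem doubleRocketH_facetGluing : FacetGluing lowerRocketH upperRocketH doubleRocketH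
    (Sum.elim (doubleRocketFacet false) (doubleRocketFacet true)) := by
  refine .of_linked lowerRocketH_outerCircles upperRocketH_outerCircles
    doubleRocketH_outerCircles
    (fun x : Bool ⊕ Bool × Option Bool => Sum.elim (fun b => .inl (some (b, false))) (fun y => bif
        y.1 then .inr (y.2.map (·, true)) else .inl (y.2.map (·, true))) x) ?_ ?_ ?_ ?_ ?_ ?_
  all_goals decide +kernel

theorem doubleRocketH_gluing : Nonempty (Gluing lowerRocketH upperRocketH doubleRocketH) := by
  refine ⟨(doubleRocketH_facetGluing).gluingFlat ?_ ?_
    (Sum.elim Empty.elim Empty.elim) ?_ ?_ ?_⟩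
  all_goals decide +kernel

theorem doubleRocketV_outerCircles : doubleRocketV.OuterCircles
    (fun x : doubleRocketV.Facet => Sum.elim (fun b => .inl (.inl (Prod.map not id (rocketEndV
        (some (b, false))))))
      (fun y => bif y.1 then .inr (.inl (rocketEndV (y.2.map (·, true)))) else .inl (.inl (Prod.map
          not id (rocketEndV (y.2.map (·, true)))))) x) (fun s => doubleRocketV.attach (.inl s)) :=
          by
  refine ⟨?_, ?_, ?_, ?_⟩ <;> decide +kernel

theorem doubleRocketV_facetGluing : FacetGluing lowerRocketV upperRocketV doubleRocketV
    (Sum.elim (doubleRocketFacet false) (doubleRocketFacet true)) := by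
  refine .of_linked lowerRocketV_outerCircles upperRocketV_outerCircles
    doubleRocketV_outerCircles
    (fun x : Bool ⊕ Bool × Option Bool => Sum.elim (fun b => .inl (some (b, false))) (fun y => bif
        y.1 then .inr (y.2.map (·, true)) else .inl (y.2.map (·, true))) x) ?_ ?_ ?_ ?_ ?_ ?_
  all_goals decide +kernel

theorem doubleRocketV_gluing : Nonempty (Gluing lowerRocketV upperRocketV doubleRocketV) := by
  refine ⟨(doubleRocketV_facetGluing).gluingFlat ?_ ?_
    (Sum.elim Empty.elim Empty.elim) ?_ ?_ ?_⟩
  all_goals decide +kernel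

/-! ### Foams between pairs of strands -/

/-- The label of a boundary point. -/
def rimLabel : Ends Empty Empty Bool → Bool
  | .inr (.inr b) => b
  | .inr (.inl m) => m.elim
  | .inl (v, _) => v.elim

/-- The identity of two horizontal strands. -/
def sheetsH : Foam horizontalWeb horizontalWeb :=
  sheets Bool (Sum.elim rimLabel rimLabel) (by decide +kernel)

/-- The identity of two vertical strands. -/
def sheetsV : Foam verticalWeb verticalWeb :=
  sheets Bool (Sum.elim rimLabel fun h => !rimLabel h) (by decide +kernel)

/-- The saddle from horizontal to vertical strands. -/
def saddleHV : Foam horizontalWeb verticalWeb := sheets Unit (fun _ => ()) fun _ => rfl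

/-- The saddle from vertical to horizontal strands. -/
def saddleVH : Foam verticalWeb horizontalWeb := sheets Unit (fun _ => ()) fun _ => rfl

/-- Two horizontal sheets joined by an airlock, with the seams in reversed order. -/
def rocketFoamH : Foam horizontalWeb horizontalWeb :=
  ((((sheetsH.addFacet 0).addFacet 0).addFacet 0).addRing
    (tri (some (some (some false))) (some (some none)) (some none))).addRing
    (tri (some (some (some true))) (some (some none)) none)

/-- Two vertical sheets joined by an airlock. -/
def rocketFoamV : Foam verticalWeb verticalWeb := sheetsV.addAirlock false true

/-- A saddle with two discs glued in along a closed seam. -/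
def rocketFoamHV : Foam horizontalWeb verticalWeb :=
  ((saddleHV.addFacet 0).addFacet 0).addRing (tri (some (some ())) (some none) none)

/-- A saddle with two discs glued in along a closed seam. -/
def rocketFoamVH : Foam verticalWeb horizontalWeb :=
  ((saddleVH.addFacet 0).addFacet 0).addRing (tri (some (some ())) (some none) none)

instance : Fintype rocketFoamH.Facet := inferInstanceAs (Fintype (Option (Option (Option Bool))))
instance : DecidableEq rocketFoamH.Facet :=
  inferInstanceAs (DecidableEq (Option (Option (Option Bool))))
instance : Fintype rocketFoamH.Ring := inferInstanceAs (Fintype (Option (Option Empty)))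
instance : DecidableEq rocketFoamH.Ring := inferInstanceAs (DecidableEq (Option (Option Empty)))
instance : Fintype rocketFoamV.Facet := inferInstanceAs (Fintype (Option (Option (Option Bool))))
instance : DecidableEq rocketFoamV.Facet :=
  inferInstanceAs (DecidableEq (Option (Option (Option Bool))))
instance : Fintype rocketFoamV.Ring := inferInstanceAs (Fintype (Option (Option Empty)))
instance : DecidableEq rocketFoamV.Ring := inferInstanceAs (DecidableEq (Option (Option Empty)))
instance : Fintype rocketFoamHV.Facet := inferInstanceAs (Fintype (Option (Option Unit)))
instance : DecidableEq rocketFoamHV.Facet := inferInstanceAs (DecidableEq (Option (Option Unit)))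
instance : Fintype rocketFoamHV.Ring := inferInstanceAs (Fintype (Option Empty))
instance : DecidableEq rocketFoamHV.Ring := inferInstanceAs (DecidableEq (Option Empty))
instance : Fintype rocketFoamVH.Facet := inferInstanceAs (Fintype (Option (Option Unit)))
instance : DecidableEq rocketFoamVH.Facet := inferInstanceAs (DecidableEq (Option (Option Unit)))
instance : Fintype rocketFoamVH.Ring := inferInstanceAs (Fintype (Option Empty))
instance : DecidableEq rocketFoamVH.Ring := inferInstanceAs (DecidableEq (Option Empty))

theorem rocketFoamH_outerCircles : rocketFoamH.OuterCircles
    (fun b : Bool => .inl (.inr (.inr b))) (Sum.elim rimLabel rimLabel) := by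
  refine ⟨?_, ?_, ?_, ?_⟩ <;> decide +kernel

theorem rocketFoamV_outerCircles : rocketFoamV.OuterCircles
    (fun b : Bool => .inl (.inr (.inr b))) (Sum.elim rimLabel fun h => !rimLabel h) := by
  refine ⟨?_, ?_, ?_, ?_⟩ <;> decide +kernel

theorem rocketFoamHV_outerCircles : rocketFoamHV.OuterCircles
    (fun _ : Unit => .inl (.inr (.inr false))) (fun _ => ()) := by
  refine ⟨?_, ?_, ?_, ?_⟩ <;> decide +kernel

theorem rocketFoamVH_outerCircles : rocketFoamVH.OuterCircles
    (fun _ : Unit => .inl (.inr (.inr false))) (fun _ => ()) := by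
  refine ⟨?_, ?_, ?_, ?_⟩ <;> decide +kernel

/-- The two tunnels are glued along the vertical sides to an annulus, and the discs at the
horizontal sides are glued in pairs. The order strand, tunnel, disc at both seams is opposite to
that of an airlock with the tunnel as middle annulus. -/
theorem rocketH_facetGluing : FacetGluing upperRocketH lowerRocketH rocketFoamH
    (Sum.elim (fun x => Option.elim x (some (some none)) fun x => bif x.2 then (bif x.1 then none
        else some none) else some (some (some x.1)))
      (fun x => Option.elim x (some (some none)) fun x => bif x.2 then (bif x.1 then none else some
          none) else some (some (some x.1)))) := by
  refine .of_linked upperRocketH_outerCircles lowerRocketH_outerCircles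
    rocketFoamH_outerCircles
    (fun x : Option (Option (Option Bool)) => .inl (x.elim (some (true, true)) fun x => x.elim
        (some (false, true)) fun x => x.map (·, false))) ?_ ?_ ?_ ?_ ?_ ?_
  all_goals decide +kernel

theorem rocketH_gluing : Nonempty (Gluing upperRocketH lowerRocketH rocketFoamH) := by
  refine ⟨(rocketH_facetGluing).gluing (Sum.elim (Sum.elim Empty.elim id) (Sum.elim id Empty.elim))
      (fun b => .inl (.inr b))
    (Sum.elim (Sum.elim Empty.elim Empty.elim) fun b => bif b then none else some none) ?_ ?_ ?_ ?_
        ?_ ?_ ?_ ?_ ?_ ?_⟩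
  all_goals decide +kernel

/-- Here the order at both seams is strand, disc, tunnel, which is that of an airlock. -/
theorem rocketV_facetGluing : FacetGluing upperRocketV lowerRocketV rocketFoamV
    (Sum.elim (fun x => Option.elim x (some (some none)) fun x => bif x.2 then (bif x.1 then none
        else some none) else some (some (some x.1)))
      (fun x => Option.elim x (some (some none)) fun x => bif x.2 then (bif x.1 then none else some
          none) else some (some (some x.1)))) := by
  refine .of_linked upperRocketV_outerCircles lowerRocketV_outerCircles
    rocketFoamV_outerCircles
    (fun x : Option (Option (Option Bool)) => .inl (x.elim (some (true, true)) fun x => x.elim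
        (some (false, true)) fun x => x.map (·, false))) ?_ ?_ ?_ ?_ ?_ ?_
  all_goals decide +kernel

theorem rocketV_gluing : Nonempty (Gluing upperRocketV lowerRocketV rocketFoamV) := by
  -- The facets are labelled by sinks, whereas the arcs of the upper half begin at sources, and an
  -- arc joins a source to the sink with the other label; hence `not`.
  refine ⟨(rocketV_facetGluing).gluing (Sum.elim (Sum.elim Empty.elim not) (Sum.elim id
      Empty.elim)) (fun b => .inl (.inr (!b)))
    (Sum.elim (Sum.elim Empty.elim Empty.elim) fun b => bif b then none else some none) ?_ ?_ ?_ ?_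
        ?_ ?_ ?_ ?_ ?_ ?_⟩
  all_goals decide +kernel

/-- The tunnel of each half rocket is glued to the two discs of the other half rocket, which gives a
disc. The sheets of the strands form a saddle, and the four seam arcs form a single closed seam. -/
theorem rocketHV_facetGluing : FacetGluing upperRocketH lowerRocketV rocketFoamHV
    (Sum.elim (fun x => Option.elim x (some none) fun x => bif x.2 then none else some (some ()))
      (fun x => Option.elim x none fun x => bif x.2 then some none else some (some ()))) := by
  refine .of_linked upperRocketH_outerCircles lowerRocketV_outerCircles
    rocketFoamHV_outerCircles
    (fun x : Option (Option Unit) => .inl (x.elim (some (false, true)) fun x => x.elim (none) fun _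
        => some (false, false))) ?_ ?_ ?_ ?_ ?_ ?_
  all_goals decide +kernel

theorem rocketHV_gluing : Nonempty (Gluing upperRocketH lowerRocketV rocketFoamHV) := by
  refine ⟨(rocketHV_facetGluing).gluing (fun _ => ()) (fun _ => .inl (.inr false))
    (Sum.elim (Sum.elim Empty.elim Empty.elim) fun _ => none) ?_ ?_ ?_ ?_ ?_ ?_ ?_ ?_ ?_ ?_⟩
  all_goals decide +kernel

theorem rocketVH_facetGluing : FacetGluing upperRocketV lowerRocketH rocketFoamVH
    (Sum.elim (fun x => Option.elim x none fun x => bif x.2 then some none else some (some ()))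
      (fun x => Option.elim x (some none) fun x => bif x.2 then none else some (some ()))) := by
  refine .of_linked upperRocketV_outerCircles lowerRocketH_outerCircles
    rocketFoamVH_outerCircles
    (fun x : Option (Option Unit) => .inl (x.elim (none) fun x => x.elim (some (false, true)) fun _
        => some (false, false))) ?_ ?_ ?_ ?_ ?_ ?_
  all_goals decide +kernel

theorem rocketVH_gluing : Nonempty (Gluing upperRocketV lowerRocketH rocketFoamVH) := by
  refine ⟨(rocketVH_facetGluing).gluing (fun _ => ()) (fun _ => .inl (.inr false))
    (Sum.elim (Sum.elim Empty.elim Empty.elim) fun _ => none) ?_ ?_ ?_ ?_ ?_ ?_ ?_ ?_ ?_ ?_⟩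
  all_goals decide +kernel

/-! ### Relations between foams with flat ends -/

section Fill

variable {I O : Type} {A B : PreWeb I O} {W : PreWeb Empty Empty} [W.Loops]
  {F : Foam A B} {K : Foam emptyWeb W} {p : W.Mrk → F.Facet} {H : Foam A B}

/-- Filling punctures by a foam that has at most one boundary circle at each facet. -/
noncomputable def Filling.ofInjective [DecidableEq F.Facet] [Fintype W.Mrk]
    (a : F.Facet → H.Facet) (b : K.Facet → H.Facet)
    (glue : ∀ m, b (K.top (.inr (.inl m))) = a (p m))
    (ht : ∀ m m', K.top (.inr (.inl m)) = K.top (.inr (.inl m')) → m = m')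
    (ha : Function.Injective a)
    (hb : ∀ y y', (∀ m, K.top (.inr (.inl m)) ≠ y) → b y = b y' → y = y')
    (hab : ∀ x y, (∀ m, K.top (.inr (.inl m)) ≠ y) → a x ≠ b y)
    (surj : Function.Surjective (Sum.elim a b))
    (genus_new : ∀ y, (∀ m, K.top (.inr (.inl m)) ≠ y) → H.genus (b y) = K.genus y)
    (genus_old : ∀ x, H.genus (a x) =
      F.genus x + ∑ m, if p m = x then K.genus (K.top (.inr (.inl m))) else 0)
    (bot : ∀ t, H.bot t = a (F.bot t)) (top : ∀ h, H.top h = a (F.top h))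
    (ring : F.Ring ⊕ K.Ring ≃ H.Ring)
    (ring_left : ∀ k, H.hol (ring (.inl k)) = F.hol k ∧
      ∃ j, ∀ i, H.side (ring (.inl k)) (i + j) = a (F.side k i))
    (ring_right : ∀ k, H.hol (ring (.inr k)) = K.hol k ∧
      ∃ j, ∀ i, H.side (ring (.inr k)) (i + j) = b (K.side k i)) : Filling F K p H where
  a := a
  b := b
  glue := glue
  surj := surj
  ker := by
    -- By `hab` such a facet of `K` lies at a puncture, and injectivity of `a` shows that this
    -- puncture is in `x`.
    have hm : ∀ x y, a x = b y → Relation.EqvGen (fun u v : F.Facet ⊕ K.Facet =>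
        ∃ m, u = .inl (p m) ∧ v = .inr (K.top (.inr (.inl m)))) (.inl x) (.inr y) := by
      intro x y h
      by_cases hy : ∀ m, K.top (.inr (.inl m)) ≠ y
      · exact absurd h (hab x y hy)
      · push Not at hy
        obtain ⟨m, rfl⟩ := hy
        rw [glue] at h
        exact .rel _ _ ⟨m, congrArg _ (ha h), rfl⟩
    rintro (x | y) (x' | y') h
    · rw [ha h]
      exact .refl _
    · exact hm _ _ h
    · exact .symm _ _ (hm _ _ h.symm)
    · by_cases hy : ∀ m, K.top (.inr (.inl m)) ≠ y
      · rw [hb y y' hy h]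
        exact .refl _
      · push Not at hy
        obtain ⟨m, rfl⟩ := hy
        have h' : a (p m) = b y' := (glue m).symm.trans h
        exact .trans _ _ _ (.symm _ _ (.rel _ _ ⟨m, rfl, rfl⟩)) (hm _ _ h')
  genus φ := by
    classical
    have := Fintype.ofFinite F.Facet
    have := Fintype.ofFinite K.Facet
    rw [finsum_subtype (fun x => a x = φ) (fun x => ((F.genus x : ℤ) - 1)),
      finsum_subtype (fun x => b x = φ) (fun x => ((K.genus x : ℤ) - 1)), card_subtype_eq_sum]
    by_cases hφ : ∃ x, a x = φ
    -- The facets of `K` over `x` correspond to the punctures of `x`. For each of them the `-1` next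
    -- to its genus cancels against the `+1` of the puncture, so the genera add up.
    · obtain ⟨x, rfl⟩ := hφ
      have h1 : (∑ y, if b y = a x then (K.genus y : ℤ) - 1 else 0) =
          ∑ m, if p m = x then (K.genus (K.top (.inr (.inl m))) : ℤ) - 1 else 0 := by
        rw [← Finset.sum_filter, ← Finset.sum_filter]
        refine (Finset.sum_bij (fun m _ => K.top (.inr (.inl m))) ?_ ?_ ?_ fun _ _ => rfl).symm
        · intro m hm
          simp only [Finset.mem_filter, Finset.mem_univ, true_and] at hm ⊢
          rw [glue, hm]
        · exact fun m _ m' _ h => ht m m' h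
        · intro y hy
          simp only [Finset.mem_filter, Finset.mem_univ, true_and] at hy
          by_cases hy' : ∀ m, K.top (.inr (.inl m)) ≠ y
          · exact absurd hy.symm (hab x y hy')
          · push Not at hy'
            obtain ⟨m, rfl⟩ := hy'
            rw [glue] at hy
            exact ⟨m, by simpa using ha hy, rfl⟩
      simp only [ha.eq_iff, Finset.sum_ite_eq', Finset.mem_univ, if_true]
      rw [h1, genus_old, add_assoc, ← Finset.sum_add_distrib]
      push_cast
      rw [add_sub_right_comm]
      congr 1
      exact Finset.sum_congr rfl fun m _ => by split_ifs <;> simp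
    · push Not at hφ
      obtain ⟨x | y, rfl⟩ := surj φ
      · exact absurd rfl (hφ x)
      · have hy : ∀ m, K.top (.inr (.inl m)) ≠ y := by
          rintro m rfl
          exact hφ _ (glue m).symm
        have h1 : ∀ y', b y' = Sum.elim a b (.inr y) ↔ y' = y :=
          fun y' => ⟨fun h => (hb y y' hy h.symm).symm, fun h => congrArg b h⟩
        simp only [hφ, h1, if_false, Finset.sum_const_zero, Finset.sum_ite_eq', Finset.mem_univ,
          if_true, zero_add, add_zero]
        rw [← genus_new y hy]
        rfl
  bot := bot
  top := top
  ring := ring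
  ring_left := ring_left
  ring_right := ring_right

end Fill

instance : (emptyWeb.bend emptyWeb).Loops where
  snk := inferInstanceAs (IsEmpty (Empty ⊕ Empty))
  src := inferInstanceAs (IsEmpty (Empty ⊕ Empty))
  edge_mrk := by rintro ((⟨⟨⟩⟩ | ⟨⟨⟩⟩) | (⟨⟨⟩⟩ | ⟨⟨⟩⟩))

instance : (circleWeb.bend circleWeb).Loops where
  snk := inferInstanceAs (IsEmpty (Empty ⊕ Empty))
  src := inferInstanceAs (IsEmpty (Empty ⊕ Empty))
  edge_mrk := by rintro ((_ | _) | (⟨⟨⟩⟩ | ⟨⟨⟩⟩)) <;> rfl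

instance : (emptyWeb.bend threeCircles).Loops where
  snk := inferInstanceAs (IsEmpty (Empty ⊕ Empty))
  src := inferInstanceAs (IsEmpty (Empty ⊕ Empty))
  edge_mrk := by rintro ((⟨⟨⟩⟩ | _) | (⟨⟨⟩⟩ | ⟨⟨⟩⟩)); rfl

instance : IsEmpty (emptyWeb.bend emptyWeb).Mrk :=
  inferInstanceAs (IsEmpty ((Empty ⊕ Empty) ⊕ (Empty ⊕ Empty)))
instance : Fintype (circleWeb.bend circleWeb).Mrk :=
  inferInstanceAs (Fintype ((Unit ⊕ Unit) ⊕ (Empty ⊕ Empty)))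
instance : Fintype (emptyWeb.bend threeCircles).Mrk :=
  inferInstanceAs (Fintype ((Empty ⊕ ZMod 3) ⊕ (Empty ⊕ Empty)))

/-! ### Gluing the pieces of the local relations into a foam -/

section Flat

variable {I O : Type} {A B : PreWeb I O} {F : Foam A B}

/-- An isomorphism of foams with flat ends. -/
def FlatIso (F H : Foam A B) : Prop :=
  ∃ (a : F.Facet → H.Facet) (r : F.Ring → H.Ring), Function.Bijective a ∧ Function.Bijective r ∧
    (∀ x, H.genus (a x) = F.genus x) ∧ (∀ s, H.attach (.inl s) = a (F.attach (.inl s))) ∧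
    ∀ k, H.hol (r k) = F.hol k ∧ ∃ j, ∀ i, H.side (r k) (i + j) = a (F.side k i)

theorem FlatIso.refl (F : Foam A B) : FlatIso F F :=
  ⟨id, id, Function.bijective_id, Function.bijective_id, fun _ => rfl, fun _ => rfl,
    fun _ => ⟨rfl, 0, fun i => by rw [add_zero]; rfl⟩⟩

/-- Nothing is glued in: there are no punctures, and the identity of the empty web has no facets.
What remains of a filling is an isomorphism. -/
theorem FlatIso.nonempty_filling {F H : Foam A B} (h : FlatIso F H) :
    Nonempty (Filling F (idFoam emptyWeb).bend isEmptyElim H) := by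
  classical
  obtain ⟨a, r, ha, hr, hg, ho, hs⟩ := h
  have hK : IsEmpty (idFoam emptyWeb).bend.Facet :=
    ⟨by rintro ⟨⟨⟨⟩, _⟩ | ⟨⟨⟩⟩ | ⟨⟨⟩⟩⟩⟩
  have hR : IsEmpty (idFoam emptyWeb).bend.Ring := inferInstanceAs (IsEmpty Empty)
  have : Fintype (emptyWeb.bend emptyWeb).Mrk := Fintype.ofFinite _
  exact ⟨.ofInjective a isEmptyElim isEmptyElim isEmptyElim ha.1 isEmptyElim
    (fun _ => isEmptyElim) (fun φ => by
      obtain ⟨x, rfl⟩ := ha.2 φ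
      exact ⟨.inl x, rfl⟩) isEmptyElim (fun x => by
        rw [hg, Finset.univ_eq_empty, Finset.sum_empty, add_zero])
    (fun t => ho _) (fun h => ho _) ((Equiv.sumEmpty _ _).trans (Equiv.ofBijective r hr)) hs
    isEmptyElim⟩

theorem nonempty_filling_addFacet (F : Foam A B) (g : ℕ) :
    Nonempty (Filling F (closedSurface g).bend isEmptyElim (F.addFacet g)) := by
  classical
  have hR : IsEmpty (closedSurface g).bend.Ring := inferInstanceAs (IsEmpty Empty)
  have : Fintype (emptyWeb.bend emptyWeb).Mrk := Fintype.ofFinite _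
  exact ⟨.ofInjective some (fun _ => none) isEmptyElim isEmptyElim (Option.some_injective _)
    (fun _ _ _ _ => rfl) (fun _ _ _ h => by cases h) (fun φ => by
      rcases φ with _ | x
      exacts [⟨.inr (), rfl⟩, ⟨.inl x, rfl⟩]) (fun _ _ => rfl) (fun x => by
        rw [Finset.univ_eq_empty, Finset.sum_empty, add_zero]
        rfl)
    (fun t => rfl) (fun h => rfl) (Equiv.sumEmpty _ _)
    (fun k => ⟨rfl, 0, fun i => by rw [add_zero]; rfl⟩) isEmptyElim⟩

/-- The punctures along a closed seam. -/
def ringMarks {Φ : Type} (p : ZMod 3 → Φ) : (emptyWeb.bend threeCircles).Mrk → Φ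
  | .inl (.inr i) => p i
  | .inl (.inl m) => m.elim
  | .inr (.inl x) => x.elim
  | .inr (.inr x) => x.elim

/-- The punctures at the ends of a cylinder. -/
def pairMarks {Φ : Type} (x y : Φ) : (circleWeb.bend circleWeb).Mrk → Φ
  | .inl (.inl _) => x
  | .inl (.inr _) => y
  | .inr (.inl z) => z.elim
  | .inr (.inr z) => z.elim

/-- Each sheet of a neighbourhood of the seam is an annulus that ends at a puncture, so no facet is
added, only the seam. -/
theorem nonempty_filling_addRing (F : Foam A B) (p : ZMod 3 → F.Facet) (c : Equiv.Perm (ZMod 3)) :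
    Nonempty (Filling F (seamFoam c).bend (ringMarks p) (F.addRing (p ∘ c))) := by
  classical
  have ht : ∀ y : ZMod 3, ¬ ∀ m, (seamFoam c).bend.top (.inr (.inl m)) ≠ y :=
    fun y h => h (.inl (.inr y)) rfl
  refine ⟨.ofInjective (H := F.addRing (p ∘ c)) id p ?_ ?_ Function.injective_id
    (fun y _ h => absurd h (ht y)) (fun _ y h => absurd h (ht y)) (fun x => ⟨.inl x, rfl⟩)
    (fun y h => absurd h (ht y)) ?_ (fun _ => rfl) (fun _ => rfl)
    (Equiv.optionEquivSumPUnit _).symm (fun k => ⟨rfl, 0, fun i => by rw [add_zero]; rfl⟩)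
    (fun k => ⟨rfl, 0, fun i => by rw [add_zero]; rfl⟩)⟩
  · rintro ((⟨⟨⟩⟩ | m) | (⟨⟨⟩⟩ | ⟨⟨⟩⟩))
    rfl
  · rintro ((⟨⟨⟩⟩ | m) | (⟨⟨⟩⟩ | ⟨⟨⟩⟩)) ((⟨⟨⟩⟩ | m') | (⟨⟨⟩⟩ | ⟨⟨⟩⟩)) h
    exact congrArg (fun m => Sum.inl (Sum.inr m)) h
  · intro x
    have : ∀ y, (seamFoam c).bend.genus y = 0 := fun _ => rfl
    simp only [this, ite_self, Finset.sum_const_zero, add_zero]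
    rfl

/-- The outer annuli of the airlock extend the punctured facets; the middle annulus and both discs
become new facets. -/
theorem nonempty_filling_addAirlock (F : Foam A B) (x y : F.Facet) :
    Nonempty (Filling F airlock.bend (pairMarks x y) (F.addAirlock x y)) := by
  classical
  let b : Option (Bool × Bool) → Option (Option (Option F.Facet))
    | none => some (some none)
    | some (false, false) => some (some (some x))
    | some (true, false) => some (some (some y))
    | some (false, true) => some none
    | some (true, true) => none
  let e : F.Ring ⊕ Bool → Option (Option F.Ring)
    | .inl k => some (some k)
    | .inr true => none
    | .inr false => some none
  have he : Function.Bijective e := by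
    constructor
    · rintro (k | _ | _) (k' | _ | _) h <;> first | rfl | cases h
      rfl
    · rintro (_ | _ | k)
      exacts [⟨.inr true, rfl⟩, ⟨.inr false, rfl⟩, ⟨.inl k, rfl⟩]
  refine ⟨.ofInjective (H := F.addAirlock x y) (fun z => some (some (some z))) b
    ?_ ?_ ?_ ?_ ?_ ?_ ?_ ?_ (fun _ => rfl) (fun _ => rfl)
    (Equiv.ofBijective e he) (fun k => ⟨rfl, 0, fun i => by rw [add_zero]; rfl⟩) ?_⟩
  · rintro ((_ | _) | (⟨⟨⟩⟩ | ⟨⟨⟩⟩)) <;> rfl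
  · rintro ((_ | _) | (⟨⟨⟩⟩ | ⟨⟨⟩⟩)) ((_ | _) | (⟨⟨⟩⟩ | ⟨⟨⟩⟩)) h <;> first | rfl | cases h
  · intro z z' h
    cases h
    rfl
  · rintro (_ | ⟨_ | _, _ | _⟩) (_ | ⟨_ | _, _ | _⟩) h h' <;>
      first | rfl | exact absurd rfl (h (.inl (.inl ()))) |
        exact absurd rfl (h (.inl (.inr ()))) | cases h'
  · rintro z (_ | ⟨_ | _, _ | _⟩) h h' <;>
      first | cases h'; done | exact absurd rfl (h (.inl (.inl ()))) |
        exact absurd rfl (h (.inl (.inr ())))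
  · rintro (_ | _ | _ | z)
    exacts [⟨.inr (some (true, true)), rfl⟩, ⟨.inr (some (false, true)), rfl⟩, ⟨.inr none, rfl⟩,
      ⟨.inl z, rfl⟩]
  · rintro (_ | ⟨_ | _, _ | _⟩) h <;> first | rfl | exact absurd rfl (h (.inl (.inl ()))) |
        exact absurd rfl (h (.inl (.inr ())))
  · intro z
    have : ∀ y, airlock.bend.genus y = 0 := fun _ => rfl
    simp only [this, ite_self, Finset.sum_const_zero, add_zero]
    rfl
  · rintro (_ | _) <;> refine ⟨rfl, 0, fun i => ?_⟩ <;> rw [add_zero]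
    all_goals
      obtain rfl | rfl | rfl := (by decide : ∀ i : ZMod 3, i = 0 ∨ i = 1 ∨ i = 2) i <;> rfl

/-- Two choking tori glued in at the facets `x` and `y`. -/
def Foam.addChokes (F : Foam A B) (x y : F.Facet) : Foam A B :=
  (((((F.addFacet 1).addFacet 0).addFacet 1).addFacet 0).addRing
    (tri (some (some (some (some x)))) (some (some (some none))) (some (some none)))).addRing
    (tri (some (some (some (some y)))) (some none) none)

/-- The bulks extend the punctured facets, and both handles and both discs become new facets. -/
theorem nonempty_filling_addChokes (F : Foam A B) (x y : F.Facet) :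
    Nonempty (Filling F chokePair.bend (pairMarks x y) (F.addChokes x y)) := by
  classical
  let b : Bool × ZMod 3 → Option (Option (Option (Option F.Facet))) := fun z =>
    if z.2 = 0 then some (some (some (some (bif z.1 then y else x))))
    else if z.2 = 1 then bif z.1 then some none else some (some (some none))
    else bif z.1 then none else some (some none)
  have h3 : ∀ i : ZMod 3, i = 0 ∨ i = 1 ∨ i = 2 := by decide
  let e : F.Ring ⊕ Bool → Option (Option F.Ring)
    | .inl k => some (some k)
    | .inr true => none
    | .inr false => some none
  have he : Function.Bijective e := by
    constructor
    · rintro (k | _ | _) (k' | _ | _) h <;> first | rfl | cases h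
      rfl
    · rintro (_ | _ | k)
      exacts [⟨.inr true, rfl⟩, ⟨.inr false, rfl⟩, ⟨.inl k, rfl⟩]
  have hx : ∀ m, chokePair.bend.top (.inr (.inl m)) =
      (pairMarks (false, (0 : ZMod 3)) (true, (0 : ZMod 3)) m : Bool × ZMod 3) := by
    rintro ((_ | _) | (⟨⟨⟩⟩ | ⟨⟨⟩⟩)) <;> rfl
  refine ⟨.ofInjective (H := F.addChokes x y) (fun z => some (some (some (some z)))) b
    ?_ ?_ ?_ ?_ ?_ ?_ ?_ ?_ (fun _ => rfl) (fun _ => rfl)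
    (Equiv.ofBijective e he) (fun k => ⟨rfl, 0, fun i => by rw [add_zero]; rfl⟩) ?_⟩
  · rintro ((_ | _) | (⟨⟨⟩⟩ | ⟨⟨⟩⟩)) <;> rfl
  · rintro ((_ | _) | (⟨⟨⟩⟩ | ⟨⟨⟩⟩)) ((_ | _) | (⟨⟨⟩⟩ | ⟨⟨⟩⟩)) h <;> first | rfl | cases h
  · intro z z' h
    cases h
    rfl
  · rintro ⟨c, i⟩ ⟨c', i'⟩ h h'
    obtain rfl | rfl | rfl := h3 i <;> obtain rfl | rfl | rfl := h3 i' <;>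
      cases c <;> cases c' <;> first | rfl | exact absurd rfl (h (.inl (.inl ()))) |
        exact absurd rfl (h (.inl (.inr ()))) | cases h'
  · rintro z ⟨c, i⟩ h h'
    obtain rfl | rfl | rfl := h3 i <;> cases c <;>
      first | exact absurd rfl (h (.inl (.inl ()))) | exact absurd rfl (h (.inl (.inr ()))) | cases
          h'
  · rintro (_ | _ | _ | _ | z)
    exacts [⟨.inr (true, (2 : ZMod 3)), rfl⟩, ⟨.inr (true, (1 : ZMod 3)), rfl⟩,
      ⟨.inr (false, (2 : ZMod 3)), rfl⟩, ⟨.inr (false, (1 : ZMod 3)), rfl⟩, ⟨.inl z, rfl⟩]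
  · rintro ⟨c, i⟩ h
    obtain rfl | rfl | rfl := h3 i <;> cases c <;>
      first | rfl | exact absurd rfl (h (.inl (.inl ()))) | exact absurd rfl (h (.inl (.inr ())))
  · intro z
    have : ∀ m, chokePair.bend.genus (chokePair.bend.top (.inr (.inl m))) = 0 := by
      rintro ((_ | _) | (⟨⟨⟩⟩ | ⟨⟨⟩⟩)) <;> rfl
    simp only [this, ite_self, Finset.sum_const_zero, add_zero]
    rfl
  · rintro (_ | _) <;> refine ⟨rfl, 0, fun i => ?_⟩ <;> rw [add_zero]
    all_goals
      obtain rfl | rfl | rfl := h3 i <;> rfl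

/-- Closing a puncture by a surface adds its genus to the facet. The genera are added one after the
other, which is also correct for `x = y`. -/
theorem nonempty_filling_discPair [DecidableEq F.Facet] (g h : ℕ) (x y : F.Facet) :
    Nonempty (Filling F (discPair g h).bend (pairMarks x y)
      ((F.addGenus x g).addGenus (A := A) (B := B) y h)) := by
  have : IsEmpty (discPair g h).bend.Ring := inferInstanceAs (IsEmpty Empty)
  refine ⟨.ofInjective (H := (F.addGenus x g).addGenus (A := A) (B := B) y h) id
    (fun c : Bool => bif c then y else x) ?_ ?_ Function.injective_id
    (fun c _ hc => ?_) (fun _ c hc => ?_) (fun x => ⟨.inl x, rfl⟩)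
    (fun c hc => ?_) ?_ (fun _ => rfl) (fun _ => rfl)
    (Equiv.sumEmpty _ _) (fun k => ⟨rfl, 0, fun i => by rw [add_zero]; rfl⟩)
    isEmptyElim⟩
  · rintro ((_ | _) | (⟨⟨⟩⟩ | ⟨⟨⟩⟩)) <;> rfl
  · rintro ((_ | _) | (⟨⟨⟩⟩ | ⟨⟨⟩⟩)) ((_ | _) | (⟨⟨⟩⟩ | ⟨⟨⟩⟩)) h <;> first | rfl | cases h
  · cases c
    exacts [absurd rfl (hc (.inl (.inl ()))), absurd rfl (hc (.inl (.inr ())))]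
  · cases c
    exacts [absurd rfl (hc (.inl (.inl ()))), absurd rfl (hc (.inl (.inr ())))]
  · cases c
    exacts [absurd rfl (hc (.inl (.inl ()))), absurd rfl (hc (.inl (.inr ())))]
  · intro z
    refine Eq.trans ?_ (congrArg (F.genus z + ·) (Fintype.sum_sum_type (α₁ := Unit ⊕ Unit)
      (α₂ := Empty ⊕ Empty) _).symm)
    rw [Fintype.sum_sum_type, Finset.univ_eq_empty (α := Empty ⊕ Empty), Finset.sum_empty, add_zero]
    simp only [Finset.univ_unique, Finset.sum_singleton]
    rw [← add_assoc]
    change F.genus z + (if z = x then g else 0) + (if z = y then h else 0) = F.genus z +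
      (if x = z then g else 0) + (if y = z then h else 0)
    simp only [eq_comm]

/-- A tube joins the facets `x` and `y`. In `hg` the tube contributes `-1` as a facet of genus zero
and its two ends contribute `+2`, hence the single `1` at the joined facet. -/
theorem nonempty_filling_idCircle [DecidableEq F.Facet] [Fintype F.Facet] {H : Foam A B}
    [DecidableEq H.Facet] (x y : F.Facet) (a : F.Facet → H.Facet) (r : F.Ring → H.Ring)
    (ha : Function.Surjective a) (hr : Function.Bijective r) (hxy : a x = a y)
    (hker : ∀ u v, a u = a v → u = v ∨ (u = x ∧ v = y) ∨ (u = y ∧ v = x))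
    (hg : ∀ φ, (H.genus φ : ℤ) - 1 = (∑ u, if a u = φ then (F.genus u : ℤ) - 1 else 0) +
      if a x = φ then 1 else 0)
    (ho : ∀ s, H.attach (.inl s) = a (F.attach (.inl s)))
    (hs : ∀ k, H.hol (r k) = F.hol k ∧ ∃ j, ∀ i, H.side (r k) (i + j) = a (F.side k i)) :
    Nonempty (Filling F (idFoam circleWeb).bend (pairMarks x y) H) := by
  have hR : IsEmpty (idFoam circleWeb).bend.Ring := inferInstanceAs (IsEmpty Empty)
  let q : (idFoam circleWeb).bend.Facet := (idFoam circleWeb).bend.top (.inr (.inl (.inl (.inl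
      ()))))
  have hq : ∀ z, z = q := by
    rintro ⟨⟨⟨⟩, _⟩ | _ | ⟨⟨⟩⟩⟩
    rfl
  let uq : Unique (idFoam circleWeb).bend.Facet := ⟨⟨q⟩, hq⟩
  have hx : Relation.EqvGen (fun u v : F.Facet ⊕ (idFoam circleWeb).bend.Facet => ∃ m,
      u = .inl (pairMarks x y m) ∧ v = .inr ((idFoam circleWeb).bend.top (.inr (.inl m))))
      (.inl x) (.inr q) := .rel _ _ ⟨.inl (.inl ()), rfl, rfl⟩
  have hy : Relation.EqvGen (fun u v : F.Facet ⊕ (idFoam circleWeb).bend.Facet => ∃ m,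
      u = .inl (pairMarks x y m) ∧ v = .inr ((idFoam circleWeb).bend.top (.inr (.inl m))))
      (.inl y) (.inr q) := .rel _ _ ⟨.inl (.inr ()), rfl, congrArg _ (hq _).symm⟩
  have hux : ∀ u, a u = a x → Relation.EqvGen (fun u v : F.Facet ⊕
      (idFoam circleWeb).bend.Facet => ∃ m,
      u = .inl (pairMarks x y m) ∧ v = .inr ((idFoam circleWeb).bend.top (.inr (.inl m))))
      (.inl u) (.inr q) := by
    intro u h
    obtain rfl | ⟨rfl, -⟩ | ⟨rfl, -⟩ := hker _ _ h
    exacts [hx, hx, hy]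
  refine ⟨⟨a, fun _ => a x, ?_, ?_, ?_, ?_, fun t => ho _, fun h => ho _,
    (Equiv.sumEmpty _ _).trans (Equiv.ofBijective r hr), hs, isEmptyElim⟩⟩
  · rintro ((_ | _) | (⟨⟨⟩⟩ | ⟨⟨⟩⟩))
    exacts [rfl, hxy]
  · intro φ
    obtain ⟨u, rfl⟩ := ha φ
    exact ⟨.inl u, rfl⟩
  · rintro (u | u) (v | v) h
    · obtain rfl | ⟨rfl, rfl⟩ | ⟨rfl, rfl⟩ := hker _ _ h
      · exact .refl _
      · exact .trans _ _ _ hx (.symm _ _ hy)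
      · exact .trans _ _ _ hy (.symm _ _ hx)
    · rw [hq v]
      exact hux u h
    · rw [hq u]
      exact .symm _ _ (hux v h.symm)
    · rw [hq u, hq v]
      exact .refl _
  · intro φ
    rw [finsum_subtype (fun x => a x = φ) (fun x => ((F.genus x : ℤ) - 1)), hg,
      finsum_subtype (fun _ => a x = φ)
        (fun z => (((idFoam circleWeb).bend.genus z : ℤ) - 1)), Fintype.sum_unique (ι := (idFoam
            circleWeb).bend.Facet), card_subtype_eq_sum, add_assoc]
    congr 1
    refine Eq.trans ?_ (congrArg (_ + ·) (Fintype.sum_sum_type (α₁ := Unit ⊕ Unit)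
      (α₂ := Empty ⊕ Empty) _).symm)
    rw [Fintype.sum_sum_type, Finset.univ_eq_empty (α := Empty ⊕ Empty), Finset.sum_empty, add_zero]
    simp only [Finset.univ_unique, Finset.sum_singleton]
    change (if a x = φ then 1 else 0) = (if a x = φ then ((0 : ℕ) : ℤ) - 1 else 0) +
      ((if a x = φ then 1 else 0) + (if a y = φ then 1 else 0))
    rw [← hxy]
    split_ifs <;> norm_num

end Flat

/-! ### Relations between classes -/

section Relations

variable {I O : Type} [Finite I] [Finite O] {A B : PreWeb I O} [A.Flat] [B.Flat]
variable (S : Type u) [CommRing S] [Invertible (2 : S)] [Invertible (3 : S)]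

theorem Filling.cls_comp {W : PreWeb Empty Empty} [W.Loops] {F : Foam A B} {K : Foam emptyWeb W}
    {p : W.Mrk → F.Facet} {H : Foam A B} (D : Nonempty (Filling F K p H)) :
    ((idFoam A).adjoin K).cls S ≫ (F.puncture p).cls S = H.cls S :=
  D.some.gluing.cls_comp S

/-- The planar form of the relation is composed with the punctured foam. With `Filling.cls_comp`
every term becomes `F` with one term of the relation glued in. -/
theorem LocalRel.linearCombination_puncture_eq_zero {I' O' : Type} [Finite I'] [Finite O']
    {A' B' : PreWeb I' O'} [(A'.bend B').Loops] {x : Foam A' B' →₀ S} (h : LocalRel S x)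
    (F : Foam A B) (p : (A'.bend B').Mrk → F.Facet) :
    Finsupp.linearCombination S (fun K : Foam A' B' =>
      ((idFoam A).adjoin K.bend).cls S ≫ (F.puncture p).cls S) x = 0 := by
  have h1 := congrArg (Linear.rightComp S _ ((F.puncture p).cls S))
    (h.linearCombination_adjoin_eq_zero (S := S) A)
  rw [map_zero, Finsupp.linearCombination_apply, map_finsuppSum] at h1
  rw [Finsupp.linearCombination_apply]
  refine Eq.trans ?_ h1
  exact Finsupp.sum_congr fun K _ => (Linear.smul_comp _ _ _ _ _ _).symm

/-- Both foams are the composite of the same two foams, since a filling determines its result only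
up to isomorphism. -/
theorem FlatIso.cls_eq {F H : Foam A B} (h : FlatIso F H) : F.cls S = H.cls S :=
  (Filling.cls_comp S (FlatIso.refl F).nonempty_filling).symm.trans
    (Filling.cls_comp S h.nonempty_filling)

theorem cls_addFacet_zero (F : Foam A B) : (F.addFacet 0).cls S = 0 := by
  have h := LocalRel.sphere.linearCombination_puncture_eq_zero S F isEmptyElim
  rwa [Finsupp.linearCombination_single, one_smul,
    Filling.cls_comp S (nonempty_filling_addFacet F 0)] at h

theorem cls_addFacet_one (F : Foam A B) : (F.addFacet 1).cls S = (3 : S) • F.cls S := by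
  have h := LocalRel.torus.linearCombination_puncture_eq_zero S F isEmptyElim
  rwa [map_sub, Finsupp.linearCombination_single, Finsupp.linearCombination_single, one_smul,
    Filling.cls_comp S (nonempty_filling_addFacet F 1),
    Filling.cls_comp S (FlatIso.refl F).nonempty_filling, sub_eq_zero] at h

theorem cls_addFacet_two (F : Foam A B) : (F.addFacet 2).cls S = 0 := by
  have h := LocalRel.doubleTorus.linearCombination_puncture_eq_zero S F isEmptyElim
  rwa [Finsupp.linearCombination_single, one_smul,
    Filling.cls_comp S (nonempty_filling_addFacet F 2)] at h

/-- Negation on `ZMod 3` exchanges the sheets 1 and 2 and so reverses the cyclic order at the seam.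
-/
theorem cls_addRing (F : Foam A B) (p : ZMod 3 → F.Facet) :
    (F.addRing p).cls S = -(F.addRing (p ∘ Neg.neg)).cls S := by
  have h := LocalRel.seamSwap.linearCombination_puncture_eq_zero S F (ringMarks p)
  rwa [map_add, Finsupp.linearCombination_single, Finsupp.linearCombination_single, one_smul,
    one_smul, Filling.cls_comp S (nonempty_filling_addRing F p (Equiv.refl _)),
    Filling.cls_comp S (nonempty_filling_addRing F p (Equiv.neg _)), add_eq_zero_iff_eq_neg] at h

omit [A.Flat] [B.Flat] in
theorem cls_eq_zero_of_eq_neg {F : Foam A B} (h : F.cls S = -F.cls S) : F.cls S = 0 := by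
  have h2 : (2 : S) • F.cls S = 0 := by
    rw [two_smul]
    nth_rewrite 1 [h]
    exact neg_add_cancel _
  rw [← one_smul S (F.cls S), ← invOf_mul_self (2 : S), mul_smul, h2, smul_zero]

/-- The symmetry argument: a foam isomorphic to its own reversal is its own negative, and 2 is
invertible. -/
theorem cls_addRing_eq_zero {F : Foam A B} {p : ZMod 3 → F.Facet}
    (h : FlatIso (F.addRing (p ∘ Neg.neg)) (F.addRing p)) : (F.addRing p).cls S = 0 := by
  refine cls_eq_zero_of_eq_neg S ?_
  nth_rewrite 1 [cls_addRing]
  rw [h.cls_eq S]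


theorem cls_addAirlock (F : Foam A B) (x y : F.Facet) :
    (F.addAirlock x y).cls S = -F.cls S := by
  classical
  have hd : Nonempty (Gluing (capFoam 0) (cupFoam 0) (discPair 0 0)) := capCup_gluing 0 0
  have h := (LocalRel.airlock (S := S) _ hd.some).linearCombination_puncture_eq_zero
    S F (pairMarks x y)
  -- The right hand side of the airlock relation closes both punctures by discs, which restores `F`.
  have h0 : FlatIso F ((F.addGenus x 0).addGenus (A := A) (B := B) y 0) :=
    ⟨id, id, Function.bijective_id, Function.bijective_id, fun z => by
      change F.genus z + (if z = x then 0 else 0) + (if z = y then 0 else 0) = _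
      simp, fun _ => rfl, fun _ => ⟨rfl, 0, fun i => by rw [add_zero]; rfl⟩⟩
  rwa [map_add, Finsupp.linearCombination_single, Finsupp.linearCombination_single, one_smul,
    one_smul, Filling.cls_comp S (nonempty_filling_addAirlock F x y),
    Filling.cls_comp S (nonempty_filling_discPair 0 0 x y), ← h0.cls_eq S,
    add_eq_zero_iff_eq_neg] at h

/-- Cutting a neck between the facets `x` and `y` of `F`. -/
theorem cls_eq_of_neck {F H P Q : Foam A B} [DecidableEq F.Facet] {x y : F.Facet}
    (hH : Nonempty (Filling F (idFoam circleWeb).bend (pairMarks x y) H))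
    (hP : FlatIso ((F.addGenus x 1).addGenus (A := A) (B := B) y 0) P)
    (hQ : FlatIso ((F.addGenus x 0).addGenus (A := A) (B := B) y 1) Q) :
    H.cls S = (⅟3 : S) • P.cls S - (⅟3 * ⅟3 : S) • (F.addChokes x y).cls S +
      (⅟3 : S) • Q.cls S := by
  have h1 : Nonempty (Gluing (capFoam 1) (cupFoam 0) (discPair 1 0)) := capCup_gluing 1 0
  have h2 : Nonempty (Gluing (capFoam 0) (cupFoam 1) (discPair 0 1)) := capCup_gluing 0 1
  have h := (LocalRel.neckCutting (S := S) _ _ _ h1.some chokeCapCup_gluing.some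
    h2.some).linearCombination_puncture_eq_zero S F (pairMarks x y)
  rwa [map_sub, map_add, map_sub, Finsupp.linearCombination_single,
    Finsupp.linearCombination_single, Finsupp.linearCombination_single,
    Finsupp.linearCombination_single, one_smul, Filling.cls_comp S hH,
    Filling.cls_comp S (nonempty_filling_discPair 1 0 x y), hP.cls_eq S,
    Filling.cls_comp S (nonempty_filling_discPair 0 1 x y), hQ.cls_eq S,
    Filling.cls_comp S (nonempty_filling_addChokes F x y), sub_eq_zero] at h

end Relations

/-! ### Evaluation of foams -/

section Evaluation

variable {I O : Type} {A B : PreWeb I O}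

/-- The facets of an identity are edges joined at marked points. There are none of these, so a
bijective labelling of facets of genus zero by edges is enough. -/
theorem flatIso_idFoam [Finite I] [A.Flat] [IsEmpty A.Mrk] {F : Foam A A} [IsEmpty F.Ring]
    (f : F.Facet → A.Tail) (hf : Function.Bijective f) (hg : ∀ x, F.genus x = 0)
    (ha : ∀ s, f (F.attach (.inl s)) = Sum.elim id A.edge.symm s) : FlatIso F (idFoam A) := by
  have hR : IsEmpty (idFoam A).Ring := inferInstanceAs (IsEmpty Empty)
  have hq : Function.Bijective (Quot.mk fun s t : A.Tail =>
      ∃ m : A.Mrk, A.edge s = .inr (.inl m) ∧ t = .inr (.inl m)) := by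
    refine ⟨fun s t h => ?_, Quot.mk_surjective⟩
    have h1 := Quot.eqvGen_exact h
    clear h
    induction h1 with
    | rel _ _ h => exact isEmptyElim h.choose
    | refl => rfl
    | symm _ _ _ ih => exact ih.symm
    | trans _ _ _ _ _ ih1 ih2 => exact ih1.trans ih2
  refine ⟨fun x => Quot.mk _ (f x), isEmptyElim, hq.comp hf,
    ⟨fun k => isEmptyElim k, fun k => isEmptyElim k⟩, fun x => (hg x).symm, ?_, isEmptyElim⟩
  rintro (t | h)
  · exact congrArg _ (ha (.inl t)).symm
  · exact congrArg _ (ha (.inr h)).symm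

theorem flatIso_addRing_comm (F : Foam A B) (p q : ZMod 3 → F.Facet) :
    FlatIso ((F.addRing p).addRing q) ((F.addRing q).addRing (A := A) (B := B) p) := by
  let r : Option (Option F.Ring) → Option (Option F.Ring)
    | none => some none
    | some none => none
    | some (some k) => some (some k)
  have hr : Function.Involutive r := by rintro (_ | _ | k) <;> rfl
  refine ⟨id, r, Function.bijective_id, hr.bijective, fun _ => rfl, fun _ => rfl, ?_⟩
  rintro (_ | _ | k) <;> exact ⟨rfl, 0, fun i => by rw [add_zero]; rfl⟩

/-- The seam that was added first is moved to the last place, where `cls_addRing` applies to it. -/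
theorem flatIso_addRing_rotate (F : Foam A B) (p q t : ZMod 3 → F.Facet) :
    FlatIso (((F.addRing p).addRing q).addRing t)
      (((F.addRing q).addRing (A := A) (B := B) t).addRing (A := A) (B := B) p) := by
  let r : Option (Option (Option F.Ring)) → Option (Option (Option F.Ring))
    | none => some none
    | some none => some (some none)
    | some (some none) => none
    | some (some (some k)) => some (some (some k))
  have hr : r.Bijective := by
    refine ⟨?_, ?_⟩
    · rintro (_ | _ | _ | k) (_ | _ | _ | k') h <;> first | rfl | cases h
      rfl
    · rintro (_ | _ | _ | k)
      exacts [⟨some (some none), rfl⟩, ⟨none, rfl⟩, ⟨some none, rfl⟩, ⟨some (some (some k)), rfl⟩]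
  refine ⟨id, r, Function.bijective_id, hr, fun _ => rfl, fun _ => rfl, ?_⟩
  rintro (_ | _ | _ | k) <;> exact ⟨rfl, 0, fun i => by rw [add_zero]; rfl⟩

/-- Whether two maps are an isomorphism of the combinatorial data of foams with flat ends. -/
def isoCheck {T Φ Ψ R Q : Type} [Fintype T] [Fintype Φ] [DecidableEq Φ] [Fintype Ψ] [DecidableEq Ψ]
    [Fintype R] [DecidableEq R] [Fintype Q] [DecidableEq Q]
    (g : Φ → ℕ) (o : T → Φ) (h : R → ZMod 3) (s : R → ZMod 3 → Φ)
    (g' : Ψ → ℕ) (o' : T → Ψ) (h' : Q → ZMod 3) (s' : Q → ZMod 3 → Ψ)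
    (a : Φ → Ψ) (r : R → Q) : Bool :=
  decide (Function.Bijective a ∧ Function.Bijective r ∧ (∀ x, g' (a x) = g x) ∧
    (∀ t, o' t = a (o t)) ∧ ∀ k, h' (r k) = h k ∧ ∃ j, ∀ i, s' (r k) (i + j) = a (s k i))

/-- Transporting the data of the foams to explicit finite types makes the existence of an
isomorphism a Boolean computation. The equalities of types hold by `rfl` in all applications. -/
theorem FlatIso.of_isoCheck [Fintype (A.Tail ⊕ B.Head)] {F H : Foam A B} {Φ Ψ R Q : Type}
    [Fintype Φ] [DecidableEq Φ] [Fintype Ψ] [DecidableEq Ψ]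
    [Fintype R] [DecidableEq R] [Fintype Q] [DecidableEq Q] (a : Φ → Ψ) (r : R → Q)
    (eΦ : F.Facet = Φ) (eΨ : H.Facet = Ψ) (eR : F.Ring = R) (eQ : H.Ring = Q)
    (h : isoCheck (fun x => F.genus (cast eΦ.symm x)) (fun t => cast eΦ (F.attach (.inl t)))
      (fun k => F.hol (cast eR.symm k)) (fun k i => cast eΦ (F.side (cast eR.symm k) i))
      (fun x => H.genus (cast eΨ.symm x)) (fun t => cast eΨ (H.attach (.inl t)))
      (fun k => H.hol (cast eQ.symm k)) (fun k i => cast eΨ (H.side (cast eQ.symm k) i)) a r =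
          true) :
    FlatIso F H := by
  subst eΦ eΨ eR eQ
  exact ⟨a, r, of_decide_eq_true h⟩

variable [Finite I] [Finite O] [A.Flat] [B.Flat]
variable (S : Type u) [CommRing S] [Invertible (2 : S)] [Invertible (3 : S)]

theorem cls_addRing_addRing (F : Foam A B) (p q : ZMod 3 → F.Facet) :
    ((F.addRing p).addRing q).cls S = -((F.addRing (p ∘ Neg.neg)).addRing (A := A) (B := B) q).cls
        S :=
  ((flatIso_addRing_comm F p q).cls_eq S).trans ((cls_addRing S (F.addRing q) p).trans
    (congrArg _ ((flatIso_addRing_comm F (p ∘ Neg.neg) q).cls_eq S).symm))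

theorem cls_addRing_addRing_addRing (F : Foam A B) (p q t : ZMod 3 → F.Facet) :
    (((F.addRing p).addRing q).addRing t).cls S =
      -(((F.addRing (p ∘ Neg.neg)).addRing (A := A) (B := B) q).addRing (A := A) (B := B) t).cls
        S :=
  ((flatIso_addRing_rotate F p q t).cls_eq S).trans
    ((cls_addRing S (Foam.addRing (A := A) (B := B) (F.addRing q) t) p).trans
      (congrArg _ ((flatIso_addRing_rotate F (p ∘ Neg.neg) q t).cls_eq S).symm))

/-- An airlock in which the seam at the facet `y` is reversed. -/
def Foam.addTwistedAirlock (F : Foam A B) (x y : F.Facet) : Foam A B :=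
  ((((F.addFacet 0).addFacet 0).addFacet 0).addRing
    (tri (some (some none)) (some (some (some x))) (some none))).addRing
    (tri (some (some none)) none (some (some (some y))))

theorem tri_comp_neg {α : Type} (x y z : α) : tri x y z ∘ Neg.neg = tri x z y := by
  funext i
  obtain rfl | rfl | rfl := (by decide : ∀ i : ZMod 3, i = 0 ∨ i = 1 ∨ i = 2) i <;> rfl

/-- The sign of the reversed seam cancels the sign of the airlock. -/
theorem cls_addTwistedAirlock (F : Foam A B) (x y : F.Facet) :
    (F.addTwistedAirlock x y).cls S = F.cls S := by
  have h := (cls_addRing S _ _).symm.trans (cls_addAirlock S F x y)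
  have h' := (congrArg (fun p => -(Foam.addRing (A := A) (B := B) ((((F.addFacet 0).addFacet
    0).addFacet 0).addRing (tri (some (some none)) (some (some (some x))) (some none))) p).cls S)
    (tri_comp_neg (some (some none) : Option (Option (Option F.Facet)))
      (some (some (some y))) none)).symm.trans h
  exact neg_injective h'

end Evaluation

/-! ### Values of the composites of standard foams -/

section Closed

variable (S : Type u) [CommRing S] [Invertible (2 : S)] [Invertible (3 : S)]

theorem cls_voidFoam : voidFoam.cls S = 𝟙 _ := by
  have : IsEmpty emptyWeb.Mrk := inferInstanceAs (IsEmpty Empty)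
  have : IsEmpty voidFoam.Ring := inferInstanceAs (IsEmpty Empty)
  have : IsEmpty emptyWeb.Tail := ⟨by rintro (⟨⟨⟩, _⟩ | ⟨⟨⟩⟩ | ⟨⟨⟩⟩)⟩
  rw [← cls_idFoam]
  refine (flatIso_idFoam (Empty.elim : Empty → emptyWeb.Tail) ⟨fun x => (x : Empty).elim,
      isEmptyElim⟩
    (fun _ => rfl) ?_).cls_eq S
  decide +kernel

theorem cls_thetaFoam (g : Fin 2) : (thetaFoam g).cls S = 0 := by
  fin_cases g
  -- Genera 0, 1, 0: the two discs are exchanged.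
  · refine cls_addRing_eq_zero S (.of_isoCheck (Φ := Option (Option (Option Empty))) (R := Option
      Empty)
      (fun x => x.elim (some (some none)) fun x => x.elim (some none) fun _ => none) id
      rfl rfl rfl rfl ?_)
    decide +kernel
  -- Genera 1, 1, 0: the two handles are exchanged.
  · refine cls_addRing_eq_zero S (.of_isoCheck (Φ := Option (Option (Option Empty))) (R := Option
      Empty)
      (fun x => x.elim (some none) fun x => x.elim none fun x => some (some x)) id
      rfl rfl rfl rfl ?_)
    decide +kernel

/-- The sign comes from the airlock, and each of the two tori that it joins contributes 3. -/
theorem cls_chokeFoam : chokeFoam.cls S = -(9 : S) • 𝟙 _ := by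
  rw [← cls_voidFoam]
  refine (cls_addAirlock S _ _ _).trans ?_
  rw [cls_addFacet_one, cls_addFacet_one, smul_smul, neg_smul]
  norm_num

theorem cls_strandSheet : strandSheet.cls S = 𝟙 _ := by
  have : IsEmpty strandWeb.Mrk := inferInstanceAs (IsEmpty Empty)
  have : IsEmpty strandSheet.Ring := inferInstanceAs (IsEmpty Empty)
  rw [← cls_idFoam]
  refine (flatIso_idFoam (fun _ : Unit => (.inr (.inr ()) : strandWeb.Tail)) ⟨fun _ _ _ => rfl, ?_⟩
    (fun _ => rfl) ?_).cls_eq S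
  · rintro (⟨⟨⟩, _⟩ | ⟨⟨⟩⟩ | ⟨⟩)
    exact ⟨(), rfl⟩
  · decide +kernel

theorem cls_sheetsH : sheetsH.cls S = 𝟙 _ := by
  have : IsEmpty horizontalWeb.Mrk := inferInstanceAs (IsEmpty Empty)
  have : IsEmpty sheetsH.Ring := inferInstanceAs (IsEmpty Empty)
  rw [← cls_idFoam]
  refine (flatIso_idFoam (fun b : Bool => (.inr (.inr b) : horizontalWeb.Tail)) ⟨?_, ?_⟩
    (fun _ => rfl) ?_).cls_eq S
  · intro b c h
    cases h
    rfl
  · rintro (⟨⟨⟩, _⟩ | ⟨⟨⟩⟩ | b)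
    exact ⟨b, rfl⟩
  · decide +kernel

theorem cls_sheetsV : sheetsV.cls S = 𝟙 _ := by
  have : IsEmpty verticalWeb.Mrk := inferInstanceAs (IsEmpty Empty)
  have : IsEmpty sheetsV.Ring := inferInstanceAs (IsEmpty Empty)
  rw [← cls_idFoam]
  refine (flatIso_idFoam (fun b : Bool => (.inr (.inr b) : verticalWeb.Tail)) ⟨?_, ?_⟩
    (fun _ => rfl) ?_).cls_eq S
  · intro b c h
    cases h
    rfl
  · rintro (⟨⟨⟩, _⟩ | ⟨⟨⟩⟩ | b)
    exact ⟨b, rfl⟩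
  · decide +kernel

/-- Exchanging the two discs reverses the seam. -/
theorem cls_bubbleFoam : bubbleFoam.cls S = 0 := by
  refine cls_addRing_eq_zero S (.of_isoCheck (Φ := Option (Option Unit)) (R := Option Empty)
    (fun x => x.elim (some none) fun x => x.elim none fun x => some (some x)) id rfl rfl rfl rfl ?_)
  decide +kernel

theorem cls_rocketFoamHV : rocketFoamHV.cls S = 0 := by
  refine cls_addRing_eq_zero S (.of_isoCheck (Φ := Option (Option Unit)) (R := Option Empty)
    (fun x => x.elim (some none) fun x => x.elim none fun x => some (some x)) id rfl rfl rfl rfl ?_)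
  decide +kernel

theorem cls_rocketFoamVH : rocketFoamVH.cls S = 0 := by
  refine cls_addRing_eq_zero S (.of_isoCheck (Φ := Option (Option Unit)) (R := Option Empty)
    (fun x => x.elim (some none) fun x => x.elim none fun x => some (some x)) id rfl rfl rfl rfl ?_)
  decide +kernel

theorem cls_rocketFoamV : rocketFoamV.cls S = -𝟙 _ := by
  rw [← cls_sheetsV]
  exact cls_addAirlock S _ _ _

/-- Both seams are opposite to those of an airlock; reversing both costs two signs, which cancel. -/
theorem cls_rocketFoamH : rocketFoamH.cls S = -𝟙 _ := by
  rw [← cls_sheetsH, ← cls_addAirlock S sheetsH false true]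
  refine (cls_addRing S _ _).trans ((congrArg _ (cls_addRing_addRing S _ _ _)).trans ?_)
  rw [neg_neg]
  refine FlatIso.cls_eq S (.of_isoCheck (Φ := Option (Option (Option Bool)))
    (R := Option (Option Empty)) id id rfl rfl rfl rfl ?_)
  decide +kernel

/-- Exchanging the two sheets that kiss, with the discs of both kisses fixed, reverses all three
seams. Three signs make the foam its own negative. -/
theorem cls_doubleKissFoam : doubleKissFoam.cls S = 0 := by
  refine cls_eq_zero_of_eq_neg S ((cls_addRing S _ _).trans (congrArg _ ?_))
  refine (cls_addRing_addRing S _ _ _).trans ?_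
  refine (congrArg _ (cls_addRing_addRing_addRing S _ _ _ _)).trans ((neg_neg _).trans ?_)
  refine FlatIso.cls_eq S (.of_isoCheck (Φ := Option (Option (Option (Option Unit))))
    (Ψ := Option (Option (Option (Option Unit))))
    (R := Option (Option (Option Empty))) (fun x => x.elim none fun x => x.elim (some none)
      fun x => x.elim (some (some (some none))) fun x => x.elim (some (some none))
      fun x => some (some (some (some x)))) id rfl rfl rfl rfl ?_)
  decide +kernel

/-- The sheet of a strand, a disc, and surfaces of genus `g` and `h`, and another disc. -/
def kissParts (g h : ℕ) : Foam strandWeb strandWeb :=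
  (((strandSheet.addFacet 0).addFacet g).addFacet h).addFacet 0

/-- The bubble whose sheets kiss, with one of the sheets cut between the seams. -/
def cutKissFoam (g h : ℕ) : Foam strandWeb strandWeb :=
  ((kissParts g h).addRing (tri (some (some (some (some ())))) (some (some (some none)))
    (some (some none)))).addRing (tri none (some (some (some none))) (some none))

instance (g h : ℕ) : Fintype (cutKissFoam g h).Facet :=
  inferInstanceAs (Fintype (Option (Option (Option (Option Unit)))))
instance (g h : ℕ) : DecidableEq (cutKissFoam g h).Facet :=
  inferInstanceAs (DecidableEq (Option (Option (Option (Option Unit)))))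
instance (g h : ℕ) : Fintype (cutKissFoam g h).Ring :=
  inferInstanceAs (Fintype (Option (Option Empty)))

/-- The second sheet is an annulus between the two seams; it arises by joining the two discs of the
cut foam by a tube. -/
theorem nonempty_filling_kissFoam : Nonempty (Filling (cutKissFoam 0 0) (idFoam circleWeb).bend
    (pairMarks (some (some none)) (some none)) kissFoam) := by
  refine nonempty_filling_idCircle (F := cutKissFoam 0 0) (H := kissFoam) (some (some none))
    (some none) (fun x : Option (Option (Option (Option Unit))) => x.elim none fun x => some
        (x.elim none id))
    id ?_ ?_ ?_ ?_ ?_ ?_ ?_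
  · rintro (_ | _ | z)
    exacts [⟨none, rfl⟩, ⟨some none, rfl⟩, ⟨some (some (some z)), rfl⟩]
  · exact Function.bijective_id
  · rfl
  · rintro (_ | _ | _ | z) (_ | _ | _ | z') h <;>
      first
      | exact .inl rfl
      | exact .inr (.inl ⟨rfl, rfl⟩)
      | exact .inr (.inr ⟨rfl, rfl⟩)
      | cases h
    exact .inl rfl
  · decide +kernel
  · decide +kernel
  · decide +kernel

/-- The seam of the kiss now bounds two discs, which are exchanged. -/
theorem cls_cutKissFoam_one_zero : (cutKissFoam 1 0).cls S = 0 := by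
  refine cls_addRing_eq_zero S (.of_isoCheck (Φ := Option (Option (Option (Option Unit))))
    (R := Option (Option Empty)) (fun x => x.elim (some none) fun x => x.elim none
      fun x => some (some x)) id rfl rfl rfl rfl ?_)
  decide +kernel

/-- The uncut sheet is the middle annulus of an airlock between the strand and a torus, with the
seam at the strand reversed. Hence there is no sign, and the torus contributes 3. -/
theorem cls_cutKissFoam_zero_one : (cutKissFoam 0 1).cls S = (3 : S) • 𝟙 _ := by
  rw [← cls_strandSheet, ← cls_addFacet_one,
    ← cls_addTwistedAirlock S (strandSheet.addFacet 1) none (some ())]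
  refine FlatIso.cls_eq S (.of_isoCheck (Φ := Option (Option (Option (Option Unit))))
    (R := Option (Option Empty)) (fun x => x.elim (some none) fun x => x.elim (some (some (some
        none)))
      fun x => x.elim none fun x => x.elim (some (some none)) fun x => some (some (some (some x))))
    (fun k => k.elim (some none) fun _ => none) rfl rfl rfl rfl ?_)
  decide +kernel

/-- The half of the cut sheet at the strand is the middle annulus of an airlock between the strand
and the first handle, and the uncut sheet is the disc at the strand seam of this airlock. The other
half is the middle annulus of a twisted airlock between this disc and the second handle. The value
is -1 for the airlock times 3 for each torus. -/
theorem cls_addChokes_cutKissFoam : ((cutKissFoam 0 0).addChokes (some (some none)) (some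
    none)).cls S =
    -(9 : S) • 𝟙 _ := by
  have h : -(9 : S) • 𝟙 ((Quotient.functor (Rel S)).obj (strandWeb.formal S)) =
      ((((strandSheet.addFacet 1).addAirlock (some ()) none).addFacet 1).addTwistedAirlock none
        (some (some none))).cls S := by
    refine Eq.trans ?_ ((cls_addTwistedAirlock S _ _ _).trans ((cls_addFacet_one S _).trans
      (congrArg _ ((cls_addAirlock S _ _ _).trans (congrArg _ ((cls_addFacet_one S _).trans
        (congrArg _ (cls_strandSheet S)))))))).symm
    rw [smul_neg, smul_smul, neg_smul]
    norm_num
  rw [h]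
  let a : Option (Option (Option (Option (Option (Option (Option (Option Unit))))))) →
      Option (Option (Option (Option (Option (Option (Option (Option Unit))))))) := fun x =>
    x.elim (some none) fun x => x.elim (some (some (some none))) fun x =>
    x.elim (some (some (some (some none)))) fun x =>
    x.elim (some (some (some (some (some (some (some none))))))) fun x =>
    x.elim none fun x => x.elim (some (some none)) fun x =>
    x.elim (some (some (some (some (some (some none)))))) fun x =>
    x.elim (some (some (some (some (some none))))) fun x =>
    some (some (some (some (some (some (some (some x)))))))
  refine FlatIso.cls_eq S (.of_isoCheck a
    (R := Option (Option (Option (Option Empty)))) (Q := Option (Option (Option (Option Empty))))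
    (fun k => k.elim (some none) fun k => k.elim (some (some none)) fun k =>
      k.elim none fun _ => some (some (some none))) rfl rfl rfl rfl ?_)
  decide +kernel

/-- Neck cutting on the second sheet, between the two seams; the terms contribute 0, 1 and 1. -/
theorem cls_kissFoam : kissFoam.cls S = (2 : S) • 𝟙 _ := by
  rw [cls_eq_of_neck S (P := cutKissFoam 1 0) (Q := cutKissFoam 0 1) nonempty_filling_kissFoam
      (.of_isoCheck (Φ := Option (Option (Option (Option Unit)))) (R := Option (Option Empty))
        id id rfl rfl rfl rfl (by decide +kernel))
      (.of_isoCheck (Φ := Option (Option (Option (Option Unit)))) (R := Option (Option Empty))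
        id id rfl rfl rfl rfl (by decide +kernel)),
    cls_cutKissFoam_one_zero, cls_cutKissFoam_zero_one, cls_addChokes_cutKissFoam, smul_zero,
    zero_sub, smul_smul, smul_smul, ← neg_smul, ← add_smul]
  congr 1
  -- For `u = ⅟3 * 3` the claim is `u² + u = 2`, and `u² + u - 2 = (u + 2) (u - 1)`.
  have h3 : (⅟3 : S) * 3 = 1 := invOf_mul_self _
  linear_combination (⅟3 * 3 + 2 : S) * h3

end Closed

/-! ### Degrees -/

section Degree

variable {I O : Type} [Fintype I] [Fintype O] {A B : PreWeb I O}

theorem Foam.OuterCircles.deg_eq [Fintype A.Snk] [Fintype A.Src] [Fintype B.Snk] [Fintype B.Src]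
    {F : Foam A B} [DecidableEq F.Facet] [Fintype F.Facet] [Fintype F.Ring] {ι : Type} [Fintype ι]
    {p : ι → A.Tail ⊕ B.Head} {ix : A.Tail ⊕ B.Head → ι} (h : F.OuterCircles p ix) :
    F.deg = 2 * ((∑ φ, F.euler p φ) - 2 * (Fintype.card (A.Snk ⊕ B.Src) : ℤ)) -
      (Fintype.card (I ⊕ O) : ℤ) + (Fintype.card ((A.Snk ⊕ A.Src) ⊕ (B.Snk ⊕ B.Src)) : ℤ) / 2 := by
  rw [Foam.deg, Foam.eulerChar, finsum_eq_sum_of_fintype, Nat.card_eq_fintype_card,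
    Nat.card_eq_fintype_card, Nat.card_eq_fintype_card, Finset.sum_congr rfl fun φ _ => h.chi_eq φ]

/-- Twice the Euler characteristic `1 - 2g`, as there are no boundary points and no vertices. -/
theorem capFoam_deg (g : Fin 2) : (capFoam g).deg = 2 - 4 * g := by
  rw [(capFoam_outerCircles g).deg_eq]
  revert g
  decide +kernel

theorem cupFoam_deg (g : Fin 2) : (cupFoam g).deg = 2 - 4 * g := by
  rw [(cupFoam_outerCircles g).deg_eq]
  revert g
  decide +kernel

theorem capChoke_deg : capChoke.deg = 0 :=
  capChoke_outerCircles.deg_eq.trans (by decide +kernel)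

theorem cupChoke_deg : cupChoke.deg = 0 :=
  cupChoke_outerCircles.deg_eq.trans (by decide +kernel)

theorem lowerBubble_deg : lowerBubble.deg = 1 :=
  lowerBubble_outerCircles.deg_eq.trans (by decide +kernel)

theorem upperBubble_deg : upperBubble.deg = 1 :=
  upperBubble_outerCircles.deg_eq.trans (by decide +kernel)

/-- Two punctures and a new disc lower the Euler characteristic of the half bubble by one, hence the
degree by two. -/
theorem lowerKiss_deg : lowerKiss.deg = -1 :=
  lowerKiss_outerCircles.deg_eq.trans (by decide +kernel)

theorem upperKiss_deg : upperKiss.deg = -1 :=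
  upperKiss_outerCircles.deg_eq.trans (by decide +kernel)

theorem lowerRocketH_deg : lowerRocketH.deg = 0 :=
  lowerRocketH_outerCircles.deg_eq.trans (by decide +kernel)

theorem upperRocketH_deg : upperRocketH.deg = 0 :=
  upperRocketH_outerCircles.deg_eq.trans (by decide +kernel)

theorem lowerRocketV_deg : lowerRocketV.deg = 0 :=
  lowerRocketV_outerCircles.deg_eq.trans (by decide +kernel)

theorem upperRocketV_deg : upperRocketV.deg = 0 :=
  upperRocketV_outerCircles.deg_eq.trans (by decide +kernel)

end Degree

/-! ### Matrices of foams -/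

section Matrices

/-- An isomorphism from an object to a direct sum, given by its components. -/
noncomputable def matIso {C : Type*} [Category C] [Preadditive C] {n : ℕ} {X : C} {Y : Fin n → C}
    (f : ∀ j, X ⟶ Y j) (g : ∀ j, Y j ⟶ X) (h : ∑ j, f j ≫ g j = 𝟙 X)
    (h1 : ∀ i, g i ≫ f i = 𝟙 (Y i)) (h0 : ∀ i j, i ≠ j → g i ≫ f j = 0) :
    (⟨Unit, fun _ => X⟩ : Mat_ C) ≅ ⟨Fin n, Y⟩ where
  hom := fun _ j => f j
  inv := fun j _ => g j
  hom_inv_id := Mat_.hom_ext _ _ fun _ _ =>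
    h.trans (Mat_.id_apply_self (⟨Unit, fun _ => X⟩ : Mat_ C) ()).symm
  inv_hom_id := by
    refine Mat_.hom_ext _ _ fun i j => (Fintype.sum_unique (ι := Unit) fun _ => g i ≫ f j).trans ?_
    by_cases hij : i = j
    · subst hij
      exact (h1 i).trans (Mat_.id_apply_self (⟨Fin n, Y⟩ : Mat_ C) i).symm
    · exact (h0 i j hij).trans (Mat_.id_apply_of_ne (⟨Fin n, Y⟩ : Mat_ C) i j hij).symm

variable (S : Type u) [CommRing S] [Invertible (2 : S)] [Invertible (3 : S)] {D : Rim}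

/-- Morphisms of webs as morphisms of graded webs. -/
noncomputable def gradedHom (X Y : GradedWeb D) :
    ((Quotient.functor (Rel S)).obj (X.web.formal S) ⟶
      (Quotient.functor (Rel S)).obj (Y.web.formal S)) →ₗ[S]
      ((show Cob3 S D from X) ⟶ (show Cob3 S D from Y)) where
  toFun f := InducedCategory.homMk f
  map_add' _ _ := rfl
  map_smul' _ _ := rfl

variable {S} {X Y Z : GradedWeb D}

theorem mor_eq_gradedHom (F : Foam X.web Y.web) : F.mor S X Y = gradedHom S X Y (F.cls S) := rfl

theorem gradedHom_comp (f : (Quotient.functor (Rel S)).obj (X.web.formal S) ⟶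
      (Quotient.functor (Rel S)).obj (Y.web.formal S))
    (g : (Quotient.functor (Rel S)).obj (Y.web.formal S) ⟶
      (Quotient.functor (Rel S)).obj (Z.web.formal S)) :
    gradedHom S X Y f ≫ gradedHom S Y Z g = gradedHom S X Z (f ≫ g) := rfl

theorem gradedHom_id : gradedHom S X X (𝟙 _) = 𝟙 _ := rfl

theorem mor_comp_mor {F : Foam X.web Y.web} {G : Foam Y.web Z.web} {H : Foam X.web Z.web}
    (h : Nonempty (Gluing F G H)) : F.mor S X Y ≫ G.mor S Y Z = gradedHom S X Z (H.cls S) := by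
  rw [mor_eq_gradedHom, mor_eq_gradedHom, gradedHom_comp, h.some.cls_comp S]

theorem isHomogeneous_mor {F : Foam X.web Y.web} (h : F.deg = X.shift - Y.shift) :
    IsHomogeneous S 0 (F.mor S X Y) :=
  Submodule.subset_span ⟨F, by rw [h]; ring, rfl⟩

theorem IsHomogeneous.smul {d : ℤ} {f : (show Cob3 S D from X) ⟶ (show Cob3 S D from Y)}
    (h : IsHomogeneous S d f) (a : S) : IsHomogeneous S d (a • f) :=
  Submodule.smul_mem _ a h

theorem IsHomogeneous.neg {d : ℤ} {f : (show Cob3 S D from X) ⟶ (show Cob3 S D from Y)}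
    (h : IsHomogeneous S d f) : IsHomogeneous S d (-f) :=
  Submodule.neg_mem _ h

end Matrices

/-! ### Decompositions of the identities -/

section Isomorphisms

variable (S : Type u) [CommRing S] [Invertible (2 : S)] [Invertible (3 : S)]

/-- The relation is available for every model of the composites that occur in it, so explicit foams
can be inserted. -/
theorem id_circle : 𝟙 ((Quotient.functor (Rel S)).obj (circleWeb.formal S)) =
    (⅟3 : S) • (discPair 1 0).cls S - (⅟3 * ⅟3 : S) • chokePair.cls S +
      (⅟3 : S) • (discPair 0 1).cls S := by
  have h1 : Nonempty (Gluing (capFoam 1) (cupFoam 0) (discPair 1 0)) := capCup_gluing 1 0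
  have h2 : Nonempty (Gluing (capFoam 0) (cupFoam 1) (discPair 0 1)) := capCup_gluing 0 1
  have h := (LocalRel.neckCutting (S := S) _ _ _ h1.some chokeCapCup_gluing.some
    h2.some).linearCombination_eq_zero S
  rwa [map_sub, map_add, map_sub, Finsupp.linearCombination_single,
    Finsupp.linearCombination_single, Finsupp.linearCombination_single,
    Finsupp.linearCombination_single, one_smul, cls_idFoam, sub_eq_zero] at h

theorem id_bigon : 𝟙 ((Quotient.functor (Rel S)).obj (bigonWeb.formal S)) =
    (⅟2 : S) • (doubleBubble (tri 5 1 2)).cls S + (⅟2 : S) • (doubleBubble (tri 5 3 4)).cls S := by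
  have h := (LocalRel.tube (S := S) _ _ lowerKissUpperBubble_gluing.some
    lowerBubbleUpperKiss_gluing.some).linearCombination_eq_zero S
  rwa [map_sub, map_add, Finsupp.linearCombination_single, Finsupp.linearCombination_single,
    Finsupp.linearCombination_single, one_smul, cls_idFoam, sub_eq_zero] at h

theorem id_square : 𝟙 ((Quotient.functor (Rel S)).obj (squareWeb.formal S)) =
    -doubleRocketH.cls S - doubleRocketV.cls S := by
  have h := (LocalRel.rocket (S := S) _ _ doubleRocketH_gluing.some
    doubleRocketV_gluing.some).linearCombination_eq_zero S
  rw [map_add, map_add, Finsupp.linearCombination_single, Finsupp.linearCombination_single,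
    Finsupp.linearCombination_single, one_smul, one_smul, one_smul, cls_idFoam, add_assoc,
    add_eq_zero_iff_eq_neg, neg_add'] at h
  exact h

end Isomorphisms

/-! ### The three isomorphisms -/

section Isomorphisms

variable (S : Type u) [CommRing S] [Invertible (2 : S)] [Invertible (3 : S)]

theorem cls_surfaceFoam_zero : (surfaceFoam 0).cls S = 0 := cls_addFacet_zero S _

theorem cls_surfaceFoam_one : (surfaceFoam 1).cls S = (3 : S) • 𝟙 _ :=
  (cls_addFacet_one S _).trans (congrArg _ (cls_voidFoam S))

theorem cls_surfaceFoam_two : (surfaceFoam 2).cls S = 0 := cls_addFacet_two S _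

/-- The components of the isomorphism from the circle. -/
noncomputable def circleHom : ∀ j : Fin 3, (show Cob3 S emptyRim from qCircle 0) ⟶
    (show Cob3 S emptyRim from ![qEmpty (-2), qEmpty 0, qEmpty 2] j)
  | 0 => (capFoam 0).mor S (qCircle 0) (qEmpty (-2))
  | 1 => (⅟3 : S) • capChoke.mor S (qCircle 0) (qEmpty 0)
  | 2 => (⅟3 : S) • (capFoam 1).mor S (qCircle 0) (qEmpty 2)

/-- The components of the isomorphism to the circle. -/
noncomputable def circleInv : ∀ j : Fin 3,
    (show Cob3 S emptyRim from ![qEmpty (-2), qEmpty 0, qEmpty 2] j) ⟶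
      (show Cob3 S emptyRim from qCircle 0)
  | 0 => (⅟3 : S) • (cupFoam 1).mor S (qEmpty (-2)) (qCircle 0)
  | 1 => -((⅟3 : S) • cupChoke.mor S (qEmpty 0) (qCircle 0))
  | 2 => (cupFoam 0).mor S (qEmpty 2) (qCircle 0)

section Components

variable {S} {D : Rim} {X Y Z : GradedWeb D} {F : Foam X.web Y.web} {G : Foam Y.web Z.web}
  {f : (show Cob3 S D from X) ⟶ (show Cob3 S D from Y)}
  {g : (show Cob3 S D from Y) ⟶ (show Cob3 S D from Z)} {a b c : S}

/-- All matrix entries are multiples of foams, so a product of two entries is known once the glued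
foam is. -/
theorem comp_eq_gradedHom {H : Foam X.web Z.web} (h : Nonempty (Gluing F G H))
    (hf : f = a • F.mor S X Y) (hg : g = b • G.mor S Y Z) :
    f ≫ g = gradedHom S X Z ((a * b) • H.cls S) := by
  rw [hf, hg, Linear.smul_comp, Linear.comp_smul, mor_comp_mor h, smul_smul, map_smul]

theorem comp_eq_zero {H : Foam X.web Z.web} (h : Nonempty (Gluing F G H)) (hH : H.cls S = 0)
    (hf : f = a • F.mor S X Y) (hg : g = b • G.mor S Y Z) : f ≫ g = 0 := by
  rw [comp_eq_gradedHom h hf hg, hH, smul_zero, map_zero]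

theorem comp_eq_id {G : Foam Y.web X.web} {g : (show Cob3 S D from Y) ⟶ (show Cob3 S D from X)}
    {H : Foam X.web X.web} (h : Nonempty (Gluing F G H)) (hH : H.cls S = c • 𝟙 _)
    (hf : f = a • F.mor S X Y) (hg : g = b • G.mor S Y X) (hc : a * b * c = 1) : f ≫ g = 𝟙 _ := by
  rw [comp_eq_gradedHom h hf hg, hH, smul_smul, hc, one_smul]
  rfl

end Components

/-- The isomorphism of the circle with a sum of empty webs. -/
noncomputable def circleIso : (⟨Unit, fun _ => qCircle 0⟩ : Mat_ (Cob3 S emptyRim)) ≅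
    ⟨Fin 3, ![qEmpty (-2), qEmpty 0, qEmpty 2]⟩ := by
  have e00 : Nonempty (Gluing (cupFoam 0) (capFoam 0) (surfaceFoam 0)) := cupCap_gluing 0 0
  have e01 : Nonempty (Gluing (cupFoam 0) (capFoam 1) (surfaceFoam 1)) := cupCap_gluing 0 1
  have e10 : Nonempty (Gluing (cupFoam 1) (capFoam 0) (surfaceFoam 1)) := cupCap_gluing 1 0
  have e11 : Nonempty (Gluing (cupFoam 1) (capFoam 1) (surfaceFoam 2)) := cupCap_gluing 1 1
  have f01 : Nonempty (Gluing (capFoam 0) (cupFoam 1) (discPair 0 1)) := capCup_gluing 0 1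
  have f10 : Nonempty (Gluing (capFoam 1) (cupFoam 0) (discPair 1 0)) := capCup_gluing 1 0
  refine matIso (circleHom S) (circleInv S) ?_ ?_ ?_
  · rw [Fin.sum_univ_three]
    have h1 : circleHom S 0 ≫ circleInv S 0 = _ :=
      comp_eq_gradedHom (X := qCircle 0) (Y := qEmpty (-2)) (Z := qCircle 0) f01 (one_smul S
          _).symm rfl
    have h2 : circleHom S 1 ≫ circleInv S 1 = _ :=
      comp_eq_gradedHom (X := qCircle 0) (Y := qEmpty 0) (Z := qCircle 0) chokeCapCup_gluing rfl
          (neg_smul _ _).symm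
    have h3 : circleHom S 2 ≫ circleInv S 2 = _ :=
      comp_eq_gradedHom (X := qCircle 0) (Y := qEmpty 2) (Z := qCircle 0) f10 rfl (one_smul S
          _).symm
    rw [h1, h2, h3, ← map_add, ← map_add]
    refine (congrArg (gradedHom S (qCircle 0) (qCircle 0)) ?_).trans gradedHom_id
    refine Eq.trans ?_ (id_circle S).symm
    rw [one_mul, mul_one, mul_neg, neg_smul, sub_eq_add_neg]
    exact (add_comm _ _).trans ((congrArg (_ + ·) (add_comm _ _)).trans (add_assoc _ _ _).symm)
  · intro i
    match i with
    | 0 =>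
      exact comp_eq_id (X := qEmpty (-2)) (Y := qCircle 0) e10 (cls_surfaceFoam_one S) rfl
          (one_smul S _).symm (by simp)
    | 1 =>
      exact comp_eq_id (X := qEmpty 0) (Y := qCircle 0) (chokeChoke_gluing) (cls_chokeFoam S)
          (neg_smul _ _).symm rfl (by
        -- For `u = ⅟3 * 3` the scalar is `u²`, and `u² - 1 = (u + 1) (u - 1)`.
        have h3 : (⅟3 : S) * 3 = 1 := invOf_mul_self _
        linear_combination (⅟3 * 3 + 1 : S) * h3)
    | 2 =>
      exact comp_eq_id (X := qEmpty 2) (Y := qCircle 0) e01 (cls_surfaceFoam_one S) (one_smul S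
          _).symm rfl (by simp)
  · intro i j hij
    match i, j with
    | 0, 0 | 1, 1 | 2, 2 => exact absurd rfl hij
    | 0, 1 =>
      exact comp_eq_zero (X := qEmpty (-2)) (Y := qCircle 0) (Z := qEmpty 0) (cupChokeCap_gluing 1)
          (cls_thetaFoam S 1) rfl rfl
    | 0, 2 =>
      exact comp_eq_zero (X := qEmpty (-2)) (Y := qCircle 0) (Z := qEmpty 2) e11
          (cls_surfaceFoam_two S) rfl rfl
    | 1, 0 =>
      exact comp_eq_zero (X := qEmpty 0) (Y := qCircle 0) (Z := qEmpty (-2)) (chokeCupCap_gluing 0)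
          (cls_thetaFoam S 0) (neg_smul _ _).symm
        (one_smul S _).symm
    | 1, 2 =>
      exact comp_eq_zero (X := qEmpty 0) (Y := qCircle 0) (Z := qEmpty 2) (chokeCupCap_gluing 1)
          (cls_thetaFoam S 1) (neg_smul _ _).symm rfl
    | 2, 0 =>
      exact comp_eq_zero (X := qEmpty 2) (Y := qCircle 0) (Z := qEmpty (-2)) e00
          (cls_surfaceFoam_zero S) (one_smul S _).symm
        (one_smul S _).symm
    | 2, 1 =>
      exact comp_eq_zero (X := qEmpty 2) (Y := qCircle 0) (Z := qEmpty 0) (cupChokeCap_gluing 0)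
          (cls_thetaFoam S 0) (one_smul S _).symm rfl

/-- The components of the isomorphism from the bigon. -/
noncomputable def bigonHom : ∀ j : Fin 2, (show Cob3 S strandRim from qBigon 0) ⟶
    (show Cob3 S strandRim from ![qStrand (-1), qStrand 1] j)
  | 0 => lowerBubble.mor S (qBigon 0) (qStrand (-1))
  | 1 => (⅟2 : S) • lowerKiss.mor S (qBigon 0) (qStrand 1)

/-- The components of the isomorphism to the bigon. -/
noncomputable def bigonInv : ∀ j : Fin 2, (show Cob3 S strandRim from ![qStrand (-1), qStrand 1] j)
    ⟶
    (show Cob3 S strandRim from qBigon 0)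
  | 0 => (⅟2 : S) • upperKiss.mor S (qStrand (-1)) (qBigon 0)
  | 1 => upperBubble.mor S (qStrand 1) (qBigon 0)

/-- The isomorphism of the bigon with a sum of strands. -/
noncomputable def bigonIso : (⟨Unit, fun _ => qBigon 0⟩ : Mat_ (Cob3 S strandRim)) ≅
    ⟨Fin 2, ![qStrand (-1), qStrand 1]⟩ := by
  refine matIso (bigonHom S) (bigonInv S) ?_ ?_ ?_
  · rw [Fin.sum_univ_two]
    have h1 : bigonHom S 0 ≫ bigonInv S 0 = _ :=
      comp_eq_gradedHom (X := qBigon 0) (Y := qStrand (-1)) (Z := qBigon 0)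
          lowerBubbleUpperKiss_gluing (one_smul S _).symm rfl
    have h2 : bigonHom S 1 ≫ bigonInv S 1 = _ :=
      comp_eq_gradedHom (X := qBigon 0) (Y := qStrand 1) (Z := qBigon 0)
          lowerKissUpperBubble_gluing rfl (one_smul S _).symm
    rw [h1, h2, ← map_add]
    refine (congrArg (gradedHom S (qBigon 0) (qBigon 0)) ?_).trans gradedHom_id
    refine Eq.trans ?_ (id_bigon S).symm
    rw [one_mul, mul_one]
    exact add_comm _ _
  · intro i
    match i with
    | 0 =>
      exact comp_eq_id (X := qStrand (-1)) (Y := qBigon 0) upperKissBubble_gluing (cls_kissFoam S)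
          rfl (one_smul S _).symm (by simp)
    | 1 =>
      exact comp_eq_id (X := qStrand 1) (Y := qBigon 0) bubbleLowerKiss_gluing (cls_kissFoam S)
          (one_smul S _).symm rfl (by simp)
  · intro i j hij
    match i, j with
    | 0, 0 | 1, 1 => exact absurd rfl hij
    | 0, 1 =>
      exact comp_eq_zero (X := qStrand (-1)) (Y := qBigon 0) (Z := qStrand 1) doubleKiss_gluing
          (cls_doubleKissFoam S) rfl rfl
    | 1, 0 =>
      exact comp_eq_zero (X := qStrand 1) (Y := qBigon 0) (Z := qStrand (-1)) bubble_gluing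
          (cls_bubbleFoam S) (one_smul S _).symm
        (one_smul S _).symm

/-- The components of the isomorphism from the square. -/
noncomputable def squareHom : ∀ j : Fin 2, (show Cob3 S squareRim from qSquare 0) ⟶
    (show Cob3 S squareRim from ![qHorizontal 0, qVertical 0] j)
  | 0 => lowerRocketH.mor S (qSquare 0) (qHorizontal 0)
  | 1 => lowerRocketV.mor S (qSquare 0) (qVertical 0)

/-- The components of the isomorphism to the square. -/
noncomputable def squareInv : ∀ j : Fin 2,
    (show Cob3 S squareRim from ![qHorizontal 0, qVertical 0] j) ⟶
      (show Cob3 S squareRim from qSquare 0)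
  | 0 => -upperRocketH.mor S (qHorizontal 0) (qSquare 0)
  | 1 => -upperRocketV.mor S (qVertical 0) (qSquare 0)

/-- The isomorphism of the square with the sum of its smoothings. -/
noncomputable def squareIso : (⟨Unit, fun _ => qSquare 0⟩ : Mat_ (Cob3 S squareRim)) ≅
    ⟨Fin 2, ![qHorizontal 0, qVertical 0]⟩ := by
  refine matIso (squareHom S) (squareInv S) ?_ ?_ ?_
  · rw [Fin.sum_univ_two]
    have h1 : squareHom S 0 ≫ squareInv S 0 = _ :=
      comp_eq_gradedHom (X := qSquare 0) (Y := qHorizontal 0) (Z := qSquare 0) doubleRocketH_gluing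
          (one_smul S _).symm (neg_one_smul S _).symm
    have h2 : squareHom S 1 ≫ squareInv S 1 = _ :=
      comp_eq_gradedHom (X := qSquare 0) (Y := qVertical 0) (Z := qSquare 0) doubleRocketV_gluing
          (one_smul S _).symm (neg_one_smul S _).symm
    rw [h1, h2, ← map_add]
    refine (congrArg (gradedHom S (qSquare 0) (qSquare 0)) ?_).trans gradedHom_id
    refine Eq.trans ?_ (id_square S).symm
    rw [one_mul, neg_one_smul, neg_one_smul]
    exact (sub_eq_add_neg _ _).symm
  · intro i
    match i with
    | 0 =>
      exact comp_eq_id (X := qHorizontal 0) (Y := qSquare 0) rocketH_gluing ((cls_rocketFoamH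
          S).trans (neg_one_smul S _).symm)
        (neg_one_smul S _).symm (one_smul S _).symm (by simp)
    | 1 =>
      exact comp_eq_id (X := qVertical 0) (Y := qSquare 0) rocketV_gluing ((cls_rocketFoamV
          S).trans (neg_one_smul S _).symm)
        (neg_one_smul S _).symm (one_smul S _).symm (by simp)
  · intro i j hij
    match i, j with
    | 0, 0 | 1, 1 => exact absurd rfl hij
    | 0, 1 =>
      exact comp_eq_zero (X := qHorizontal 0) (Y := qSquare 0) (Z := qVertical 0) rocketHV_gluing
          (cls_rocketFoamHV S) (neg_one_smul S _).symm
        (one_smul S _).symm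
    | 1, 0 =>
      exact comp_eq_zero (X := qVertical 0) (Y := qSquare 0) (Z := qHorizontal 0) rocketVH_gluing
          (cls_rocketFoamVH S) (neg_one_smul S _).symm
        (one_smul S _).symm

end Isomorphisms

end SeamedFoam

theorem mainTheorem3 (S : Type*) [CommRing S] [Invertible (2 : S)] [Invertible (3 : S)] :
    (∃ φ : (⟨Unit, fun _ => qCircle 0⟩ : Mat_ (Cob3 S emptyRim)) ≅
        ⟨Fin 3, ![qEmpty (-2), qEmpty 0, qEmpty 2]⟩,
      IsGraded S φ.hom ∧ IsGraded S φ.inv ∧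
      φ.hom () 0 = (capFoam 0).mor S (qCircle 0) (qEmpty (-2)) ∧
      φ.hom () 1 = (⅟3 : S) • capChoke.mor S (qCircle 0) (qEmpty 0) ∧
      φ.hom () 2 = (⅟3 : S) • (capFoam 1).mor S (qCircle 0) (qEmpty 2) ∧
      φ.inv 0 () = (⅟3 : S) • (cupFoam 1).mor S (qEmpty (-2)) (qCircle 0) ∧
      φ.inv 1 () = -((⅟3 : S) • cupChoke.mor S (qEmpty 0) (qCircle 0)) ∧
      φ.inv 2 () = (cupFoam 0).mor S (qEmpty 2) (qCircle 0)) ∧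
    (∃ φ : (⟨Unit, fun _ => qBigon 0⟩ : Mat_ (Cob3 S strandRim)) ≅
        ⟨Fin 2, ![qStrand (-1), qStrand 1]⟩,
      IsGraded S φ.hom ∧ IsGraded S φ.inv ∧
      φ.hom () 0 = lowerBubble.mor S (qBigon 0) (qStrand (-1)) ∧
      φ.hom () 1 = (⅟2 : S) • lowerKiss.mor S (qBigon 0) (qStrand 1) ∧
      φ.inv 0 () = (⅟2 : S) • upperKiss.mor S (qStrand (-1)) (qBigon 0) ∧
      φ.inv 1 () = upperBubble.mor S (qStrand 1) (qBigon 0)) ∧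
    ∃ φ : (⟨Unit, fun _ => qSquare 0⟩ : Mat_ (Cob3 S squareRim)) ≅
        ⟨Fin 2, ![qHorizontal 0, qVertical 0]⟩,
      IsGraded S φ.hom ∧ IsGraded S φ.inv ∧
      φ.hom () 0 = lowerRocketH.mor S (qSquare 0) (qHorizontal 0) ∧
      φ.hom () 1 = lowerRocketV.mor S (qSquare 0) (qVertical 0) ∧
      φ.inv 0 () = -upperRocketH.mor S (qHorizontal 0) (qSquare 0) ∧
      φ.inv 1 () = -upperRocketV.mor S (qVertical 0) (qSquare 0) := by
  -- The entries are the prescribed ones by construction. Homogeneity remains: the degree of each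
  -- foam must be the shift of its source minus that of its target.
  refine ⟨⟨circleIso S, ?_, ?_, rfl, rfl, rfl, rfl, rfl, rfl⟩,
    ⟨bigonIso S, ?_, ?_, rfl, rfl, rfl, rfl⟩, squareIso S, ?_, ?_, rfl, rfl, rfl, rfl⟩
  · intro _ j
    match j with
    | 0 => exact isHomogeneous_mor (X := qCircle 0) (Y := qEmpty (-2)) (capFoam_deg 0)
    | 1 => exact (isHomogeneous_mor (X := qCircle 0) (Y := qEmpty 0) capChoke_deg).smul _
    | 2 => exact (isHomogeneous_mor (X := qCircle 0) (Y := qEmpty 2) (capFoam_deg 1)).smul _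
  · intro j _
    match j with
    | 0 => exact (isHomogeneous_mor (X := qEmpty (-2)) (Y := qCircle 0) (cupFoam_deg 1)).smul _
    | 1 => exact ((isHomogeneous_mor (X := qEmpty 0) (Y := qCircle 0) cupChoke_deg).smul _).neg
    | 2 => exact isHomogeneous_mor (X := qEmpty 2) (Y := qCircle 0) (cupFoam_deg 0)
  · intro _ j
    match j with
    | 0 => exact isHomogeneous_mor (X := qBigon 0) (Y := qStrand (-1)) lowerBubble_deg
    | 1 => exact (isHomogeneous_mor (X := qBigon 0) (Y := qStrand 1) lowerKiss_deg).smul _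
  · intro j _
    match j with
    | 0 => exact (isHomogeneous_mor (X := qStrand (-1)) (Y := qBigon 0) upperKiss_deg).smul _
    | 1 => exact isHomogeneous_mor (X := qStrand 1) (Y := qBigon 0) upperBubble_deg
  · intro _ j
    match j with
    | 0 => exact isHomogeneous_mor (X := qSquare 0) (Y := qHorizontal 0) lowerRocketH_deg
    | 1 => exact isHomogeneous_mor (X := qSquare 0) (Y := qVertical 0) lowerRocketV_deg
  · intro j _
    match j with
    | 0 => exact (isHomogeneous_mor (X := qHorizontal 0) (Y := qSquare 0) upperRocketH_deg).neg
    | 1 => exact (isHomogeneous_mor (X := qVertical 0) (Y := qSquare 0) upperRocketV_deg).neg
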